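/- Let $N\ge 1$, $0<\alpha<2$, $\beta\ge 0$, $p>1$, and let $h:(0,\infty)\to(0,\infty)$ be integrable on $(0,T)$ for every $T>0$. Put $\mathcal L=-\Delta+(-\Delta)^{\alpha/2}$ on $\mathbb R^N$ and consider $$\partial_t u+t^\beta\mathcal L u=-h(t)\,|u|^{p-1}u,\qquad u(0)=u_0,\tag{S1}$$ where $u_0\in L^\infty(\mathbb R^N)$ (for nonnegative $u$ the right-hand side is $-h(t)u^p$). Let $E_\alpha(\tau)=P_2(\tau)*P_\alpha(\tau)$, where $P_2(\tau,x)=(4\pi\tau)^{-N/2}e^{-|x|^2/(4\tau)}$ and $P_\alpha(\tau,x)=(2\pi)^{-N}\int_{\mathbb R^N}e^{ix\cdot\xi-\tau|\xi|^\alpha}\,d\xi$; for $0\le s\le t$ let $S(t,s)v=E_\alpha\big(\tfrac{t^{\beta+1}-s^{\beta+1}}{\beta+1}\big)*v$ if $s<t$, and $S(t,t)v=v$. A mild $L^\infty$ solution of (S1) on an interval $I=[0,T]$, $[0,T)$ or $[0,\infty)$ is a measurable function $u$ on $I\times\mathbb R^N$, with $u(t)\in L^\infty(\mathbb R^N)$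 for every $t\in I$ and $\sup_{t\in[0,T']}\|u(t)\|_\infty<\infty$ for every $T'\in I$, such that for every $t\in I$, almost everywhere on $\mathbb R^N$, $$u(t)=S(t,0)u_0-\int_0^t h(s)\,S(t,s)\big(|u(s)|^{p-1}u(s)\big)\,ds .$$ Solutions are identified if for every $t$ they agree almost everywhere on $\mathbb R^N$. Let $T_m\in[0,\infty]$ be the supremum of all $T>0$ for which a mild $L^\infty$ solution on $[0,T]$ exists. Then there is $T=T(u_0)$ with $0<T<T_m$ such that (S1) has a unique mild $L^\infty$ solution on $[0,T]$. Moreover: 1. This solution extends in a unique way to a mild $L^\infty$ solution $u$ on $[0,T_m)$; every mild $L^\infty$ solution on an interval $[0,T']$, $T'>0$, satisfies $T'<T_m$ and is the restriction of $u$. 2. If $T_m=\infty$, then $u$ is a global solution, i.e. a mild $L^\infty$ solution on $[0,\infty)$. 3. If $T_m<\infty$, then $\lim_{t\uparrow T_m}\|u(t)\|_{L^\infty(\mathbb R^N)}=\infty$. 4. If $u_0\ge 0$ a.e., then for every $t\in[0,T_m)$, $u(t)\ge 0$ a.e. 5. $u\in C((0,T_m),L^\infty(\mathbb R^N))$ and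 $u-S(\cdot,0)u_0\in C([0,T_m),L^\infty(\mathbb R^N))$. If $u_0$ agrees a.e. with a uniformly continuous function, then $u\in C([0,T_m),L^\infty(\mathbb R^N))$. If $1\le r<\infty$ and $u_0\in L^\infty(\mathbb R^N)\cap L^r(\mathbb R^N)$, then $u\in C([0,T_m),L^r(\mathbb R^N))$; in particular $u\in C([0,T_m),L^\infty(\mathbb R^N)\cap L^r(\mathbb R^N))$ if in addition $u_0$ agrees a.e. with a uniformly continuous function (for instance if $u_0\in C_0(\mathbb R^N)$). -/

import Mathlib

open MeasureTheory Set Filter Topology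
open scoped ENNReal

noncomputable section

namespace MixedDiffusion

/-- The space `ℝ^N` with its Euclidean norm. -/
abbrev RN (N : ℕ) : Type := EuclideanSpace ℝ (Fin N)

/-- The heat kernel of `-(-Δ)^{α/2}`, that is, the inverse Fourier transform of `exp (-t |ξ|^α)`:
`P_α(t, x) = (2π)^{-N} ∫ exp (i x·ξ - t |ξ|^α) dξ` (a real number, by the symmetry `ξ ↦ -ξ`). -/
def fracKernel (N : ℕ) (α t : ℝ) (x : RN N) : ℝ :=
  ((2 * Real.pi) ^ N)⁻¹ *
    (∫ ξ : RN N, Complex.exp (Complex.I * ((inner ℝ x ξ : ℝ) : ℂ)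
      - ((t * ‖ξ‖ ^ α : ℝ) : ℂ))).re

/-- The Gauss kernel, the heat kernel of `Δ`: `P_2(t, x) = (4πt)^{-N/2} exp (-|x|² / (4t))`. -/
def gaussKernel (N : ℕ) (t : ℝ) (x : RN N) : ℝ :=
  (4 * Real.pi * t) ^ (-(N : ℝ) / 2) * Real.exp (-‖x‖ ^ 2 / (4 * t))

/-- Convolution of real functions on `ℝ^N`: `(f * g)(x) = ∫ f(y) g(x - y) dy`. -/
def conv {N : ℕ} (f g : RN N → ℝ) : RN N → ℝ :=
  convolution f g (ContinuousLinearMap.mul ℝ ℝ) volume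

/-- The heat kernel `E_α(t) = P_2(t) * P_α(t)` of `-𝓛 = Δ - (-Δ)^{α/2}`, for `t > 0`. -/
def mixedKernel (N : ℕ) (α t : ℝ) : RN N → ℝ :=
  conv (gaussKernel N t) (fracKernel N α t)

/-- The semigroup `e^{-τ𝓛}`: `v ↦ E_α(τ) * v` for `τ > 0`, the identity for `τ = 0`. -/
def mixedSemigroup {N : ℕ} (α τ : ℝ) (v : RN N → ℝ) : RN N → ℝ :=
  if τ = 0 then v else conv (mixedKernel N α τ) v

/-- The evolution family of `∂_t u + t^β 𝓛 u = 0`: the map sending the state at time `s` to the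
state at time `t`, which is `e^{-τ𝓛}` with `τ = t^{β+1}/(β+1) - s^{β+1}/(β+1)`. -/
def evolution {N : ℕ} (α β t s : ℝ) (v : RN N → ℝ) : RN N → ℝ :=
  mixedSemigroup α (t ^ (β + 1) / (β + 1) - s ^ (β + 1) / (β + 1)) v

/-- `u` is a mild `L^∞` solution, on the time interval `I` (of the form `[0,T]`, `[0,T)` or
`[0,∞)`), of `∂_t u + t^β 𝓛 u = -h(t) |u|^{p-1} u`, `u(0) = u₀`. The function `u t` represents a
class of functions modulo equality almost everywhere. On `I = [0,T]` the first three fields say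
that `u` belongs to `L^∞([0,T], L^∞(ℝ^N))`. -/
structure IsMildSolution {N : ℕ} (α β p : ℝ) (h : ℝ → ℝ) (u₀ : RN N → ℝ)
    (I : Set ℝ) (u : ℝ → RN N → ℝ) : Prop where
  aestronglyMeasurable :
    AEStronglyMeasurable (Function.uncurry u) ((volume.restrict I).prod volume)
  memLp : ∀ t ∈ I, MemLp (u t) ∞ volume
  bounded : ∀ T ∈ I, ∃ M : ℝ, ∀ t ∈ Icc 0 T, ∀ᵐ x : RN N, |u t x| ≤ M
  duhamel : ∀ t ∈ I, ∀ᵐ x : RN N,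
    u t x = evolution α β t 0 u₀ x
      - ∫ s in (0 : ℝ)..t, h s * evolution α β t s (fun y => |u s y| ^ (p - 1) * u s y) x

/-- The maximal time `T_m = sup {T > 0 | there is a mild L^∞ solution on [0,T]}`, in `[0,∞]`. -/
def maximalTime {N : ℕ} (α β p : ℝ) (h : ℝ → ℝ) (u₀ : RN N → ℝ) : ℝ≥0∞ :=
  sSup {S : ℝ≥0∞ | ∃ T : ℝ, 0 < T ∧ S = ENNReal.ofReal T ∧
    ∃ u : ℝ → RN N → ℝ, IsMildSolution α β p h u₀ (Icc 0 T) u}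

/-- The interval `[0, S)` of real times, for `S` in `[0,∞]`. -/
def timesBefore (S : ℝ≥0∞) : Set ℝ := {t : ℝ | 0 ≤ t ∧ ENNReal.ofReal t < S}

/-- `u ∈ C(J, L^q(ℝ^N))`. -/
def ContinuousInLp {N : ℕ} (q : ℝ≥0∞) (J : Set ℝ) (u : ℝ → RN N → ℝ) : Prop :=
  (∀ t ∈ J, MemLp (u t) q volume) ∧
  ∀ t ∈ J, Tendsto (fun s => eLpNorm (u s - u t) q volume) (𝓝[J] t) (𝓝 0)

end MixedDiffusion

end

/-! The nonlinearity is absorbing, so bounded data never blow up: the proof builds a solution for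
all `t ≥ 0` at once, with `|u(t)| ≤ S(t,0)|u₀|`. Hence `T_m = ∞`. The local, maximal and global
statements become restrictions of one function, and the blow-up clause is vacuous.

Everything rests on the kernel `E_α(τ)` being nonnegative, of mass one, a convolution semigroup, and
continuous in `L¹` for `τ > 0`. Nonnegativity is subordination. Up to a constant, `|ξ|^α` is `∫ (1 -
exp(-s|ξ|²)) s^(-1-α/2) ds`; cutting the integral off near `s = 0` turns `exp(-t|ξ|^α)` into a limit
of constants times exponentials of Gaussian mixtures, all of which have nonnegative transforms once
multiplied by a Gaussian (`gaussPos_exp_neg_rpow`). The factor `P_2` supplies exactly such a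
Gaussian. Integrability then follows by Fatou, the mass and the semigroup law by Fourier inversion,
and `L¹` continuity by Scheffé.

For existence, write `K` for the primitive of the weight, take `|u₀| ≤ M`, and set `L = p M^(p-1)`.
On `[-M, M]` the function `v ↦ L v - |v|^(p-1) v` is nondecreasing and bounded by `L|v|`. Adding `h
L u` to both sides of the equation gives a Duhamel formula with factors `exp(±L K)` whose right-hand
side preserves order and maps functions dominated by `A(t) = S(t,0)|u₀|` to such functions
(`abs_relaxedMap_le`, `relaxedMap_mono`). Iterates started at `A` decrease to a fixed point
(`exists_relaxedMap_fixedPoint`). The semigroup law and an integration by parts remove the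
exponentials again (`duhamel_of_relaxed`). If `u₀ ≥ 0`, every iterate is nonnegative, hence so is
the limit.

Uniqueness is a Picard estimate with weight `exp(2 L K)`, each step of which gains a factor `1/2`
(`IsMildSolution.unique`). Continuity comes from Minkowski's integral inequality: the Duhamel term
is an integral of translates against a space-time kernel that is `L¹`-continuous in `t`, while the
linear part is `L¹`-continuous in its kernel for `t > 0` and at `t = 0` needs continuity of
translations on the datum. -/

noncomputable section

namespace MixedDiffusion

variable {N : ℕ}

/-! ### Cosine transforms -/

/-- The cosine transform `x ↦ ∫ cos (x·ξ) φ(ξ) dξ`. -/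
def cosTransform (φ : RN N → ℝ) (x : RN N) : ℝ := ∫ ξ : RN N, Real.cos (inner ℝ x ξ) * φ ξ

lemma integrable_cos_mul {φ : RN N → ℝ} (hφ : Integrable φ) (x : RN N) :
    Integrable fun ξ : RN N => Real.cos (inner ℝ x ξ) * φ ξ :=
  hφ.bdd_mul (c := 1) (by fun_prop) (ae_of_all _ fun ξ => by
    simpa using Real.abs_cos_le_one _)

lemma integrable_sin_mul {φ : RN N → ℝ} (hφ : Integrable φ) (x : RN N) :
    Integrable fun ξ : RN N => Real.sin (inner ℝ x ξ) * φ ξ :=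
  hφ.bdd_mul (c := 1) (by fun_prop) (ae_of_all _ fun ξ => by
    simpa using Real.abs_sin_le_one _)

lemma integral_sin_mul_of_even {φ : RN N → ℝ} (heven : ∀ ξ, φ (-ξ) = φ ξ) (x : RN N) :
    ∫ ξ : RN N, Real.sin (inner ℝ x ξ) * φ ξ = 0 := by
  have h := integral_neg_eq_self (fun ξ : RN N => Real.sin (inner ℝ x ξ) * φ ξ) volume
  simp only [inner_neg_right, Real.sin_neg, heven, neg_mul, integral_neg] at h
  linarith

lemma re_integral_cexp_mul {φ : RN N → ℝ} (hφ : Integrable φ) (x : RN N) :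
    (∫ ξ : RN N, Complex.exp (Complex.I * ((inner ℝ x ξ : ℝ) : ℂ)) * (φ ξ : ℂ)).re
      = cosTransform φ x := by
  have hi : Integrable fun ξ : RN N =>
      Complex.exp (Complex.I * ((inner ℝ x ξ : ℝ) : ℂ)) * (φ ξ : ℂ) := by
    refine hφ.ofReal.bdd_mul (c := 1) (by fun_prop) (ae_of_all _ fun ξ => ?_)
    rw [mul_comm, Complex.norm_exp_ofReal_mul_I]
  have := integral_re hi
  simp only [RCLike.re_to_complex] at this
  rw [← this, cosTransform]
  congr 1 with ξ
  rw [mul_comm Complex.I, Complex.re_mul_ofReal, Complex.exp_ofReal_mul_I_re]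

lemma im_integral_cexp_mul {φ : RN N → ℝ} (hφ : Integrable φ) (heven : ∀ ξ, φ (-ξ) = φ ξ)
    (x : RN N) :
    (∫ ξ : RN N, Complex.exp (Complex.I * ((inner ℝ x ξ : ℝ) : ℂ)) * (φ ξ : ℂ)).im = 0 := by
  have hi : Integrable fun ξ : RN N =>
      Complex.exp (Complex.I * ((inner ℝ x ξ : ℝ) : ℂ)) * (φ ξ : ℂ) := by
    refine hφ.ofReal.bdd_mul (c := 1) (by fun_prop) (ae_of_all _ fun ξ => ?_)
    rw [mul_comm, Complex.norm_exp_ofReal_mul_I]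
  have := integral_im hi
  simp only [RCLike.im_to_complex] at this
  rw [← this, ← integral_sin_mul_of_even heven x]
  congr 1 with ξ
  rw [mul_comm Complex.I, Complex.im_mul_ofReal, Complex.exp_ofReal_mul_I_im]

lemma integral_cexp_mul {φ : RN N → ℝ} (hφ : Integrable φ) (heven : ∀ ξ, φ (-ξ) = φ ξ)
    (x : RN N) :
    ∫ ξ : RN N, Complex.exp (Complex.I * ((inner ℝ x ξ : ℝ) : ℂ)) * (φ ξ : ℂ)
      = (cosTransform φ x : ℂ) :=
  Complex.ext (by simpa using re_integral_cexp_mul hφ x)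
    (by simpa using im_integral_cexp_mul hφ heven x)

lemma integrable_gauss {b : ℝ} (hb : 0 < b) :
    Integrable fun ξ : RN N => Real.exp (-b * ‖ξ‖ ^ 2) := by
  have h := (GaussianFourier.integrable_cexp_neg_mul_sq_norm_add (V := RN N) (b := (b : ℂ))
    (by simpa using hb) 0 0).re
  refine h.congr (ae_of_all _ fun ξ => ?_)
  have : (-(b : ℂ) * (‖ξ‖ : ℂ) ^ 2 + 0 * ((inner ℝ (0 : RN N) ξ : ℝ) : ℂ))
      = ((-b * ‖ξ‖ ^ 2 : ℝ) : ℂ) := by push_cast; ring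
  simp only [this, RCLike.re_to_complex]
  exact Complex.exp_ofReal_re _

lemma cosTransform_gauss {b : ℝ} (hb : 0 < b) (x : RN N) :
    cosTransform (fun ξ => Real.exp (-b * ‖ξ‖ ^ 2)) x
      = (Real.pi / b) ^ ((N : ℝ) / 2) * Real.exp (-‖x‖ ^ 2 / (4 * b)) := by
  rw [← re_integral_cexp_mul (integrable_gauss hb)]
  have h := GaussianFourier.integral_cexp_neg_mul_sq_norm_add (V := RN N) (b := (b : ℂ))
    (by simpa using hb) Complex.I x
  have e : ∀ ξ : RN N, Complex.exp (Complex.I * ((inner ℝ x ξ : ℝ) : ℂ))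
      * ((Real.exp (-b * ‖ξ‖ ^ 2) : ℝ) : ℂ)
      = Complex.exp (-(b : ℂ) * (‖ξ‖ : ℂ) ^ 2 + Complex.I * ((inner ℝ x ξ : ℝ) : ℂ)) := by
    intro ξ
    rw [Complex.ofReal_exp, ← Complex.exp_add]
    push_cast
    ring_nf
  simp_rw [e]
  rw [h]
  have : ((Real.pi : ℂ) / (b : ℂ)) ^ ((Module.finrank ℝ (RN N) : ℂ) / 2)
      * Complex.exp (Complex.I ^ 2 * (‖x‖ : ℂ) ^ 2 / (4 * (b : ℂ)))
      = (((Real.pi / b) ^ ((N : ℝ) / 2) * Real.exp (-‖x‖ ^ 2 / (4 * b)) : ℝ) : ℂ) := by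
    push_cast [Complex.ofReal_cpow (show 0 ≤ Real.pi / b by positivity)]
    simp
  rw [this, Complex.ofReal_re]

/-- Convolution of an even function with a cosine transform. -/
lemma integral_mul_cosTransform_sub {f g : RN N → ℝ} (hf : Integrable f) (hg : Integrable g)
    (heven : ∀ y, f (-y) = f y) (x : RN N) :
    ∫ y, f y * cosTransform g (x - y) = cosTransform (fun ξ => g ξ * cosTransform f ξ) x := by
  simp only [cosTransform]
  have hint : Integrable (Function.uncurry fun (y ξ : RN N) =>
      f y * (Real.cos (inner ℝ (x - y) ξ) * g ξ)) := by
    have h1 : Integrable (fun z : RN N × RN N => Real.cos (inner ℝ (x - z.1) z.2) * (f z.1 * g z.2))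
        (volume.prod volume) :=
      (hf.mul_prod hg).bdd_mul (c := 1) (by fun_prop) (ae_of_all _ fun ξ => by
        simpa using Real.abs_cos_le_one _)
    refine h1.congr (ae_of_all _ fun z => ?_)
    simp only [Function.uncurry]
    ring
  calc ∫ y, f y * ∫ ξ, Real.cos (inner ℝ (x - y) ξ) * g ξ
      = ∫ y, ∫ ξ, f y * (Real.cos (inner ℝ (x - y) ξ) * g ξ) := by
        simp_rw [integral_const_mul]
    _ = ∫ ξ, ∫ y, f y * (Real.cos (inner ℝ (x - y) ξ) * g ξ) := integral_integral_swap hint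
    _ = _ := by
        congr 1 with ξ
        -- Addition formula for the cosine; the sine part integrates to zero in `y` because `f` is
        -- even.
        have e : ∀ y, f y * (Real.cos (inner ℝ (x - y) ξ) * g ξ)
            = (Real.cos (inner ℝ x ξ) * g ξ) * (Real.cos (inner ℝ ξ y) * f y)
              + (Real.sin (inner ℝ x ξ) * g ξ) * (Real.sin (inner ℝ ξ y) * f y) := by
          intro y
          rw [inner_sub_left, Real.cos_sub, real_inner_comm ξ y]
          ring
        simp_rw [e]
        rw [integral_add ((integrable_cos_mul hf ξ).const_mul _)
          ((integrable_sin_mul hf ξ).const_mul _), integral_const_mul, integral_const_mul,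
          integral_sin_mul_of_even heven]
        ring

lemma integral_mul_cosTransform {f g : RN N → ℝ} (hf : Integrable f) (hg : Integrable g)
    (heven : ∀ y, f (-y) = f y) :
    ∫ y, f y * cosTransform g y = ∫ ξ, g ξ * cosTransform f ξ := by
  have h := integral_mul_cosTransform_sub hf hg heven 0
  simpa [cosTransform] using h

/-- Fourier inversion for cosine transforms. -/
lemma cosTransform_cosTransform {φ : RN N → ℝ} (hφ : Integrable φ) (hc : Continuous φ)
    (heven : ∀ ξ, φ (-ξ) = φ ξ) (hi : Integrable (cosTransform φ)) (ξ : RN N) :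
    cosTransform (cosTransform φ) ξ = (2 * Real.pi) ^ N * φ ξ := by
  have hpi : (0 : ℝ) < 2 * Real.pi := by positivity
  -- The dilation by `2π` converts the phase `x·ξ` to Mathlib's normalization `2π x·ξ`, and its
  -- Jacobian is the factor `(2π)^N`.
  set G : RN N → ℂ := fun η => (φ ((2 * Real.pi) • η) : ℂ) with hG
  have hGi : Integrable G := (hφ.comp_smul hpi.ne').ofReal
  have hGc : Continuous G := by fun_prop
  have key : ∀ x : RN N, FourierTransform.fourier G x
      = (((2 * Real.pi) ^ N)⁻¹ * cosTransform φ x : ℝ) := by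
    intro x
    rw [Real.fourier_eq']
    have e : ∀ v : RN N, Complex.exp (((-2 * Real.pi * inner ℝ v x : ℝ) : ℂ) * Complex.I) • G v
        = (fun ξ : RN N => Complex.exp (Complex.I * ((inner ℝ (-x) ξ : ℝ) : ℂ)) * (φ ξ : ℂ))
          ((2 * Real.pi) • v) := by
      intro v
      simp only [hG, smul_eq_mul]
      congr 2
      rw [inner_smul_right, inner_neg_left, real_inner_comm]
      push_cast
      ring
    rw [integral_congr_ae (ae_of_all _ e), Measure.integral_comp_smul volume (fun ξ : RN N =>
      Complex.exp (Complex.I * ((inner ℝ (-x) ξ : ℝ) : ℂ)) * (φ ξ : ℂ)) (2 * Real.pi), integral_cexp_mul hφ heven]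
    have : cosTransform φ (-x) = cosTransform φ x := by simp [cosTransform]
    rw [this]
    simp [abs_of_pos Real.pi_pos]
  have hFi : Integrable (FourierTransform.fourier G) := by
    have : FourierTransform.fourier G
        = fun x => ((((2 * Real.pi) ^ N)⁻¹ * cosTransform φ x : ℝ) : ℂ) := funext key
    rw [this]
    exact (hi.const_mul _).ofReal
  have hinv := congrFun (hGc.fourierInv_fourier_eq hGi hFi) ((2 * Real.pi)⁻¹ • ξ)
  rw [Real.fourierInv_eq'] at hinv
  have e : ∀ v : RN N, Complex.exp (((2 * Real.pi * inner ℝ v ((2 * Real.pi)⁻¹ • ξ) : ℝ) : ℂ)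
        * Complex.I) • FourierTransform.fourier G v
      = Complex.exp (Complex.I * ((inner ℝ ξ v : ℝ) : ℂ))
        * ((((2 * Real.pi) ^ N)⁻¹ * cosTransform φ v : ℝ) : ℂ) := by
    intro v
    rw [key, smul_eq_mul, inner_smul_right, real_inner_comm, mul_inv_cancel_left₀ hpi.ne',
      mul_comm Complex.I]
  simp_rw [e] at hinv
  have hre := congrArg Complex.re hinv
  rw [re_integral_cexp_mul (hi.const_mul _)] at hre
  simp only [hG, Complex.ofReal_re, smul_smul, mul_inv_cancel₀ hpi.ne', one_smul] at hre
  rw [← hre]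
  simp only [cosTransform]
  rw [← integral_const_mul]
  congr 1 with v
  field_simp


lemma continuous_cosTransform {φ : RN N → ℝ} (hφ : Integrable φ) :
    Continuous (cosTransform φ) := by
  refine continuous_of_dominated (bound := fun ξ => |φ ξ|)
    (fun x => (integrable_cos_mul hφ x).aestronglyMeasurable) (fun x => ae_of_all _ fun ξ => ?_)
    hφ.abs (ae_of_all _ fun ξ => by fun_prop)
  rw [norm_mul, Real.norm_eq_abs, Real.norm_eq_abs]
  exact mul_le_of_le_one_left (abs_nonneg _) (Real.abs_cos_le_one _)

/-! ### Positivity of the kernel -/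

/-- Bounded measurable functions whose product with every Gaussian has a nonnegative cosine
transform. -/
structure GaussPos (φ : RN N → ℝ) : Prop where
  measurable : Measurable φ
  bounded : ∃ C, ∀ ξ, |φ ξ| ≤ C
  nonneg : ∀ b, 0 < b → ∀ x, 0 ≤ cosTransform (fun ξ => Real.exp (-b * ‖ξ‖ ^ 2) * φ ξ) x

namespace GaussPos

variable {φ ψ : RN N → ℝ}

lemma integrable (hφ : GaussPos φ) {b : ℝ} (hb : 0 < b) :
    Integrable fun ξ => Real.exp (-b * ‖ξ‖ ^ 2) * φ ξ := by
  obtain ⟨C, hC⟩ := hφ.bounded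
  exact (integrable_gauss hb).mul_bdd (c := C) hφ.measurable.aestronglyMeasurable
    (ae_of_all _ fun ξ => hC ξ)

lemma one : GaussPos (fun _ : RN N => (1 : ℝ)) where
  measurable := measurable_const
  bounded := ⟨1, by simp⟩
  nonneg b hb x := by
    simp only [mul_one]
    rw [cosTransform_gauss hb]
    positivity

lemma const_mul (hφ : GaussPos φ) {c : ℝ} (hc : 0 ≤ c) : GaussPos fun ξ => c * φ ξ where
  measurable := hφ.measurable.const_mul c
  bounded := by
    obtain ⟨C, hC⟩ := hφ.bounded
    exact ⟨c * C, fun ξ => by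
      rw [abs_mul, abs_of_nonneg hc]
      exact mul_le_mul_of_nonneg_left (hC ξ) hc⟩
  nonneg b hb x := by
    have h := mul_nonneg hc (hφ.nonneg b hb x)
    rw [cosTransform, ← integral_const_mul] at h
    rw [cosTransform]
    convert! h using 3
    ring

lemma add (hφ : GaussPos φ) (hψ : GaussPos ψ) : GaussPos fun ξ => φ ξ + ψ ξ where
  measurable := hφ.measurable.add hψ.measurable
  bounded := by
    obtain ⟨C, hC⟩ := hφ.bounded
    obtain ⟨D, hD⟩ := hψ.bounded
    exact ⟨C + D, fun ξ => (abs_add_le _ _).trans (add_le_add (hC ξ) (hD ξ))⟩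
  nonneg b hb x := by
    have h := add_nonneg (hφ.nonneg b hb x) (hψ.nonneg b hb x)
    simp only [cosTransform] at h ⊢
    rw [← integral_add (integrable_cos_mul (hφ.integrable hb) x)
      (integrable_cos_mul (hψ.integrable hb) x)] at h
    simpa only [mul_add] using h

lemma sum_range {f : ℕ → RN N → ℝ} (hf : ∀ i, GaussPos (f i)) (n : ℕ) :
    GaussPos fun ξ => ∑ i ∈ Finset.range n, f i ξ := by
  induction n with
  | zero => simpa using (const_mul one le_rfl : GaussPos fun _ : RN N => (0 : ℝ) * 1)
  | succ n ih => simpa only [Finset.sum_range_succ] using ih.add (hf n)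

/-- The Gaussian in the definition of the class, times `C`, is an integrable majorant, so bounded
pointwise limits pass through the transform although the functions themselves need not be
integrable. -/
lemma of_tendsto {f : ℕ → RN N → ℝ} (hf : ∀ n, GaussPos (f n)) {C : ℝ}
    (hC : ∀ n ξ, |f n ξ| ≤ C) (hlim : ∀ ξ, Tendsto (fun n => f n ξ) atTop (𝓝 (φ ξ))) :
    GaussPos φ where
  measurable := measurable_of_tendsto_metrizable (fun n => (hf n).measurable)
    (tendsto_pi_nhds.2 hlim)
  bounded := ⟨C, fun ξ => le_of_tendsto (hlim ξ).abs (Eventually.of_forall fun n => hC n ξ)⟩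
  nonneg b hb x := by
    refine ge_of_tendsto' (x := atTop) (?_ : Tendsto (fun n =>
      cosTransform (fun ξ => Real.exp (-b * ‖ξ‖ ^ 2) * f n ξ) x) atTop _)
      fun n => (hf n).nonneg b hb x
    refine tendsto_integral_of_dominated_convergence (fun ξ => Real.exp (-b * ‖ξ‖ ^ 2) * C)
      (fun n => (integrable_cos_mul ((hf n).integrable hb) x).aestronglyMeasurable)
      ((integrable_gauss hb).mul_const C) (fun n => ae_of_all _ fun ξ => ?_)
      (ae_of_all _ fun ξ => ((hlim ξ).const_mul _).const_mul _)
    rw [Real.norm_eq_abs, abs_mul, abs_mul, Real.abs_exp]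
    exact (mul_le_of_le_one_left (by positivity) (Real.abs_cos_le_one _)).trans
      (mul_le_mul_of_nonneg_left (hC n ξ) (Real.exp_nonneg _))

/-- Mixtures of Gaussians are multipliers of the class. -/
lemma mul_mixture (hφ : GaussPos φ) {ε : ℝ} (hε : 0 ≤ ε) {w : ℝ → ℝ} (hw : Measurable w)
    (hwi : IntegrableOn w (Ioi ε)) (hw0 : ∀ s ∈ Ioi ε, 0 ≤ w s) :
    GaussPos fun ξ => φ ξ * ∫ s in Ioi ε, Real.exp (-s * ‖ξ‖ ^ 2) * w s where
  measurable := by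
    refine hφ.measurable.mul ?_
    have : StronglyMeasurable (Function.uncurry fun (ξ : RN N) (s : ℝ) =>
      Real.exp (-s * ‖ξ‖ ^ 2) * w s) := by
      apply Measurable.stronglyMeasurable
      simp only [Function.uncurry_def]
      fun_prop
    exact (StronglyMeasurable.integral_prod_right (ν := volume.restrict (Ioi ε)) this).measurable
  bounded := by
    obtain ⟨C, hC⟩ := hφ.bounded
    refine ⟨C * ∫ s in Ioi ε, w s, fun ξ => ?_⟩
    rw [abs_mul]
    refine mul_le_mul (hC ξ) ?_ (abs_nonneg _) ((abs_nonneg _).trans (hC ξ))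
    rw [← Real.norm_eq_abs]
    refine norm_integral_le_of_norm_le hwi ?_
    filter_upwards [ae_restrict_mem measurableSet_Ioi] with s hs
    have h0 : (0 : ℝ) ≤ s := hε.trans (le_of_lt hs)
    rw [norm_mul, Real.norm_eq_abs, Real.norm_eq_abs, Real.abs_exp, abs_of_nonneg (hw0 s hs)]
    refine mul_le_of_le_one_left (hw0 s hs) (Real.exp_le_one_iff.2 ?_)
    have : 0 ≤ s * ‖ξ‖ ^ 2 := by positivity
    linarith
  nonneg b hb x := by
    have hint : Integrable (Function.uncurry fun (ξ : RN N) (s : ℝ) =>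
        Real.cos (inner ℝ x ξ) * (Real.exp (-(b + s) * ‖ξ‖ ^ 2) * φ ξ) * w s)
        (volume.prod (volume.restrict (Ioi ε))) := by
      refine ((hφ.integrable hb).abs.mul_prod hwi).mono' ?_ ?_
      · have := hφ.measurable
        apply Measurable.aestronglyMeasurable
        simp only [Function.uncurry_def]
        fun_prop
      · have hq : ∀ᵐ z : RN N × ℝ ∂(volume.prod (volume.restrict (Ioi ε))), z.2 ∈ Ioi ε :=
          Measure.quasiMeasurePreserving_snd.ae (ae_restrict_mem measurableSet_Ioi)
        filter_upwards [hq] with z hz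
        have h0 : (0 : ℝ) ≤ z.2 := hε.trans (le_of_lt hz)
        simp only [Function.uncurry, norm_mul, Real.norm_eq_abs, abs_mul, Real.abs_exp]
        rw [abs_of_nonneg (hw0 _ hz)]
        refine mul_le_mul_of_nonneg_right ?_ (hw0 _ hz)
        refine (mul_le_of_le_one_left (by positivity) (Real.abs_cos_le_one _)).trans ?_
        refine mul_le_mul_of_nonneg_right (Real.exp_le_exp.2 ?_) (abs_nonneg _)
        have : 0 ≤ z.2 * ‖z.1‖ ^ 2 := by positivity
        linarith
    -- The Gaussians with parameters `b` and `s` merge into one with parameter `b + s`. This is why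
    -- the class asks for positivity for every `b`.
    have e : cosTransform (fun ξ => Real.exp (-b * ‖ξ‖ ^ 2) *
          (φ ξ * ∫ s in Ioi ε, Real.exp (-s * ‖ξ‖ ^ 2) * w s)) x
        = ∫ s in Ioi ε, cosTransform (fun ξ => Real.exp (-(b + s) * ‖ξ‖ ^ 2) * φ ξ) x * w s := by
      simp only [cosTransform, ← integral_mul_const]
      rw [← integral_integral_swap hint]
      congr 1 with ξ
      rw [← integral_const_mul, ← integral_const_mul, ← integral_const_mul]
      congr 1 with s
      rw [neg_add, add_mul, Real.exp_add]
      ring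
    rw [e]
    refine setIntegral_nonneg measurableSet_Ioi fun s hs => mul_nonneg (hφ.nonneg _ ?_ x) (hw0 s hs)
    have : ε < s := hs
    linarith

/-- Powers of the mixture lie in the class by repeated use of `mul_mixture`; the exponential series
has nonnegative coefficients, and its partial sums stay below the exponential of a bound for the
mixture. -/
lemma exp_mixture {ε : ℝ} (hε : 0 ≤ ε) {w : ℝ → ℝ} (hw : Measurable w)
    (hwi : IntegrableOn w (Ioi ε)) (hw0 : ∀ s ∈ Ioi ε, 0 ≤ w s) :
    GaussPos fun ξ : RN N => Real.exp (∫ s in Ioi ε, Real.exp (-s * ‖ξ‖ ^ 2) * w s) := by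
  set q : RN N → ℝ := fun ξ => ∫ s in Ioi ε, Real.exp (-s * ‖ξ‖ ^ 2) * w s with hq
  have hpow : ∀ k : ℕ, GaussPos fun ξ => q ξ ^ k := by
    intro k
    induction k with
    | zero => simpa using one
    | succ k ih => exact ih.mul_mixture hε hw hwi hw0
  have hq0 : ∀ ξ, 0 ≤ q ξ := fun ξ => setIntegral_nonneg measurableSet_Ioi fun s hs =>
    mul_nonneg (Real.exp_nonneg _) (hw0 s hs)
  obtain ⟨C, hC⟩ := (hpow 1).bounded
  refine of_tendsto (f := fun n ξ => ∑ i ∈ Finset.range n, ((i.factorial : ℝ))⁻¹ * q ξ ^ i)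
    (sum_range fun i => (hpow i).const_mul (by positivity)) (C := Real.exp C)
    (fun n ξ => ?_) (fun ξ => ?_)
  · rw [abs_of_nonneg (Finset.sum_nonneg fun i _ => mul_nonneg (by positivity)
      (pow_nonneg (hq0 ξ) i))]
    refine le_trans ?_ (Real.exp_le_exp.2 (le_of_abs_le (by simpa using hC ξ)))
    refine le_trans (le_of_eq ?_) (Real.sum_le_exp_of_nonneg (hq0 ξ) n)
    exact Finset.sum_congr rfl fun i _ => by rw [div_eq_inv_mul]
  · have := (NormedSpace.expSeries_div_hasSum_exp (𝔸 := ℝ) (q ξ)).tendsto_sum_nat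
    rw [← Real.exp_eq_exp_ℝ] at this
    simpa only [div_eq_inv_mul] using this

end GaussPos

/-! ### The subordination integral -/

/-- Near `0` the bound `1 - exp(-s) ≤ s` leaves `s^(-a)`, integrable as `a < 1`; at infinity the
first factor is at most `1` and `a > 0` suffices. -/
lemma integrableOn_levy {a : ℝ} (ha0 : 0 < a) (ha1 : a < 1) :
    IntegrableOn (fun s : ℝ => (1 - Real.exp (-s)) * s ^ (-1 - a)) (Ioi 0) := by
  have hm : Measurable fun s : ℝ => (1 - Real.exp (-s)) * s ^ (-1 - a) := by fun_prop
  rw [← Ioc_union_Ioi_eq_Ioi (zero_le_one (α := ℝ))]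
  refine IntegrableOn.union ?_ ?_
  · have h1 : IntegrableOn (fun s : ℝ => s ^ (-a)) (Ioc 0 1) := by
      rw [← intervalIntegrable_iff_integrableOn_Ioc_of_le zero_le_one]
      exact intervalIntegral.intervalIntegrable_rpow' (by linarith)
    refine h1.mono' hm.aestronglyMeasurable ?_
    filter_upwards [ae_restrict_mem measurableSet_Ioc] with s hs
    have e0 : 0 ≤ 1 - Real.exp (-s) := by
      have := Real.exp_le_one_iff.2 (neg_nonpos.2 hs.1.le); linarith
    have e1 : 1 - Real.exp (-s) ≤ s := by have := Real.add_one_le_exp (-s); linarith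
    rw [Real.norm_eq_abs, abs_of_nonneg (mul_nonneg e0 (Real.rpow_nonneg hs.1.le _))]
    calc _ ≤ s * s ^ (-1 - a) := mul_le_mul_of_nonneg_right e1 (Real.rpow_nonneg hs.1.le _)
      _ = s ^ (-a) := by
        nth_rw 1 [← Real.rpow_one s]
        rw [← Real.rpow_add hs.1]
        ring_nf
  · refine (integrableOn_Ioi_rpow_of_lt (a := -1 - a) (by linarith) zero_lt_one).mono'
      hm.aestronglyMeasurable ?_
    filter_upwards [ae_restrict_mem measurableSet_Ioi] with s hs
    have hs0 : (0 : ℝ) < s := zero_lt_one.trans hs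
    have e0 : 0 ≤ 1 - Real.exp (-s) := by
      have := Real.exp_le_one_iff.2 (neg_nonpos.2 hs0.le); linarith
    rw [Real.norm_eq_abs, abs_of_nonneg (mul_nonneg e0 (Real.rpow_nonneg hs0.le _))]
    refine mul_le_of_le_one_left (Real.rpow_nonneg hs0.le _) ?_
    have := Real.exp_pos (-s); linarith

lemma levy_const_pos {a : ℝ} (ha0 : 0 < a) (ha1 : a < 1) :
    0 < ∫ s in Ioi (0 : ℝ), (1 - Real.exp (-s)) * s ^ (-1 - a) := by
  rw [setIntegral_pos_iff_support_of_nonneg_ae _ (integrableOn_levy ha0 ha1)]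
  · refine lt_of_lt_of_le (?_ : 0 < volume (Ioi (0 : ℝ))) (measure_mono fun s hs => ⟨?_, hs⟩)
    · simp
    · have hs0 : (0 : ℝ) < s := hs
      have : Real.exp (-s) < 1 := Real.exp_lt_one_iff.2 (by linarith)
      exact (mul_pos (by linarith) (Real.rpow_pos_of_pos hs0 _)).ne'
  · filter_upwards [ae_restrict_mem measurableSet_Ioi] with s hs
    have hs0 : (0 : ℝ) < s := hs
    have : Real.exp (-s) < 1 := Real.exp_lt_one_iff.2 (by linarith)
    exact mul_nonneg (by linarith) (Real.rpow_nonneg hs0.le _)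

lemma levy_scaling {a lam : ℝ} (ha0 : 0 < a) (ha1 : a < 1) (hl : 0 ≤ lam) :
    IntegrableOn (fun s : ℝ => (1 - Real.exp (-s * lam)) * s ^ (-1 - a)) (Ioi 0) ∧
    ∫ s in Ioi (0 : ℝ), (1 - Real.exp (-s * lam)) * s ^ (-1 - a)
      = lam ^ a * ∫ s in Ioi (0 : ℝ), (1 - Real.exp (-s)) * s ^ (-1 - a) := by
  rcases hl.eq_or_lt with rfl | hl
  · simp [Real.zero_rpow ha0.ne']
  set g : ℝ → ℝ := fun s => (1 - Real.exp (-s)) * s ^ (-1 - a) with hg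
  have e : EqOn (fun s : ℝ => (1 - Real.exp (-s * lam)) * s ^ (-1 - a))
      (fun s => lam ^ (1 + a) * g (lam * s)) (Ioi 0) := by
    intro s hs
    have hs0 : (0 : ℝ) < s := hs
    simp only [hg]
    rw [Real.mul_rpow hl.le hs0.le, show -(lam * s) = -s * lam by ring]
    have : lam ^ (1 + a) * lam ^ (-1 - a) = 1 := by
      rw [← Real.rpow_add hl]; ring_nf; exact Real.rpow_zero _
    linear_combination -(1 - Real.exp (-s * lam)) * s ^ (-1 - a) * this
  constructor
  · refine IntegrableOn.congr_fun ?_ e.symm measurableSet_Ioi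
    refine Integrable.const_mul ?_ _
    have := (integrableOn_Ioi_comp_mul_left_iff g 0 hl).2
      (by simpa using integrableOn_levy ha0 ha1)
    exact this
  · rw [setIntegral_congr_fun measurableSet_Ioi e, integral_const_mul,
      integral_comp_mul_left_Ioi g 0 hl, mul_zero, smul_eq_mul, ← mul_assoc]
    congr 1
    rw [← Real.rpow_neg_one lam, ← Real.rpow_add hl]
    ring_nf

/-- Subordination through compound Poisson approximation. With the jump measure `w` restricted to `s
> ε` its total mass is finite, so the symbol splits into a positive constant times the exponential
of a Gaussian mixture. Letting `ε → 0` and using `levy_scaling` with `‖ξ‖²` and exponent `α/2`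
recovers `t ‖ξ‖^α`. -/
lemma gaussPos_exp_neg_rpow {α t : ℝ} (hα0 : 0 < α) (hα2 : α < 2) (ht : 0 < t) :
    GaussPos fun ξ : RN N => Real.exp (-(t * ‖ξ‖ ^ α)) := by
  set a := α / 2 with ha
  have ha0 : 0 < a := by positivity
  have ha1 : a < 1 := by rw [ha]; linarith
  set c := ∫ s in Ioi (0 : ℝ), (1 - Real.exp (-s)) * s ^ (-1 - a) with hc
  have hc0 : 0 < c := levy_const_pos ha0 ha1
  -- The factor `t / c` normalizes the exponent to `t ‖ξ‖^α`. This density is not integrable at `0`,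
  -- whence the cutoffs `1 / (n + 1)`.
  set w : ℝ → ℝ := fun s => t / c * s ^ (-1 - a) with hw
  have hwm : Measurable w := by fun_prop
  have hε : ∀ n : ℕ, (0 : ℝ) < 1 / ((n : ℝ) + 1) := fun n => by positivity
  have hwi : ∀ n : ℕ, IntegrableOn w (Ioi (1 / ((n : ℝ) + 1))) := fun n =>
    (integrableOn_Ioi_rpow_of_lt (by linarith) (hε n)).const_mul _
  have hw0 : ∀ n : ℕ, ∀ s ∈ Ioi (1 / ((n : ℝ) + 1)), 0 ≤ w s := fun n s hs => by
    have : (0 : ℝ) ≤ s := (hε n).le.trans (le_of_lt hs)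
    positivity
  have hd0 : ∀ (ξ : RN N) (s : ℝ), 0 ≤ s → 0 ≤ 1 - Real.exp (-s * ‖ξ‖ ^ 2) := fun ξ s hs => by
    have : Real.exp (-s * ‖ξ‖ ^ 2) ≤ 1 := Real.exp_le_one_iff.2 (by
      have : 0 ≤ s * ‖ξ‖ ^ 2 := by positivity
      linarith)
    linarith
  have hexpi : ∀ (n : ℕ) (ξ : RN N), IntegrableOn (fun s => Real.exp (-s * ‖ξ‖ ^ 2) * w s)
      (Ioi (1 / ((n : ℝ) + 1))) := fun n ξ => by
    refine (hwi n).bdd_mul (c := 1) (by fun_prop) ?_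
    filter_upwards [ae_restrict_mem measurableSet_Ioi] with s hs
    have : (0 : ℝ) ≤ s := (hε n).le.trans (le_of_lt hs)
    rw [Real.norm_eq_abs, Real.abs_exp]
    have := hd0 ξ s this
    linarith
  have hψ : ∀ (n : ℕ) (ξ : RN N),
      Real.exp (-∫ s in Ioi (1 / ((n : ℝ) + 1)), (1 - Real.exp (-s * ‖ξ‖ ^ 2)) * w s)
      = Real.exp (-∫ s in Ioi (1 / ((n : ℝ) + 1)), w s)
        * Real.exp (∫ s in Ioi (1 / ((n : ℝ) + 1)), Real.exp (-s * ‖ξ‖ ^ 2) * w s) := by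
    intro n ξ
    rw [← Real.exp_add]
    congr 1
    simp only [sub_mul, one_mul]
    rw [integral_sub (hwi n) (hexpi n ξ)]
    ring
  refine GaussPos.of_tendsto (f := fun n ξ =>
    Real.exp (-∫ s in Ioi (1 / ((n : ℝ) + 1)), (1 - Real.exp (-s * ‖ξ‖ ^ 2)) * w s)) (C := 1)
    (fun n => ?_) (fun n ξ => ?_) (fun ξ => ?_)
  · simp only [hψ]
    exact (GaussPos.exp_mixture (hε n).le hwm (hwi n) (hw0 n)).const_mul (Real.exp_nonneg _)
  · rw [Real.abs_exp, Real.exp_le_one_iff, neg_nonpos]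
    exact setIntegral_nonneg measurableSet_Ioi fun s hs =>
      mul_nonneg (hd0 ξ s ((hε n).le.trans (le_of_lt hs))) (hw0 n s hs)
  · refine (Real.continuous_exp.tendsto _).comp (Tendsto.neg ?_)
    obtain ⟨h1, h2⟩ := levy_scaling ha0 ha1 (sq_nonneg ‖ξ‖)
    have e : ∀ s, (1 - Real.exp (-s * ‖ξ‖ ^ 2)) * w s
        = t / c * ((1 - Real.exp (-s * ‖ξ‖ ^ 2)) * s ^ (-1 - a)) := fun s => by
      simp only [hw]; ring
    have h3 := (aecover_Ioi_of_Ioi (μ := volume) (A := (0 : ℝ))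
      (tendsto_one_div_add_atTop_nhds_zero_nat (𝕜 := ℝ))).integral_tendsto_of_countably_generated
      (h1.const_mul (t / c))
    have hfin : t * ‖ξ‖ ^ α = t / c * ((‖ξ‖ ^ 2) ^ a * c) := by
      rw [← Real.rpow_natCast, ← Real.rpow_mul (norm_nonneg _), ha,
        show ((2 : ℕ) : ℝ) * (α / 2) = α by push_cast; ring]
      field_simp
    rw [integral_const_mul, h2, ← hfin] at h3
    refine h3.congr fun n => ?_
    rw [Measure.restrict_restrict measurableSet_Ioi,
      inter_eq_left.2 (Ioi_subset_Ioi (hε n).le)]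
    simp only [e]

/-! ### The mixed heat kernel -/

lemma integrable_exp_neg_rpow {α t : ℝ} (hα0 : 0 < α) (ht : 0 < t) :
    Integrable fun ξ : RN N => Real.exp (-(t * ‖ξ‖ ^ α)) := by
  -- Polar coordinates need a nontrivial space; in dimension zero the domain is a point.
  rcases N.eq_zero_or_pos with rfl | hN
  · refine Continuous.integrable_of_hasCompactSupport ?_ (HasCompactSupport.of_compactSpace _)
    exact continuous_of_discreteTopology
  · have : Nonempty (Fin N) := ⟨⟨0, hN⟩⟩
    have h := integrableOn_rpow_mul_exp_neg_mul_rpow (p := α) (s := (N : ℝ) - 1) (b := t)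
      (by have : (1 : ℝ) ≤ N := by exact_mod_cast hN
          linarith) hα0 ht
    have h2 := (integrable_fun_norm_addHaar (volume : Measure (RN N))
      (f := fun r => Real.exp (-(t * r ^ α)))).2
    refine h2 (h.congr_fun (fun r hr => ?_) measurableSet_Ioi)
    simp only [smul_eq_mul, finrank_euclideanSpace, Fintype.card_fin]
    rw [← Real.rpow_natCast, Nat.cast_sub hN, Nat.cast_one, neg_mul]

/-- The Fourier symbol of the mixed heat kernel. -/
def mixedSymbol (N : ℕ) (α t : ℝ) (ξ : RN N) : ℝ :=
  Real.exp (-t * ‖ξ‖ ^ 2) * Real.exp (-(t * ‖ξ‖ ^ α))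

lemma mixedSymbol_pos (α t : ℝ) (ξ : RN N) : 0 < mixedSymbol N α t ξ := by
  unfold mixedSymbol; positivity

lemma mixedSymbol_le_gauss {α t : ℝ} (ht : 0 ≤ t) (ξ : RN N) :
    mixedSymbol N α t ξ ≤ Real.exp (-t * ‖ξ‖ ^ 2) := by
  refine mul_le_of_le_one_right (Real.exp_nonneg _) (Real.exp_le_one_iff.2 ?_)
  rw [neg_nonpos]
  positivity

lemma mixedSymbol_le_one {α t : ℝ} (ht : 0 ≤ t) (ξ : RN N) : mixedSymbol N α t ξ ≤ 1 := by
  refine (mixedSymbol_le_gauss ht ξ).trans (Real.exp_le_one_iff.2 ?_)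
  have : 0 ≤ t * ‖ξ‖ ^ 2 := by positivity
  linarith

lemma mixedSymbol_neg (α t : ℝ) (ξ : RN N) : mixedSymbol N α t (-ξ) = mixedSymbol N α t ξ := by
  simp [mixedSymbol]

lemma mixedSymbol_add (α s t : ℝ) (ξ : RN N) :
    mixedSymbol N α s ξ * mixedSymbol N α t ξ = mixedSymbol N α (s + t) ξ := by
  simp only [mixedSymbol, ← Real.exp_add]
  ring_nf

lemma continuous_mixedSymbol {α : ℝ} (hα0 : 0 < α) (t : ℝ) :
    Continuous (mixedSymbol N α t) := by
  unfold mixedSymbol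
  have : Continuous fun ξ : RN N => ‖ξ‖ ^ α := continuous_norm.rpow_const fun _ => Or.inr hα0.le
  fun_prop

lemma integrable_mixedSymbol {α t : ℝ} (hα0 : 0 < α) (ht : 0 < t) :
    Integrable (mixedSymbol N α t) :=
  (integrable_gauss ht).mono' (continuous_mixedSymbol hα0 t).aestronglyMeasurable
    (ae_of_all _ fun ξ => by
      rw [Real.norm_eq_abs, abs_of_pos (mixedSymbol_pos α t ξ)]
      exact mixedSymbol_le_gauss ht.le ξ)

lemma fracKernel_eq {α t : ℝ} (hα0 : 0 < α) (ht : 0 < t) (x : RN N) :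
    fracKernel N α t x
      = ((2 * Real.pi) ^ N)⁻¹ * cosTransform (fun ξ => Real.exp (-(t * ‖ξ‖ ^ α))) x := by
  rw [fracKernel, ← re_integral_cexp_mul (integrable_exp_neg_rpow hα0 ht)]
  congr 3 with ξ
  rw [sub_eq_add_neg, Complex.exp_add]
  push_cast
  rfl

lemma gaussKernel_eq {t : ℝ} (ht : 0 < t) (y : RN N) :
    gaussKernel N t y
      = (4 * Real.pi * t) ^ (-(N : ℝ) / 2) * Real.exp (-(4 * t)⁻¹ * ‖y‖ ^ 2) := by
  rw [gaussKernel]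
  congr 2
  field_simp

lemma cosTransform_gaussKernel {t : ℝ} (ht : 0 < t) (ξ : RN N) :
    cosTransform (gaussKernel N t) ξ = Real.exp (-t * ‖ξ‖ ^ 2) := by
  have e : cosTransform (gaussKernel N t) ξ = (4 * Real.pi * t) ^ (-(N : ℝ) / 2) *
      cosTransform (fun y => Real.exp (-(4 * t)⁻¹ * ‖y‖ ^ 2)) ξ := by
    simp only [cosTransform, gaussKernel_eq ht]
    rw [← integral_const_mul]
    congr 1 with y
    ring
  rw [e, cosTransform_gauss (by positivity), ← mul_assoc]
  have h1 : Real.pi / (4 * t)⁻¹ = 4 * Real.pi * t := by field_simp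
  rw [h1, ← Real.rpow_add (by positivity)]
  have h2 : -(N : ℝ) / 2 + (N : ℝ) / 2 = 0 := by ring
  rw [h2, Real.rpow_zero, one_mul]
  congr 1
  field_simp

lemma integrable_gaussKernel {t : ℝ} (ht : 0 < t) : Integrable (gaussKernel N t) := by
  have : gaussKernel N t = fun y => (4 * Real.pi * t) ^ (-(N : ℝ) / 2) *
      Real.exp (-(4 * t)⁻¹ * ‖y‖ ^ 2) := funext fun y => gaussKernel_eq ht y
  rw [this]
  exact (integrable_gauss (by positivity)).const_mul _

lemma mixedKernel_eq {α t : ℝ} (hα0 : 0 < α) (ht : 0 < t) (x : RN N) :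
    mixedKernel N α t x = ((2 * Real.pi) ^ N)⁻¹ * cosTransform (mixedSymbol N α t) x := by
  have h := integral_mul_cosTransform_sub (integrable_gaussKernel (N := N) ht)
    (integrable_exp_neg_rpow (N := N) hα0 ht) (fun y => by simp [gaussKernel]) x
  have e : (fun ξ : RN N => Real.exp (-(t * ‖ξ‖ ^ α)) * cosTransform (gaussKernel N t) ξ)
      = mixedSymbol N α t := by
    funext ξ
    rw [cosTransform_gaussKernel ht, mixedSymbol, mul_comm]
  rw [e] at h
  rw [mixedKernel, conv, convolution_def, ← h, ← integral_const_mul]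
  congr 1 with y
  rw [ContinuousLinearMap.mul_apply', fracKernel_eq hα0 ht]
  ring

lemma mixedKernel_neg {α t : ℝ} (hα0 : 0 < α) (ht : 0 < t) (x : RN N) :
    mixedKernel N α t (-x) = mixedKernel N α t x := by
  simp [mixedKernel_eq hα0 ht, cosTransform]

/-- The symbol of `P_2(t)` is the Gaussian of parameter `b = t` in the definition of `GaussPos`, so
nonnegativity of `P_α` itself is never needed. -/
lemma mixedKernel_nonneg {α t : ℝ} (hα0 : 0 < α) (hα2 : α < 2) (ht : 0 < t) (x : RN N) :
    0 ≤ mixedKernel N α t x := by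
  rw [mixedKernel_eq hα0 ht]
  exact mul_nonneg (by positivity) ((gaussPos_exp_neg_rpow hα0 hα2 ht).nonneg t ht x)

lemma continuous_mixedKernel {α t : ℝ} (hα0 : 0 < α) (ht : 0 < t) :
    Continuous (mixedKernel N α t) := by
  rw [funext (mixedKernel_eq hα0 ht)]
  exact (continuous_cosTransform (integrable_mixedSymbol hα0 ht)).const_mul _

/-- The Gauss means of the mixed kernel. -/
lemma integral_gauss_mul_mixedKernel {α t b : ℝ} (hα0 : 0 < α) (ht : 0 < t) (hb : 0 < b) :
    ∫ y : RN N, Real.exp (-b * ‖y‖ ^ 2) * mixedKernel N α t y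
      = ∫ ξ : RN N, mixedSymbol N α t ξ * gaussKernel N b ξ := by
  have h := integral_mul_cosTransform (integrable_gauss (N := N) hb)
    (integrable_mixedSymbol (N := N) hα0 ht) (fun y => by simp)
  simp only [mixedKernel_eq hα0 ht]
  simp_rw [mul_left_comm _ (((2 * Real.pi) ^ N)⁻¹)]
  rw [integral_const_mul, h, ← integral_const_mul]
  congr 1 with ξ
  rw [cosTransform_gauss hb, gaussKernel]
  have e : ((2 * Real.pi) ^ N)⁻¹ * (Real.pi / b) ^ ((N : ℝ) / 2)
      = (4 * Real.pi * b) ^ (-(N : ℝ) / 2) := by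
    have h1 : Real.pi / b = (2 * Real.pi) ^ 2 * (4 * Real.pi * b)⁻¹ := by
      have := Real.pi_pos
      field_simp
      ring
    rw [h1, Real.mul_rpow (by positivity) (by positivity), neg_div, Real.rpow_neg (by positivity),
      Real.inv_rpow (by positivity), ← Real.rpow_natCast (2 * Real.pi) 2,
      ← Real.rpow_mul (by positivity), ← mul_assoc,
      show ((2 : ℕ) : ℝ) * ((N : ℝ) / 2) = N by push_cast; ring, Real.rpow_natCast,
      inv_mul_cancel₀ (by positivity), one_mul]
  rw [← e]
  ring

lemma gaussKernel_nonneg {b : ℝ} (hb : 0 < b) (ξ : RN N) : 0 ≤ gaussKernel N b ξ := by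
  rw [gaussKernel]; positivity

lemma integral_gaussKernel {b : ℝ} (hb : 0 < b) : ∫ ξ, gaussKernel N b ξ = 1 := by
  simpa [cosTransform] using cosTransform_gaussKernel (N := N) hb 0

/-- Damp the kernel by wide Gaussians. The damped integrals equal averages of the symbol, which is
at most `1`, against a probability density. As the kernel is nonnegative, Fatou's lemma bounds its
full integral by `1`. -/
lemma integrable_mixedKernel {α t : ℝ} (hα0 : 0 < α) (hα2 : α < 2) (ht : 0 < t) :
    Integrable (mixedKernel N α t) := by
  refine ⟨(continuous_mixedKernel hα0 ht).aestronglyMeasurable, ?_⟩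
  have hb : ∀ n : ℕ, (0 : ℝ) < 1 / ((n : ℝ) + 1) := fun n => by positivity
  set f : ℕ → RN N → ℝ := fun n y =>
    Real.exp (-(1 / ((n : ℝ) + 1)) * ‖y‖ ^ 2) * mixedKernel N α t y with hf
  have hf0 : ∀ n y, 0 ≤ f n y := fun n y =>
    mul_nonneg (Real.exp_nonneg _) (mixedKernel_nonneg hα0 hα2 ht y)
  have hfc : ∀ n, Continuous (f n) := fun n => by
    have := continuous_mixedKernel (N := N) hα0 ht
    fun_prop
  have hfi : ∀ n, Integrable (f n) := fun n => by
    refine (integrable_gauss (hb n)).mul_bdd (c := ((2 * Real.pi) ^ N)⁻¹ *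
      ∫ ξ, |mixedSymbol N α t ξ|)
      (continuous_mixedKernel hα0 ht).aestronglyMeasurable (ae_of_all _ fun y => ?_)
    rw [mixedKernel_eq hα0 ht, norm_mul, Real.norm_of_nonneg (by positivity)]
    refine mul_le_mul_of_nonneg_left ?_ (by positivity)
    refine norm_integral_le_of_norm_le (integrable_mixedSymbol hα0 ht).abs
      (ae_of_all _ fun ξ => ?_)
    rw [norm_mul, Real.norm_eq_abs, Real.norm_eq_abs]
    exact mul_le_of_le_one_left (abs_nonneg _) (Real.abs_cos_le_one _)
  have hle : ∀ n, ∫⁻ y, ENNReal.ofReal (f n y) ≤ 1 := fun n => by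
    rw [← ofReal_integral_eq_lintegral_ofReal (hfi n) (ae_of_all _ (hf0 n)),
      ENNReal.ofReal_le_one]
    simp only [hf]
    rw [integral_gauss_mul_mixedKernel hα0 ht (hb n)]
    refine le_trans ?_ (integral_gaussKernel (N := N) (hb n)).le
    refine integral_mono_of_nonneg (ae_of_all _ fun ξ =>
      mul_nonneg (mixedSymbol_pos α t ξ).le (gaussKernel_nonneg (hb n) ξ))
      (integrable_gaussKernel (hb n)) (ae_of_all _ fun ξ => ?_)
    exact mul_le_of_le_one_left (gaussKernel_nonneg (hb n) ξ) (mixedSymbol_le_one ht.le ξ)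
  have hlim : ∀ y, Tendsto (fun n => ENNReal.ofReal (f n y)) atTop
      (𝓝 (ENNReal.ofReal (mixedKernel N α t y))) := fun y => by
    refine (ENNReal.continuous_ofReal.tendsto _).comp ?_
    have h0 : Tendsto (fun n : ℕ => Real.exp (-(1 / ((n : ℝ) + 1)) * ‖y‖ ^ 2)) atTop (𝓝 1) := by
      have h1 := ((tendsto_one_div_add_atTop_nhds_zero_nat (𝕜 := ℝ)).neg.mul_const (‖y‖ ^ 2))
      have h2 := (Real.continuous_exp.tendsto _).comp h1
      simpa [Function.comp_def] using h2
    simpa [hf] using h0.mul_const (mixedKernel N α t y)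
  rw [hasFiniteIntegral_iff_ofReal (ae_of_all _ (mixedKernel_nonneg hα0 hα2 ht))]
  calc ∫⁻ y, ENNReal.ofReal (mixedKernel N α t y)
      = ∫⁻ y, liminf (fun n => ENNReal.ofReal (f n y)) atTop := by
        congr 1 with y
        exact (hlim y).liminf_eq.symm
    _ ≤ liminf (fun n => ∫⁻ y, ENNReal.ofReal (f n y)) atTop :=
        lintegral_liminf_le fun n => (hfc n).measurable.ennreal_ofReal
    _ ≤ liminf (fun _ : ℕ => (1 : ℝ≥0∞)) atTop :=
        liminf_le_liminf (Eventually.of_forall hle)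
    _ < ∞ := by simp

/-- Fourier inversion, available now that the kernel is integrable. At `ξ = 0` it gives the mass,
and multiplicativity of the symbol in time gives the semigroup law. -/
lemma cosTransform_mixedKernel {α t : ℝ} (hα0 : 0 < α) (hα2 : α < 2) (ht : 0 < t) (ξ : RN N) :
    cosTransform (mixedKernel N α t) ξ = mixedSymbol N α t ξ := by
  have hK := integrable_mixedKernel (N := N) hα0 hα2 ht
  have hpi : (0 : ℝ) < (2 * Real.pi) ^ N := by positivity
  have e : cosTransform (mixedSymbol N α t) = fun x => (2 * Real.pi) ^ N * mixedKernel N α t x := by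
    funext x
    rw [mixedKernel_eq hα0 ht, mul_inv_cancel_left₀ hpi.ne']
  have h := cosTransform_cosTransform (integrable_mixedSymbol (N := N) hα0 ht)
    (continuous_mixedSymbol hα0 t) (mixedSymbol_neg α t) (by rw [e]; exact hK.const_mul _) ξ
  rw [e] at h
  have e2 : cosTransform (fun x => (2 * Real.pi) ^ N * mixedKernel N α t x) ξ
      = (2 * Real.pi) ^ N * cosTransform (mixedKernel N α t) ξ := by
    simp only [cosTransform]
    rw [← integral_const_mul]
    congr 1 with y
    ring
  rw [e2] at h
  exact mul_left_cancel₀ hpi.ne' h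

lemma integral_mixedKernel {α t : ℝ} (hα0 : 0 < α) (hα2 : α < 2) (ht : 0 < t) :
    ∫ y, mixedKernel N α t y = 1 := by
  have h := cosTransform_mixedKernel (N := N) hα0 hα2 ht 0
  simpa [cosTransform, mixedSymbol, Real.zero_rpow hα0.ne'] using h

lemma integral_mixedKernel_mul_mixedKernel_sub {α s t : ℝ} (hα0 : 0 < α) (hα2 : α < 2)
    (hs : 0 < s) (ht : 0 < t) (x : RN N) :
    ∫ y, mixedKernel N α s y * mixedKernel N α t (x - y) = mixedKernel N α (s + t) x := by
  have h := integral_mul_cosTransform_sub (integrable_mixedKernel (N := N) hα0 hα2 hs)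
    (integrable_mixedSymbol (N := N) hα0 ht) (mixedKernel_neg hα0 hs) x
  simp only [cosTransform_mixedKernel hα0 hα2 hs, mul_comm (mixedSymbol N α t _),
    mixedSymbol_add] at h
  rw [mixedKernel_eq hα0 (add_pos hs ht), ← h, ← integral_const_mul]
  congr 1 with y
  rw [mixedKernel_eq hα0 ht]
  ring

lemma tendsto_mixedKernel {α t : ℝ} (hα0 : 0 < α) (ht : 0 < t) (x : RN N) :
    Tendsto (fun s => mixedKernel N α s x) (𝓝 t) (𝓝 (mixedKernel N α t x)) := by
  have hev : ∀ᶠ s in 𝓝 t, t / 2 < s := lt_mem_nhds (by linarith)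
  have hc : Tendsto (fun s => cosTransform (mixedSymbol N α s) x) (𝓝 t)
      (𝓝 (cosTransform (mixedSymbol N α t) x)) := by
    refine tendsto_integral_filter_of_dominated_convergence
      (fun ξ => Real.exp (-(t / 2) * ‖ξ‖ ^ 2)) ?_ ?_ (integrable_gauss (by positivity)) ?_
    · filter_upwards [hev] with s hs
      exact (integrable_cos_mul (integrable_mixedSymbol hα0 (by linarith)) x).aestronglyMeasurable
    · filter_upwards [hev] with s hs
      refine ae_of_all _ fun ξ => ?_
      rw [norm_mul, Real.norm_eq_abs, Real.norm_eq_abs, abs_of_pos (mixedSymbol_pos α s ξ)]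
      refine (mul_le_of_le_one_left (mixedSymbol_pos α s ξ).le (Real.abs_cos_le_one _)).trans ?_
      refine (mixedSymbol_le_gauss (by linarith) ξ).trans (Real.exp_le_exp.2 ?_)
      exact mul_le_mul_of_nonneg_right (by linarith) (sq_nonneg _)
    · refine ae_of_all _ fun ξ => ?_
      have : Continuous fun s => Real.cos (inner ℝ x ξ) * mixedSymbol N α s ξ := by
        unfold mixedSymbol; fun_prop
      exact this.tendsto t
  rw [mixedKernel_eq hα0 ht]
  refine (hc.const_mul _).congr' ?_
  filter_upwards [hev] with s hs
  rw [mixedKernel_eq hα0 (by linarith)]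

/-- Continuity of the mixed kernel in `L¹`, by Scheffé's argument. -/
lemma tendsto_integral_abs_mixedKernel_sub {α t : ℝ} (hα0 : 0 < α) (hα2 : α < 2) (ht : 0 < t) :
    Tendsto (fun s => ∫ y : RN N, |mixedKernel N α s y - mixedKernel N α t y|) (𝓝 t) (𝓝 0) := by
  have hev : ∀ᶠ s in 𝓝 t, 0 < s := lt_mem_nhds ht
  have hKt := integrable_mixedKernel (N := N) hα0 hα2 ht
  have h1 : Tendsto (fun s => ∫ y : RN N, max (mixedKernel N α t y - mixedKernel N α s y) 0)
      (𝓝 t) (𝓝 (∫ _ : RN N, (0 : ℝ))) := by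
    refine tendsto_integral_filter_of_dominated_convergence (mixedKernel N α t) ?_ ?_ hKt ?_
    · filter_upwards [hev] with s hs
      exact ((hKt.sub (integrable_mixedKernel hα0 hα2 hs)).pos_part).aestronglyMeasurable
    · filter_upwards [hev] with s hs
      refine ae_of_all _ fun y => ?_
      have a1 := mixedKernel_nonneg hα0 hα2 hs y
      have a2 := mixedKernel_nonneg hα0 hα2 ht y
      rw [Real.norm_of_nonneg (le_max_right _ _)]
      exact max_le (by linarith) a2
    · refine ae_of_all _ fun y => ?_
      have h := ((tendsto_const_nhds (x := mixedKernel N α t y)).sub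
        (tendsto_mixedKernel hα0 ht y)).max (tendsto_const_nhds (x := (0 : ℝ)))
      simpa using h
  rw [integral_zero] at h1
  have h2 := h1.const_mul 2
  rw [mul_zero] at h2
  refine h2.congr' ?_
  filter_upwards [hev] with s hs
  have hKs := integrable_mixedKernel (N := N) hα0 hα2 hs
  -- Scheffé: `|d| = 2 max(-d, 0) + d`, and the last term integrates to zero since both kernels have
  -- mass one. The negative part is dominated by the fixed kernel at time `t`.
  have e : ∀ y : RN N, |mixedKernel N α s y - mixedKernel N α t y|
      = 2 * max (mixedKernel N α t y - mixedKernel N α s y) 0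
        + (mixedKernel N α s y - mixedKernel N α t y) := by
    intro y
    rcases le_total (mixedKernel N α t y) (mixedKernel N α s y) with h | h
    · rw [max_eq_right (by linarith), abs_of_nonneg (by linarith)]; ring
    · rw [max_eq_left (by linarith), abs_of_nonpos (by linarith)]; ring
  simp_rw [e]
  have hi : Integrable fun y => 2 * max (mixedKernel N α t y - mixedKernel N α s y) 0 :=
    (hKt.sub hKs).pos_part.const_mul 2
  have hi2 : Integrable fun y => mixedKernel N α s y - mixedKernel N α t y := hKs.sub hKt
  rw [integral_add hi hi2, integral_sub hKs hKt,
    integral_mixedKernel hα0 hα2 hs, integral_mixedKernel hα0 hα2 ht, integral_const_mul]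
  simp

/-- The mass of the mixed kernel concentrates at the origin as `t → 0`. -/
lemma tendsto_integral_mixedKernel_mul {α : ℝ} (hα0 : 0 < α) (hα2 : α < 2) :
    Tendsto (fun t => ∫ y : RN N, mixedKernel N α t y * (1 - Real.exp (-1 * ‖y‖ ^ 2)))
      (𝓝[>] 0) (𝓝 0) := by
  -- On the Fourier side, the Gauss mean of the kernel tends to the mass of the Gauss kernel because
  -- the symbol tends to `1`; subtracting from the kernel's mass gives the claim.
  have h1 : Tendsto (fun t => ∫ ξ : RN N, mixedSymbol N α t ξ * gaussKernel N 1 ξ)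
      (𝓝[>] 0) (𝓝 (∫ ξ : RN N, gaussKernel N 1 ξ)) := by
    refine tendsto_integral_filter_of_dominated_convergence (gaussKernel N 1) ?_ ?_
      (integrable_gaussKernel one_pos) ?_
    · exact Eventually.of_forall fun t => ((continuous_mixedSymbol hα0 t).aestronglyMeasurable).mul
        (integrable_gaussKernel one_pos).aestronglyMeasurable
    · filter_upwards [self_mem_nhdsWithin] with t ht
      refine ae_of_all _ fun ξ => ?_
      have ht0 : (0 : ℝ) < t := ht
      rw [Real.norm_of_nonneg (mul_nonneg (mixedSymbol_pos α t ξ).le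
        (gaussKernel_nonneg one_pos ξ))]
      exact mul_le_of_le_one_left (gaussKernel_nonneg one_pos ξ) (mixedSymbol_le_one ht0.le ξ)
    · refine ae_of_all _ fun ξ => ?_
      have hc : Continuous fun t => mixedSymbol N α t ξ * gaussKernel N 1 ξ := by
        unfold mixedSymbol; fun_prop
      have := (hc.tendsto 0).mono_left (nhdsWithin_le_nhds (s := Ioi 0))
      simpa [mixedSymbol] using this
  rw [integral_gaussKernel one_pos] at h1
  have h2 := h1.const_sub 1
  rw [sub_self] at h2
  refine h2.congr' ?_
  filter_upwards [self_mem_nhdsWithin] with t ht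
  have hK := integrable_mixedKernel (N := N) hα0 hα2 ht
  rw [← integral_gauss_mul_mixedKernel hα0 ht one_pos]
  have hi : Integrable fun y : RN N => Real.exp (-1 * ‖y‖ ^ 2) * mixedKernel N α t y := by
    refine hK.bdd_mul (c := 1) (by fun_prop) (ae_of_all _ fun y => ?_)
    rw [Real.norm_eq_abs, Real.abs_exp, Real.exp_le_one_iff]
    have : 0 ≤ ‖y‖ ^ 2 := by positivity
    linarith
  have e := integral_sub hK hi
  rw [integral_mixedKernel hα0 hα2 ht] at e
  rw [← e]
  congr 1 with y
  ring

/-- The cosine formula for the kernel holds only for `t > 0`, so joint measurability over all real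
`t` is read off the defining parametric integrals. -/
lemma measurable_mixedKernel (N : ℕ) (α : ℝ) :
    Measurable fun z : ℝ × RN N => mixedKernel N α z.1 z.2 := by
  have hg : Measurable fun z : ℝ × RN N => gaussKernel N z.1 z.2 := by
    unfold gaussKernel; fun_prop
  have hfr : Measurable fun z : ℝ × RN N => fracKernel N α z.1 z.2 := by
    unfold fracKernel
    refine Measurable.const_mul (Complex.measurable_re.comp ?_) _
    have : StronglyMeasurable (Function.uncurry fun (z : ℝ × RN N) (ξ : RN N) =>
        Complex.exp (Complex.I * ((inner ℝ z.2 ξ : ℝ) : ℂ) - ((z.1 * ‖ξ‖ ^ α : ℝ) : ℂ))) := by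
      apply Measurable.stronglyMeasurable
      simp only [Function.uncurry_def]
      fun_prop
    exact (StronglyMeasurable.integral_prod_right (ν := volume) this).measurable
  have : StronglyMeasurable (Function.uncurry fun (z : ℝ × RN N) (y : RN N) =>
      gaussKernel N z.1 y * fracKernel N α z.1 (z.2 - y)) := by
    apply Measurable.stronglyMeasurable
    simp only [Function.uncurry_def]
    exact (hg.comp (f := fun q : (ℝ × RN N) × RN N => (q.1.1, q.2)) (by fun_prop)).mul
      (hfr.comp (f := fun q : (ℝ × RN N) × RN N => (q.1.1, q.1.2 - q.2)) (by fun_prop))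
  exact (StronglyMeasurable.integral_prod_right (ν := volume) this).measurable

/-! ### Minkowski's integral inequality -/

lemma lintegral_rpow_le_of_one_le {Ω : Type*} [MeasurableSpace Ω] (ν : Measure Ω)
    [IsFiniteMeasure ν] {q : ℝ} (hq : 1 ≤ q) {f : Ω → ℝ≥0∞} (hf : Measurable f) :
    (∫⁻ ω, f ω ∂ν) ^ q ≤ ν univ ^ (q - 1) * ∫⁻ ω, f ω ^ q ∂ν := by
  have hq0 : 0 < q := zero_lt_one.trans_le hq
  rcases hq.eq_or_lt with rfl | hq1
  · simp
  have hc := Real.HolderConjugate.conjExponent hq1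
  have h := ENNReal.lintegral_mul_le_Lp_mul_Lq ν hc hf.aemeasurable
    (aemeasurable_const (b := (1 : ℝ≥0∞)))
  simp only [Pi.mul_apply, mul_one, ENNReal.one_rpow, lintegral_const, one_mul] at h
  have h2 := ENNReal.rpow_le_rpow h hq0.le
  rw [ENNReal.mul_rpow_of_nonneg _ _ hq0.le, ← ENNReal.rpow_mul, ← ENNReal.rpow_mul,
    one_div_mul_cancel hq0.ne', ENNReal.rpow_one, mul_comm] at h2
  refine h2.trans (le_of_eq ?_)
  congr 2
  have : q - 1 ≠ 0 := by linarith
  rw [Real.conjExponent]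
  field_simp

/-- With a bound on the norms uniform in `ω`, Minkowski's inequality reduces to Hölder against the
constant `1` on the finite measure `ν`, followed by Tonelli. For `r = ∞` one only exchanges two
almost-everywhere quantifiers. -/
lemma eLpNorm_lintegral_enorm_le {Ω X : Type*} [MeasurableSpace Ω] [MeasurableSpace X]
    (ν : Measure Ω) [IsFiniteMeasure ν] (μ : Measure X) [SFinite μ] {r : ℝ≥0∞} (hr : 1 ≤ r)
    {φ : Ω → X → ℝ} (hφ : Measurable (Function.uncurry φ)) {C : ℝ≥0∞}
    (hC : ∀ᵐ ω ∂ν, eLpNorm (φ ω) r μ ≤ C) :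
    eLpNorm (fun x => ∫⁻ ω, ‖φ ω x‖ₑ ∂ν) r μ ≤ ν univ * C := by
  have hm : Measurable (Function.uncurry fun ω x => ‖φ ω x‖ₑ) := hφ.enorm
  by_cases hr' : r = ∞
  · subst hr'
    have h1 : ∀ᵐ ω ∂ν, ∀ᵐ x ∂μ, ‖φ ω x‖ₑ ≤ C := by
      filter_upwards [hC] with ω hω
      rw [eLpNorm_exponent_top] at hω
      filter_upwards [ae_le_eLpNormEssSup (f := φ ω) (μ := μ)] with x hx using hx.trans hω
    have h2 := (Measure.ae_ae_comm (μ := ν) (ν := μ) (p := fun ω x => ‖φ ω x‖ₑ ≤ C)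
      (hm measurableSet_Iic)).1 h1
    rw [eLpNorm_exponent_top]
    refine essSup_le_of_ae_le _ ?_
    filter_upwards [h2] with x hx
    refine (lintegral_mono_ae hx).trans ?_
    rw [lintegral_const, mul_comm]
  · set q := r.toReal with hq
    have hr0 : r ≠ 0 := (zero_lt_one.trans_le hr).ne'
    have hq1 : 1 ≤ q := by
      rw [hq, ← ENNReal.toReal_one]
      exact ENNReal.toReal_mono hr' hr
    have hq0 : 0 < q := zero_lt_one.trans_le hq1
    rw [eLpNorm_eq_lintegral_rpow_enorm_toReal hr0 hr', ← hq, one_div,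
      ENNReal.rpow_inv_le_iff hq0]
    simp only [enorm_eq_self]
    calc ∫⁻ x, (∫⁻ ω, ‖φ ω x‖ₑ ∂ν) ^ q ∂μ
        ≤ ∫⁻ x, ν univ ^ (q - 1) * ∫⁻ ω, ‖φ ω x‖ₑ ^ q ∂ν ∂μ :=
          lintegral_mono fun x => lintegral_rpow_le_of_one_le ν hq1
            (hm.comp (measurable_id.prodMk measurable_const))
      _ = ν univ ^ (q - 1) * ∫⁻ ω, ∫⁻ x, ‖φ ω x‖ₑ ^ q ∂μ ∂ν := by
          have hmq : Measurable (Function.uncurry fun ω x => ‖φ ω x‖ₑ ^ q) := hm.pow_const q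
          rw [lintegral_const_mul, lintegral_lintegral_swap]
          · exact (hmq.comp measurable_swap).aemeasurable
          · exact Measurable.lintegral_prod_left' (f := fun z : Ω × X => ‖φ z.1 z.2‖ₑ ^ q) hmq
      _ ≤ ν univ ^ (q - 1) * ∫⁻ _, C ^ q ∂ν := by
          refine mul_le_mul' le_rfl (lintegral_mono_ae ?_)
          filter_upwards [hC] with ω hω
          rwa [eLpNorm_eq_lintegral_rpow_enorm_toReal hr0 hr', ← hq, one_div,
            ENNReal.rpow_inv_le_iff hq0] at hω
      _ = (ν univ * C) ^ q := by
          rw [lintegral_const, ENNReal.mul_rpow_of_nonneg _ _ hq0.le, mul_comm (C ^ q), ← mul_assoc]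
          congr 1
          nth_rw 2 [← ENNReal.rpow_one (ν univ)]
          rw [← ENNReal.rpow_add_of_nonneg _ _ (by linarith) zero_le_one]
          ring_nf

/-- Minkowski's integral inequality for weighted averages `∫ k(ω) φ(ω, ·) dν`. -/
lemma eLpNorm_integral_mul_le {Ω X : Type*} [MeasurableSpace Ω] [MeasurableSpace X]
    {ν : Measure Ω} {μ : Measure X} [SFinite μ] {r : ℝ≥0∞} (hr : 1 ≤ r)
    {k : Ω → ℝ} (hk : Measurable k) (hki : Integrable k ν)
    {φ : Ω → X → ℝ} (hφ : Measurable (Function.uncurry φ)) {C : ℝ≥0∞}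
    (hC : ∀ᵐ ω ∂ν, eLpNorm (φ ω) r μ ≤ C) :
    eLpNorm (fun x => ∫ ω, k ω * φ ω x ∂ν) r μ ≤ ENNReal.ofReal (∫ ω, |k ω| ∂ν) * C := by
  -- The weight is absorbed into the measure `|k| ν`, which is finite of mass `∫ |k|`.
  have huniv : (ν.withDensity fun ω => ‖k ω‖ₑ) univ = ENNReal.ofReal (∫ ω, |k ω| ∂ν) := by
    rw [withDensity_apply _ MeasurableSet.univ, Measure.restrict_univ]
    exact (ofReal_integral_norm_eq_lintegral_enorm hki).symm
  have : IsFiniteMeasure (ν.withDensity fun ω => ‖k ω‖ₑ) :=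
    ⟨by rw [huniv]; exact ENNReal.ofReal_lt_top⟩
  have hC' : ∀ᵐ ω ∂(ν.withDensity fun ω => ‖k ω‖ₑ), eLpNorm (φ ω) r μ ≤ C :=
    (withDensity_absolutelyContinuous ν _).ae_le hC
  have h := eLpNorm_lintegral_enorm_le _ μ hr hφ hC'
  rw [huniv] at h
  refine le_trans (eLpNorm_mono_enorm fun x => ?_) h
  have hφx : Measurable fun ω => ‖φ ω x‖ₑ :=
    (hφ.comp (measurable_id.prodMk measurable_const)).enorm
  rw [enorm_eq_self, lintegral_withDensity_eq_lintegral_mul _ hk.enorm hφx]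
  refine (enorm_integral_le_lintegral_enorm _).trans (lintegral_mono fun ω => ?_)
  simp [enorm_mul]

/-! ### An exponential identity for absolutely continuous functions -/

/-- The primitive `t ↦ ∫₀ᵗ k`. -/
def primitive (k : ℝ → ℝ) (t : ℝ) : ℝ := ∫ s in (0 : ℝ)..t, k s

/-- An absolutely continuous function is bounded on the interval, and the exponential is Lipschitz
below any bound. -/
lemma absolutelyContinuousOnInterval_exp {f : ℝ → ℝ} {a b : ℝ}
    (hf : AbsolutelyContinuousOnInterval f a b) :
    AbsolutelyContinuousOnInterval (fun s => Real.exp (f s)) a b := by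
  obtain ⟨C, hC⟩ := hf.exists_bound
  have hlip : ∀ x ∈ uIcc a b, ∀ y ∈ uIcc a b,
      dist (Real.exp (f x)) (Real.exp (f y)) ≤ Real.exp C * dist (f x) (f y) := by
    intro x hx y hy
    have hb : ∀ z ∈ Iic C, ‖deriv Real.exp z‖ ≤ Real.exp C := fun z hz => by
      rw [Real.deriv_exp, Real.norm_eq_abs, Real.abs_exp]
      exact Real.exp_le_exp.2 hz
    have := (convex_Iic C).norm_image_sub_le_of_norm_deriv_le
      (fun z _ => Real.differentiable_exp z) hb
      (show f y ∈ Iic C from (le_abs_self _).trans (hC y hy))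
      (show f x ∈ Iic C from (le_abs_self _).trans (hC x hx))
    simpa [dist_eq_norm] using this
  rw [absolutelyContinuousOnInterval_iff] at hf ⊢
  intro ε hε
  obtain ⟨δ, hδ, h⟩ := hf (ε / Real.exp C) (by positivity)
  refine ⟨δ, hδ, fun E hE hlt => ?_⟩
  have h1 := h E hE hlt
  rw [lt_div_iff₀ (Real.exp_pos C), Finset.sum_mul] at h1
  refine lt_of_le_of_lt (Finset.sum_le_sum fun i hi => ?_) h1
  rw [mul_comm]
  have hmem := hE.1 i hi
  exact hlip _ hmem.1 _ hmem.2

/-- As `k` is merely integrable, its primitive is differentiable only almost everywhere, so the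
fundamental theorem is used in its absolutely continuous form. -/
lemma integral_mul_exp_primitive {k : ℝ → ℝ} {r t : ℝ} (hr : 0 ≤ r) (hrt : r ≤ t)
    (hk : IntegrableOn k (Ioc 0 t)) (lam : ℝ) :
    ∫ s in r..t, k s * (lam * Real.exp (lam * primitive k s))
      = Real.exp (lam * primitive k t) - Real.exp (lam * primitive k r) := by
  have ht : 0 ≤ t := hr.trans hrt
  have hki : IntervalIntegrable k volume 0 t :=
    (intervalIntegrable_iff_integrableOn_Ioc_of_le ht).2 hk
  have hac : AbsolutelyContinuousOnInterval (primitive k) 0 t :=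
    hki.absolutelyContinuousOnInterval_intervalIntegral (c := 0) left_mem_uIcc
  have hac2 := absolutelyContinuousOnInterval_exp ((hac.const_mul lam).mono (c := r) (d := t)
    (by rw [uIcc_of_le hrt, uIcc_of_le ht]; exact Icc_subset_Icc_left hr))
  rw [← hac2.integral_deriv_eq_sub]
  refine intervalIntegral.integral_congr_ae ?_
  filter_upwards [hki.ae_hasDerivAt_integral] with s hs hmem
  rw [uIoc_of_le hrt] at hmem
  have hs' := hs (by rw [uIcc_of_le ht]; exact ⟨hr.trans hmem.1.le, hmem.2⟩) 0 left_mem_uIcc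
  have := ((hs'.const_mul lam).exp).deriv
  simp only [primitive]
  rw [this]
  ring

/-! ### The propagator -/

/-- The kernel of the evolution family for `s < t`. -/
def propKernel (N : ℕ) (α β t s : ℝ) : RN N → ℝ :=
  mixedKernel N α (t ^ (β + 1) / (β + 1) - s ^ (β + 1) / (β + 1))

/-- Convolution with `propKernel`. -/
def propagate (α β t s : ℝ) (v : RN N → ℝ) (x : RN N) : ℝ :=
  ∫ y, propKernel N α β t s y * v (x - y)

lemma clock_sub_pos {β s t : ℝ} (hβ : 0 ≤ β) (hs : 0 ≤ s) (hst : s < t) :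
    0 < t ^ (β + 1) / (β + 1) - s ^ (β + 1) / (β + 1) := by
  have hβ1 : 0 < β + 1 := by linarith
  rw [← sub_div]
  exact div_pos (sub_pos.2 (Real.rpow_lt_rpow hs hst hβ1)) hβ1

lemma evolution_of_lt {α β s t : ℝ} (hβ : 0 ≤ β) (hs : 0 ≤ s) (hst : s < t) (v : RN N → ℝ) :
    evolution α β t s v = propagate α β t s v := by
  rw [evolution, mixedSemigroup, if_neg (clock_sub_pos hβ hs hst).ne']
  rfl

lemma evolution_self (α β t : ℝ) (v : RN N → ℝ) : evolution α β t t v = v := by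
  simp [evolution, mixedSemigroup]

lemma measurable_propKernel (N : ℕ) (α β : ℝ) :
    Measurable fun q : (ℝ × ℝ) × RN N => propKernel N α β q.1.1 q.1.2 q.2 :=
  (measurable_mixedKernel N α).comp (f := fun q : (ℝ × ℝ) × RN N =>
    (q.1.1 ^ (β + 1) / (β + 1) - q.1.2 ^ (β + 1) / (β + 1), q.2)) (by fun_prop)

lemma ae_sub_left {P : RN N → Prop} (h : ∀ᵐ y, P y) (x : RN N) : ∀ᵐ y, P (x - y) :=
  (Measure.measurePreserving_sub_left volume x).quasiMeasurePreserving.ae h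

lemma aestronglyMeasurable_comp_sub_left {v : RN N → ℝ} (hv : AEStronglyMeasurable v volume)
    (x : RN N) : AEStronglyMeasurable (fun y => v (x - y)) volume :=
  hv.comp_quasiMeasurePreserving (Measure.measurePreserving_sub_left volume x).quasiMeasurePreserving

lemma propagate_congr_ae {α β t s : ℝ} {v w : RN N → ℝ} (h : v =ᵐ[volume] w) :
    propagate α β t s v = propagate α β t s w := by
  funext x
  refine integral_congr_ae ?_
  filter_upwards [ae_sub_left h x] with y hy
  rw [hy]

lemma measurable_propagate {α β : ℝ} {w : ℝ → RN N → ℝ} (hw : Measurable (Function.uncurry w)) :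
    Measurable fun q : (ℝ × ℝ) × RN N => propagate α β q.1.1 q.1.2 (w q.1.2) q.2 := by
  have : StronglyMeasurable (Function.uncurry fun (q : (ℝ × ℝ) × RN N) (y : RN N) =>
      propKernel N α β q.1.1 q.1.2 y * w q.1.2 (q.2 - y)) := by
    apply Measurable.stronglyMeasurable
    exact ((measurable_propKernel N α β).comp
      (f := fun z : ((ℝ × ℝ) × RN N) × RN N => (z.1.1, z.2)) (by fun_prop)).mul
      (hw.comp (f := fun z : ((ℝ × ℝ) × RN N) × RN N => (z.1.1.2, z.1.2 - z.2)) (by fun_prop))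
  exact (StronglyMeasurable.integral_prod_right (ν := volume) this).measurable

/-- An arbitrary mild solution is only almost everywhere measurable in `(s, x)`. For almost every
`s` its slice agrees a.e. with that of a Borel version, and convolution does not see the difference.
-/
lemma aestronglyMeasurable_propagate {α β t : ℝ} {J : Set ℝ} {w : ℝ → RN N → ℝ}
    (hw : AEStronglyMeasurable (Function.uncurry w) ((volume.restrict J).prod volume)) (x : RN N) :
    AEStronglyMeasurable (fun s => propagate α β t s (w s) x) (volume.restrict J) := by
  have hm := measurable_propagate (α := α) (β := β) (w := fun s y => hw.mk _ (s, y))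
    hw.stronglyMeasurable_mk.measurable
  refine ⟨fun s => propagate α β t s (fun y => hw.mk _ (s, y)) x,
    (hm.comp (f := fun s => ((t, s), x)) (by fun_prop)).stronglyMeasurable, ?_⟩
  filter_upwards [Measure.ae_ae_of_ae_prod hw.ae_eq_mk] with s hs
  exact congrFun (propagate_congr_ae hs) x

section

variable {α β s t : ℝ} (hα0 : 0 < α) (hα2 : α < 2) (hβ : 0 ≤ β) (hs : 0 ≤ s) (hst : s < t)

include hα0 hβ hs hst in
lemma continuous_propKernel : Continuous (propKernel N α β t s) :=
  continuous_mixedKernel hα0 (clock_sub_pos hβ hs hst)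

include hα0 hα2 hβ hs hst

lemma propKernel_nonneg (y : RN N) : 0 ≤ propKernel N α β t s y :=
  mixedKernel_nonneg hα0 hα2 (clock_sub_pos hβ hs hst) y

lemma integrable_propKernel : Integrable (propKernel N α β t s) :=
  integrable_mixedKernel hα0 hα2 (clock_sub_pos hβ hs hst)

lemma integral_propKernel : ∫ y, propKernel N α β t s y = 1 :=
  integral_mixedKernel hα0 hα2 (clock_sub_pos hβ hs hst)

lemma integrable_propKernel_mul {v : RN N → ℝ} (hv : AEStronglyMeasurable v volume) {C : ℝ}
    (hC : ∀ᵐ y, |v y| ≤ C) (x : RN N) :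
    Integrable fun y => propKernel N α β t s y * v (x - y) :=
  (integrable_propKernel hα0 hα2 hβ hs hst).mul_bdd (c := C)
    (aestronglyMeasurable_comp_sub_left hv x) (ae_sub_left hC x)

lemma abs_propagate_le {v : RN N → ℝ} {C : ℝ} (hC : ∀ᵐ y, |v y| ≤ C) (x : RN N) :
    |propagate α β t s v x| ≤ C := by
  have h := norm_integral_le_of_norm_le
    ((integrable_propKernel (N := N) hα0 hα2 hβ hs hst).mul_const C)
    (f := fun y => propKernel N α β t s y * v (x - y)) ?_
  · rwa [integral_mul_const, integral_propKernel hα0 hα2 hβ hs hst, one_mul] at h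
  · filter_upwards [ae_sub_left hC x] with y hy
    have h0 := propKernel_nonneg (N := N) hα0 hα2 hβ hs hst y
    rw [norm_mul, Real.norm_of_nonneg h0]
    exact mul_le_mul_of_nonneg_left hy h0

lemma propagate_mono {v w : RN N → ℝ} (hv : AEStronglyMeasurable v volume)
    (hw : AEStronglyMeasurable w volume) {C : ℝ} (hvC : ∀ᵐ y, |v y| ≤ C) (hwC : ∀ᵐ y, |w y| ≤ C)
    (hvw : ∀ᵐ y, v y ≤ w y) (x : RN N) : propagate α β t s v x ≤ propagate α β t s w x := by
  refine integral_mono_ae (integrable_propKernel_mul hα0 hα2 hβ hs hst hv hvC x)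
    (integrable_propKernel_mul hα0 hα2 hβ hs hst hw hwC x) ?_
  filter_upwards [ae_sub_left hvw x] with y hy
  exact mul_le_mul_of_nonneg_left hy (propKernel_nonneg hα0 hα2 hβ hs hst y)

lemma abs_propagate_le_propagate {v w : RN N → ℝ} (hw : AEStronglyMeasurable w volume) {C : ℝ}
    (hwC : ∀ᵐ y, |w y| ≤ C) (hvw : ∀ᵐ y, |v y| ≤ w y) (x : RN N) :
    |propagate α β t s v x| ≤ propagate α β t s w x := by
  rw [← Real.norm_eq_abs]
  refine norm_integral_le_of_norm_le (integrable_propKernel_mul hα0 hα2 hβ hs hst hw hwC x) ?_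
  filter_upwards [ae_sub_left hvw x] with y hy
  have h0 := propKernel_nonneg (N := N) hα0 hα2 hβ hs hst y
  rw [norm_mul, Real.norm_of_nonneg h0]
  exact mul_le_mul_of_nonneg_left hy h0

lemma propagate_nonneg {v : RN N → ℝ} (hv : ∀ᵐ y, 0 ≤ v y) (x : RN N) :
    0 ≤ propagate α β t s v x := by
  refine integral_nonneg_of_ae ?_
  filter_upwards [ae_sub_left hv x] with y hy
  exact mul_nonneg (propKernel_nonneg hα0 hα2 hβ hs hst y) hy

lemma propagate_sub {v w : RN N → ℝ} (hv : AEStronglyMeasurable v volume)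
    (hw : AEStronglyMeasurable w volume) {C : ℝ} (hvC : ∀ᵐ y, |v y| ≤ C) (hwC : ∀ᵐ y, |w y| ≤ C)
    (x : RN N) : propagate α β t s (fun y => v y - w y) x
      = propagate α β t s v x - propagate α β t s w x := by
  rw [propagate, propagate, propagate, ← integral_sub
    (integrable_propKernel_mul hα0 hα2 hβ hs hst hv hvC x)
    (integrable_propKernel_mul hα0 hα2 hβ hs hst hw hwC x)]
  simp only [mul_sub]

lemma tendsto_propagate {f : ℕ → RN N → ℝ} {v : RN N → ℝ} (hf : ∀ n, Measurable (f n)) {C : ℝ}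
    (hC : ∀ n y, |f n y| ≤ C) (hlim : ∀ y, Tendsto (fun n => f n y) atTop (𝓝 (v y))) (x : RN N) :
    Tendsto (fun n => propagate α β t s (f n) x) atTop (𝓝 (propagate α β t s v x)) := by
  refine tendsto_integral_of_dominated_convergence (fun y => propKernel N α β t s y * C)
    (fun n => (integrable_propKernel_mul hα0 hα2 hβ hs hst (hf n).aestronglyMeasurable
      (ae_of_all _ (hC n)) x).aestronglyMeasurable)
    ((integrable_propKernel hα0 hα2 hβ hs hst).mul_const C) (fun n => ae_of_all _ fun y => ?_)
    (ae_of_all _ fun y => (hlim (x - y)).const_mul _)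
  have h0 := propKernel_nonneg (N := N) hα0 hα2 hβ hs hst y
  rw [norm_mul, Real.norm_of_nonneg h0]
  exact mul_le_mul_of_nonneg_left (hC n _) h0

end

lemma propKernel_conv {α β r s t : ℝ} (hα0 : 0 < α) (hα2 : α < 2) (hβ : 0 ≤ β) (hr : 0 ≤ r)
    (hrs : r < s) (hst : s < t) (z : RN N) :
    ∫ y, propKernel N α β t s y * propKernel N α β s r (z - y) = propKernel N α β t r z := by
  have h := integral_mixedKernel_mul_mixedKernel_sub (N := N) hα0 hα2
    (clock_sub_pos hβ (hr.trans hrs.le) hst) (clock_sub_pos hβ hr hrs) z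
  rw [sub_add_sub_cancel] at h
  exact h

/-- Fubini and the semigroup law of the kernels: the increments of the clock `t^(β+1)/(β+1)` add up.
The integrand is an integrable convolution integrand times a bounded function. -/
lemma propagate_propagate {α β r s t : ℝ} (hα0 : 0 < α) (hα2 : α < 2) (hβ : 0 ≤ β) (hr : 0 ≤ r)
    (hrs : r < s) (hst : s < t) {v : RN N → ℝ} (hv : Measurable v) {C : ℝ} (hC : ∀ y, |v y| ≤ C)
    (x : RN N) :
    propagate α β t s (propagate α β s r v) x = propagate α β t r v x := by
  have hs : 0 ≤ s := hr.trans hrs.le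
  have hint : Integrable (Function.uncurry fun (y z : RN N) =>
      propKernel N α β t s y * propKernel N α β s r (z - y) * v (x - z))
      (volume.prod volume) := by
    have h1 := ((integrable_propKernel (N := N) hα0 hα2 hβ hs hst).convolution_integrand
      (ContinuousLinearMap.mul ℝ ℝ) (integrable_propKernel (N := N) hα0 hα2 hβ hr hrs)).swap
    refine Integrable.mul_bdd (c := C) h1 ?_ (ae_of_all _ fun z => hC _)
    exact (hv.comp (f := fun z : RN N × RN N => x - z.2) (by fun_prop)).aestronglyMeasurable
  calc propagate α β t s (propagate α β s r v) x
      = ∫ y, ∫ z, propKernel N α β t s y * propKernel N α β s r (z - y) * v (x - z) := by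
        rw [propagate]
        congr 1 with y
        rw [propagate, ← integral_const_mul,
          ← integral_sub_right_eq_self _ y]
        congr 1 with z
        rw [sub_sub, add_sub_cancel, mul_assoc]
    _ = ∫ z, ∫ y, propKernel N α β t s y * propKernel N α β s r (z - y) * v (x - z) :=
        integral_integral_swap hint
    _ = propagate α β t r v x := by
        rw [propagate]
        congr 1 with z
        rw [integral_mul_const, propKernel_conv hα0 hα2 hβ hr hrs hst]

/-! ### The power nonlinearity -/

/-- The odd power `v ↦ |v|^{p-1} v`. -/
def oddPow (p v : ℝ) : ℝ := |v| ^ (p - 1) * v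

@[fun_prop]
lemma measurable_oddPow (p : ℝ) : Measurable (oddPow p) := by
  have h : Measurable fun v : ℝ => |v| := measurable_norm
  exact (h.pow_const _).mul measurable_id

@[fun_prop]
lemma continuous_oddPow {p : ℝ} (hp : 1 < p) : Continuous (oddPow p) :=
  (continuous_abs.rpow_const fun _ => Or.inr (by linarith)).mul continuous_id

lemma oddPow_neg (p v : ℝ) : oddPow p (-v) = -oddPow p v := by simp [oddPow]

lemma oddPow_of_nonneg {p v : ℝ} (hp : 1 < p) (hv : 0 ≤ v) : oddPow p v = v ^ p := by
  rw [oddPow, abs_of_nonneg hv]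
  rcases hv.eq_or_lt with rfl | hv
  · rw [mul_zero, Real.zero_rpow (by linarith)]
  · nth_rw 2 [← Real.rpow_one v]
    rw [← Real.rpow_add hv]
    ring_nf

lemma abs_oddPow_le {p v M : ℝ} (hp : 1 < p) (hv : |v| ≤ M) :
    |oddPow p v| ≤ M ^ (p - 1) * |v| := by
  rw [oddPow, abs_mul, abs_of_nonneg (Real.rpow_nonneg (abs_nonneg v) _)]
  exact mul_le_mul_of_nonneg_right
    (Real.rpow_le_rpow (abs_nonneg _) hv (by linarith)) (abs_nonneg _)

lemma oddPow_sub_le_of_nonneg {p a b M : ℝ} (hp : 1 < p) (hb : 0 ≤ b) (hba : b ≤ a) (ha : a ≤ M) :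
    0 ≤ oddPow p a - oddPow p b ∧ oddPow p a - oddPow p b ≤ p * M ^ (p - 1) * (a - b) := by
  have ha0 : 0 ≤ a := hb.trans hba
  rw [oddPow_of_nonneg hp ha0, oddPow_of_nonneg hp hb]
  refine ⟨sub_nonneg.2 (Real.rpow_le_rpow hb hba (by linarith)), ?_⟩
  have h := (convex_Icc b a).norm_image_sub_le_of_norm_hasDerivWithin_le
    (f := fun x : ℝ => x ^ p) (f' := fun x => p * x ^ (p - 1)) (C := p * M ^ (p - 1))
    (fun x _ => (Real.hasDerivAt_rpow_const (Or.inr hp.le)).hasDerivWithinAt) (fun x hx => ?_)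
    (left_mem_Icc.2 hba) (right_mem_Icc.2 hba)
  · rw [Real.norm_eq_abs, Real.norm_eq_abs, abs_of_nonneg (sub_nonneg.2 hba)] at h
    exact (le_abs_self _).trans h
  · have hx0 : 0 ≤ x := hb.trans hx.1
    rw [Real.norm_of_nonneg (by positivity)]
    exact mul_le_mul_of_nonneg_left
      (Real.rpow_le_rpow hx0 (hx.2.trans ha) (by linarith)) (by linarith)

/-- The mean value bound on the half-line transfers to the negative side by oddness; if `0`
separates the two points, both are compared with it. The upper bound fixes the relaxation constant
`p M^(p-1)`. -/
lemma oddPow_sub_le {p a b M : ℝ} (hp : 1 < p) (hb : -M ≤ b) (hba : b ≤ a) (ha : a ≤ M) :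
    0 ≤ oddPow p a - oddPow p b ∧ oddPow p a - oddPow p b ≤ p * M ^ (p - 1) * (a - b) := by
  rcases le_total 0 b with hb0 | hb0
  · exact oddPow_sub_le_of_nonneg hp hb0 hba ha
  rcases le_total a 0 with ha0 | ha0
  · have h := oddPow_sub_le_of_nonneg (a := -b) (b := -a) (M := M) hp (by linarith) (by linarith)
      (by linarith)
    rw [oddPow_neg, oddPow_neg] at h
    constructor <;> linarith [h.1, h.2]
  · have hM : 0 ≤ M := ha0.trans ha
    have h1 := oddPow_sub_le_of_nonneg (a := a) (b := 0) (M := M) hp le_rfl ha0 ha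
    have h2 := oddPow_sub_le_of_nonneg (a := -b) (b := 0) (M := M) hp le_rfl (by linarith)
      (by linarith)
    rw [oddPow_neg] at h2
    have h0 : oddPow p 0 = 0 := by simp [oddPow]
    rw [h0] at h1 h2
    constructor
    · linarith [h1.1, h2.1]
    · linarith [h1.2, h2.2]

lemma abs_oddPow_sub_le {p a b M : ℝ} (hp : 1 < p) (ha : |a| ≤ M) (hb : |b| ≤ M) :
    |oddPow p a - oddPow p b| ≤ p * M ^ (p - 1) * |a - b| := by
  rw [abs_le] at ha hb
  rcases le_total b a with h | h
  · have := oddPow_sub_le hp hb.1 h ha.2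
    rw [abs_of_nonneg this.1, abs_of_nonneg (sub_nonneg.2 h)]
    exact this.2
  · have := oddPow_sub_le hp ha.1 h hb.2
    rw [abs_sub_comm, abs_sub_comm a b, abs_of_nonneg this.1, abs_of_nonneg (sub_nonneg.2 h)]
    exact this.2

/-! ### Weights -/

/-- Nonnegative locally integrable Borel weights. -/
structure IsWeight (k : ℝ → ℝ) : Prop where
  measurable : Measurable k
  nonneg : ∀ s, 0 ≤ k s
  intervalIntegrable : ∀ a b, IntervalIntegrable k volume a b

namespace IsWeight

variable {k : ℝ → ℝ} (hk : IsWeight k)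

include hk

lemma integrableOn_Ioc (t : ℝ) : IntegrableOn k (Ioc 0 t) := by
  rcases le_total 0 t with ht | ht
  · exact (intervalIntegrable_iff_integrableOn_Ioc_of_le ht).1 (hk.intervalIntegrable 0 t)
  · simp [Ioc_eq_empty_of_le ht]

lemma integrableOn_Ioo (t : ℝ) : IntegrableOn k (Ioo 0 t) :=
  (hk.integrableOn_Ioc t).mono_set Ioo_subset_Ioc_self

lemma continuous_primitive : Continuous (primitive k) :=
  intervalIntegral.continuous_primitive hk.intervalIntegrable 0

lemma primitive_mono : Monotone (primitive k) := fun s t hst => by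
  have h := intervalIntegral.integral_add_adjacent_intervals
    (hk.intervalIntegrable 0 s) (hk.intervalIntegrable s t)
  have h2 : 0 ≤ ∫ r in s..t, k r :=
    intervalIntegral.integral_nonneg hst fun r _ => hk.nonneg r
  simp only [primitive]
  linarith

lemma primitive_nonneg {t : ℝ} (ht : 0 ≤ t) : 0 ≤ primitive k t := by
  have := hk.primitive_mono ht
  rwa [show primitive k 0 = 0 by simp [primitive]] at this

lemma integrableOn_mul {t : ℝ} {φ : ℝ → ℝ}
    (hφ : AEStronglyMeasurable φ (volume.restrict (Ioo 0 t))) {C : ℝ}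
    (hC : ∀ s ∈ Ioo 0 t, |φ s| ≤ C) : IntegrableOn (fun s => k s * φ s) (Ioo 0 t) := by
  refine (hk.integrableOn_Ioo t).mul_bdd (c := C) hφ ?_
  filter_upwards [ae_restrict_mem measurableSet_Ioo] with s hs using hC s hs

lemma setIntegral_mul_exp {t : ℝ} (ht : 0 ≤ t) (lam : ℝ) :
    ∫ s in Ioo 0 t, k s * (lam * Real.exp (lam * primitive k s))
      = Real.exp (lam * primitive k t) - 1 := by
  have h := integral_mul_exp_primitive le_rfl ht (hk.integrableOn_Ioc t) lam
  rw [intervalIntegral.integral_of_le ht, integral_Ioc_eq_integral_Ioo] at h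
  rw [h]
  simp [primitive]

/-- Integration by parts against `exp (-L ∫₀ˢ k)`. -/
lemma setIntegral_exp_neg_mul {t : ℝ} (ht : 0 ≤ t) (L c : ℝ) {P : ℝ → ℝ}
    (hP : IntegrableOn (fun s => k s * (Real.exp (L * primitive k s) * P s)) (Ioo 0 t)) :
    ∫ s in Ioo 0 t, k s * (L * (Real.exp (-(L * primitive k s)) *
        (c + ∫ r in Ioo 0 s, k r * (Real.exp (L * primitive k r) * P r))))
      = c + (∫ s in Ioo 0 t, k s * P s) - Real.exp (-(L * primitive k t)) *
        (c + ∫ s in Ioo 0 t, k s * (Real.exp (L * primitive k s) * P s)) := by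
  set m : ℝ → ℝ := fun s => k s * (Real.exp (L * primitive k s) * P s) with hm
  have hmi : IntervalIntegrable m volume 0 t :=
    (intervalIntegrable_iff_integrableOn_Ioo_of_le ht).2 hP
  have hQ : ∀ s, 0 ≤ s → ∫ r in Ioo 0 s, m r = ∫ r in (0 : ℝ)..s, m r := fun s hs => by
    rw [intervalIntegral.integral_of_le hs, integral_Ioc_eq_integral_Ioo]
  have hki := hk.intervalIntegrable 0 t
  have hacH : AbsolutelyContinuousOnInterval (primitive k) 0 t :=
    hki.absolutelyContinuousOnInterval_intervalIntegral (c := 0) left_mem_uIcc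
  have hacE := absolutelyContinuousOnInterval_exp (hacH.const_mul (-L))
  have hacQ : AbsolutelyContinuousOnInterval (fun s => c + ∫ r in (0 : ℝ)..s, m r) 0 t :=
    (LipschitzOnWith.absolutelyContinuousOnInterval (K := 0)
      (LipschitzWith.const c).lipschitzOnWith).add
      (hmi.absolutelyContinuousOnInterval_intervalIntegral (c := 0) left_mem_uIcc)
  -- The product rule is applied to `exp(-L K) (c + Q)`, where `K` and `Q` are the primitives of `k`
  -- and `m`; both factors are absolutely continuous. In the term with `Q'` the two exponentials
  -- cancel and leave `k P`.
  have hparts := hacE.integral_deriv_mul_eq_sub hacQ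
  have hcongr : ∫ s in (0 : ℝ)..t, (deriv (fun s => Real.exp (-L * primitive k s)) s
        * (c + ∫ r in (0 : ℝ)..s, m r) + Real.exp (-L * primitive k s)
        * deriv (fun s => c + ∫ r in (0 : ℝ)..s, m r) s)
      = ∫ s in (0 : ℝ)..t, (k s * P s - k s * (L * (Real.exp (-(L * primitive k s)) *
        (c + ∫ r in (0 : ℝ)..s, m r)))) := by
    refine intervalIntegral.integral_congr_ae ?_
    filter_upwards [hki.ae_hasDerivAt_integral, hmi.ae_hasDerivAt_integral] with s h1 h2 hs
    have hs' : s ∈ uIcc 0 t := uIoc_subset_uIcc hs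
    have d1 := (((h1 hs' 0 left_mem_uIcc).const_mul (-L)).exp).deriv
    have d2 := ((h2 hs' 0 left_mem_uIcc).const_add c).deriv
    simp only [primitive] at d1 ⊢
    rw [d1, d2]
    simp only [hm, primitive]
    have e : Real.exp (-L * ∫ r in (0 : ℝ)..s, k r) * Real.exp (L * ∫ r in (0 : ℝ)..s, k r) = 1 := by
      rw [← Real.exp_add]; simp
    rw [show -(L * ∫ r in (0 : ℝ)..s, k r) = -L * ∫ r in (0 : ℝ)..s, k r by ring]
    linear_combination (k s * P s) * e
  rw [hcongr] at hparts
  have hi1 : IntervalIntegrable (fun s => k s * P s) volume 0 t := by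
    have hc : Continuous fun s => Real.exp (-L * primitive k s) := by
      have := hk.continuous_primitive
      fun_prop
    refine (hmi.mul_continuousOn hc.continuousOn).congr fun s _ => ?_
    simp only [hm]
    have e : Real.exp (L * primitive k s) * Real.exp (-L * primitive k s) = 1 := by
      rw [← Real.exp_add]; simp
    linear_combination (k s * P s) * e
  have hi2 : IntervalIntegrable (fun s => k s * (L * (Real.exp (-(L * primitive k s)) *
        (c + ∫ r in (0 : ℝ)..s, m r)))) volume 0 t := by
    refine hki.mul_continuousOn (ContinuousOn.mul continuousOn_const (ContinuousOn.mul ?_ ?_))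
    · have hc : Continuous fun s => Real.exp (-(L * primitive k s)) := by
        have := hk.continuous_primitive
        fun_prop
      exact hc.continuousOn
    · exact hacQ.continuousOn
  rw [intervalIntegral.integral_sub hi1 hi2] at hparts
  have e1 : ∫ s in Ioo 0 t, k s * (L * (Real.exp (-(L * primitive k s)) *
        (c + ∫ r in Ioo 0 s, m r)))
      = ∫ s in (0 : ℝ)..t, k s * (L * (Real.exp (-(L * primitive k s)) *
        (c + ∫ r in (0 : ℝ)..s, m r))) := by
    rw [intervalIntegral.integral_of_le ht, integral_Ioc_eq_integral_Ioo]
    refine setIntegral_congr_fun measurableSet_Ioo fun s hs => ?_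
    rw [hQ s hs.1.le]
  have e2 : ∫ s in Ioo 0 t, k s * P s = ∫ s in (0 : ℝ)..t, k s * P s := by
    rw [intervalIntegral.integral_of_le ht, integral_Ioc_eq_integral_Ioo]
  rw [e1, e2, hQ t ht]
  simp only [neg_mul, intervalIntegral.integral_same, add_zero] at hparts
  have h0 : primitive k 0 = 0 := by simp [primitive]
  rw [h0, mul_zero, neg_zero, Real.exp_zero, one_mul] at hparts
  linarith

end IsWeight

/-! ### The order-preserving fixed point problem -/

lemma measurable_evolution {α β : ℝ} {a : RN N → ℝ} (ha : Measurable a) :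
    Measurable fun q : ℝ × RN N => evolution α β q.1 0 a q.2 := by
  have h1 : Measurable fun q : ℝ × RN N => propagate α β q.1 0 a q.2 :=
    (measurable_propagate (α := α) (β := β) (w := fun _ => a) (ha.comp measurable_snd)).comp
      (f := fun q : ℝ × RN N => ((q.1, (0 : ℝ)), q.2)) (by fun_prop)
  have h2 : MeasurableSet {q : ℝ × RN N |
      q.1 ^ (β + 1) / (β + 1) - (0 : ℝ) ^ (β + 1) / (β + 1) = 0} :=
    measurableSet_eq_fun (by fun_prop) measurable_const
  have e : (fun q : ℝ × RN N => evolution α β q.1 0 a q.2) = fun q : ℝ × RN N =>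
      if q.1 ^ (β + 1) / (β + 1) - (0 : ℝ) ^ (β + 1) / (β + 1) = 0
      then a q.2 else propagate α β q.1 0 a q.2 := by
    funext q
    simp only [evolution, mixedSemigroup]
    split_ifs <;> rfl
  rw [e]
  exact Measurable.ite h2 (ha.comp measurable_snd) h1

/-- The nonlinearity of the equation after adding `L u` to both sides. -/
def relaxed (p L v : ℝ) : ℝ := L * v - oddPow p v

@[fun_prop]
lemma measurable_relaxed (p L : ℝ) : Measurable (relaxed p L) := by
  unfold relaxed; fun_prop

lemma continuous_relaxed {p : ℝ} (hp : 1 < p) (L : ℝ) : Continuous (relaxed p L) :=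
  (continuous_const.mul continuous_id).sub (continuous_oddPow hp)

lemma relaxed_mono {p M a b : ℝ} (hp : 1 < p) (hb : -M ≤ b) (hba : b ≤ a) (ha : a ≤ M) :
    relaxed p (p * M ^ (p - 1)) b ≤ relaxed p (p * M ^ (p - 1)) a := by
  have := (oddPow_sub_le hp hb hba ha).2
  simp only [relaxed]
  linarith

lemma relaxed_zero (p L : ℝ) : relaxed p L 0 = 0 := by simp [relaxed, oddPow]

lemma relaxed_neg (p L v : ℝ) : relaxed p L (-v) = -relaxed p L v := by
  simp only [relaxed, oddPow_neg]; ring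

lemma oddPow_nonneg {p v : ℝ} (hv : 0 ≤ v) : 0 ≤ oddPow p v :=
  mul_nonneg (Real.rpow_nonneg (abs_nonneg _) _) hv

/-- For `0 ≤ v ≤ M` the relaxed term lies between `0`, by monotonicity, and `L v`, since the
absorbed power is nonnegative; oddness covers `v ≤ 0`. The sign of the nonlinearity enters here. -/
lemma abs_relaxed_le {p M v : ℝ} (hp : 1 < p) (hv : |v| ≤ M) :
    |relaxed p (p * M ^ (p - 1)) v| ≤ p * M ^ (p - 1) * |v| := by
  have hM : 0 ≤ M := (abs_nonneg v).trans hv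
  rw [abs_le] at hv
  rcases le_total 0 v with h | h
  · have h1 := relaxed_mono hp (by linarith) h hv.2
    rw [relaxed_zero] at h1
    rw [abs_of_nonneg h1, abs_of_nonneg h]
    simp only [relaxed]
    linarith [oddPow_nonneg (p := p) h]
  · have h1 := relaxed_mono hp hv.1 h hM
    rw [relaxed_zero] at h1
    rw [abs_of_nonpos h1, abs_of_nonpos h, ← relaxed_neg]
    simp only [relaxed]
    linarith [oddPow_nonneg (p := p) (show 0 ≤ -v by linarith)]

/-- The integrand of the relaxed Duhamel formula. -/
def relaxedIntegrand (α β p L : ℝ) (k : ℝ → ℝ) (z : ℝ → RN N → ℝ) (t : ℝ) (x : RN N)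
    (s : ℝ) : ℝ :=
  k s * (Real.exp (L * primitive k s) * propagate α β t s (fun y => relaxed p L (z s y)) x)

/-- The right-hand side of the relaxed Duhamel formula. -/
def relaxedMap (α β p L : ℝ) (k : ℝ → ℝ) (a : RN N → ℝ) (z : ℝ → RN N → ℝ) (t : ℝ)
    (x : RN N) : ℝ :=
  Real.exp (-(L * primitive k t)) *
    (evolution α β t 0 a x + ∫ s in Ioo 0 t, relaxedIntegrand α β p L k z t x s)

lemma measurable_relaxedIntegrand {α β p L : ℝ} {k : ℝ → ℝ} (hk : IsWeight k)
    {z : ℝ → RN N → ℝ} (hz : Measurable (Function.uncurry z)) :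
    Measurable fun q : (ℝ × RN N) × ℝ => relaxedIntegrand α β p L k z q.1.1 q.1.2 q.2 := by
  have hw : Measurable (Function.uncurry fun s y => relaxed p L (z s y)) :=
    (measurable_relaxed p L).comp hz
  have h1 := (measurable_propagate (α := α) (β := β) hw).comp
    (f := fun q : (ℝ × RN N) × ℝ => ((q.1.1, q.2), q.1.2)) (by fun_prop)
  have h2 := hk.measurable
  have h3 := hk.continuous_primitive.measurable
  unfold relaxedIntegrand
  exact (h2.comp measurable_snd).mul
    (((h3.comp measurable_snd).const_mul L).exp.mul h1)

lemma measurable_relaxedMap {α β p L : ℝ} {k : ℝ → ℝ} (hk : IsWeight k) {a : RN N → ℝ}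
    (ha : Measurable a) {z : ℝ → RN N → ℝ} (hz : Measurable (Function.uncurry z)) :
    Measurable (Function.uncurry (relaxedMap α β p L k a z)) := by
  have h1 := measurable_relaxedIntegrand (α := α) (β := β) (p := p) (L := L) hk hz
  -- The domain of integration varies with `t`; writing it as an indicator makes the integral a
  -- parametric one over a fixed space.
  have h2 : MeasurableSet {q : (ℝ × RN N) × ℝ | q.2 ∈ Ioo 0 q.1.1} :=
    (measurableSet_lt measurable_const measurable_snd).inter
      (measurableSet_lt measurable_snd (measurable_fst.comp measurable_fst))
  have h3 := (h1.indicator h2).stronglyMeasurable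
  have h4 := (StronglyMeasurable.integral_prod_right (ν := volume)
    (f := fun (q : ℝ × RN N) (s : ℝ) => {q : (ℝ × RN N) × ℝ | q.2 ∈ Ioo 0 q.1.1}.indicator
      (fun q : (ℝ × RN N) × ℝ => relaxedIntegrand α β p L k z q.1.1 q.1.2 q.2) (q, s)) h3).measurable
  have h5 := hk.continuous_primitive.measurable
  have e : Function.uncurry (relaxedMap α β p L k a z) = fun q : ℝ × RN N =>
      Real.exp (-(L * primitive k q.1)) * (evolution α β q.1 0 a q.2 + ∫ s,
        {q : (ℝ × RN N) × ℝ | q.2 ∈ Ioo 0 q.1.1}.indicator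
        (fun q : (ℝ × RN N) × ℝ => relaxedIntegrand α β p L k z q.1.1 q.1.2 q.2) (q, s)) := by
    funext q
    simp only [Function.uncurry, relaxedMap]
    rw [← integral_indicator measurableSet_Ioo]
    rfl
  rw [e]
  exact ((h5.comp measurable_fst).const_mul L).neg.exp.mul ((measurable_evolution ha).add h4)

section

variable {α β p M : ℝ} {k : ℝ → ℝ} {a : RN N → ℝ} (hα0 : 0 < α) (hα2 : α < 2) (hβ : 0 ≤ β)
  (hp : 1 < p) (hk : IsWeight k) (ha : Measurable a) (haM : ∀ y, |a y| ≤ M)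

include hα0 hα2 hβ

lemma abs_evolution_le {b : RN N → ℝ} (hb : ∀ y, |b y| ≤ M) {t : ℝ} (ht : 0 ≤ t) (x : RN N) :
    |evolution α β t 0 b x| ≤ M := by
  rcases ht.eq_or_lt with rfl | ht
  · rw [evolution_self]; exact hb x
  · rw [evolution_of_lt hβ le_rfl ht]
    exact abs_propagate_le hα0 hα2 hβ le_rfl ht (ae_of_all _ hb) x

lemma propagate_evolution {b : RN N → ℝ} (hb : Measurable b) (hbM : ∀ y, |b y| ≤ M) {s t : ℝ}
    (hs : 0 ≤ s) (hst : s < t) (x : RN N) :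
    propagate α β t s (evolution α β s 0 b) x = evolution α β t 0 b x := by
  rw [evolution_of_lt hβ le_rfl (hs.trans_lt hst)]
  rcases hs.eq_or_lt with rfl | hs
  · rw [evolution_self]
  · rw [evolution_of_lt hβ le_rfl hs]
    exact propagate_propagate hα0 hα2 hβ le_rfl hs hst hb hbM x

include ha haM

lemma abs_evolution_le_evolution_abs {t : ℝ} (ht : 0 ≤ t) (x : RN N) :
    |evolution α β t 0 a x| ≤ evolution α β t 0 (fun y => |a y|) x := by
  rcases ht.eq_or_lt with rfl | ht
  · rw [evolution_self, evolution_self]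
  · rw [evolution_of_lt hβ le_rfl ht, evolution_of_lt hβ le_rfl ht]
    exact abs_propagate_le_propagate hα0 hα2 hβ le_rfl ht ha.norm.aestronglyMeasurable
      (ae_of_all _ fun y => by simpa using haM y) (ae_of_all _ fun y => le_rfl) x

omit ha in
/-- Functions dominated by the linear evolution of `|a|` are bounded. -/
lemma abs_le_of_le_evolution {z : RN N → ℝ} {t : ℝ} (ht : 0 ≤ t)
    (hz : ∀ x, |z x| ≤ evolution α β t 0 (fun y => |a y|) x) (x : RN N) : |z x| ≤ M :=
  (hz x).trans ((le_abs_self _).trans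
    (abs_evolution_le hα0 hα2 hβ (fun y => by simpa using haM y) ht x))

variable {z : ℝ → RN N → ℝ} (hz : Measurable (Function.uncurry z))
  (hzA : ∀ t, 0 ≤ t → ∀ x, |z t x| ≤ evolution α β t 0 (fun y => |a y|) x)

include hp hzA

/-- The relaxed term is at most `L S(s,0)|a|`, and `S(t,s)` carries this to `L S(t,0)|a|`. The bound
no longer depends on `s`, so the time integral that follows is explicit. -/
lemma abs_propagate_relaxed_le {s t : ℝ} (hs : 0 ≤ s) (hst : s < t) (x : RN N) :
    |propagate α β t s (fun y => relaxed p (p * M ^ (p - 1)) (z s y)) x|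
      ≤ p * M ^ (p - 1) * evolution α β t 0 (fun y => |a y|) x := by
  have hM : 0 ≤ M := (abs_nonneg _).trans (haM 0)
  have hL : 0 ≤ p * M ^ (p - 1) := by positivity
  have haM' : ∀ y, |(|a y|)| ≤ M := fun y => by simpa using haM y
  have hA : Measurable fun x => evolution α β s 0 (fun y => |a y|) x :=
    (measurable_evolution (α := α) (β := β) ha.norm).comp
      (f := fun x : RN N => (s, x)) (by fun_prop)
  have h := abs_propagate_le_propagate (N := N) hα0 hα2 hβ hs hst
    (v := fun y => relaxed p (p * M ^ (p - 1)) (z s y))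
    (w := fun y => p * M ^ (p - 1) * evolution α β s 0 (fun y => |a y|) y)
    (hA.const_mul _).aestronglyMeasurable (C := p * M ^ (p - 1) * M)
    (ae_of_all _ fun y => by
      rw [abs_mul, abs_of_nonneg hL]
      exact mul_le_mul_of_nonneg_left (abs_evolution_le hα0 hα2 hβ haM' hs y) hL)
    (ae_of_all _ fun y => (abs_relaxed_le hp
      (abs_le_of_le_evolution hα0 hα2 hβ haM hs (hzA s hs) y)).trans
        (mul_le_mul_of_nonneg_left (hzA s hs y) hL)) x
  refine h.trans (le_of_eq ?_)
  have ham : Measurable fun y => |a y| := ha.norm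
  rw [← propagate_evolution hα0 hα2 hβ ham haM' hs hst, propagate, propagate,
    ← integral_const_mul]
  congr 1 with y
  ring

include hk hz

lemma integrableOn_relaxedIntegrand (t : ℝ) (x : RN N) :
    IntegrableOn (relaxedIntegrand α β p (p * M ^ (p - 1)) k z t x) (Ioo 0 t) := by
  have hM : 0 ≤ M := (abs_nonneg _).trans (haM 0)
  have hL : 0 ≤ p * M ^ (p - 1) := by positivity
  have hw : Measurable (Function.uncurry fun s y => relaxed p (p * M ^ (p - 1)) (z s y)) :=
    (measurable_relaxed p _).comp hz
  have h1 := (measurable_propagate (α := α) (β := β) hw).comp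
    (f := fun s : ℝ => ((t, s), x)) (by fun_prop)
  have h3 := hk.continuous_primitive.measurable
  refine hk.integrableOn_mul (C := Real.exp (p * M ^ (p - 1) * primitive k t) *
    (p * M ^ (p - 1) * evolution α β t 0 (fun y => |a y|) x))
    ((h3.const_mul _).exp.mul h1).aestronglyMeasurable fun s hs => ?_
  rw [abs_mul, Real.abs_exp]
  exact mul_le_mul (Real.exp_le_exp.2 (mul_le_mul_of_nonneg_left (hk.primitive_mono hs.2.le) hL))
    (abs_propagate_relaxed_le hα0 hα2 hβ hp ha haM hzA hs.1.le hs.2 x) (abs_nonneg _)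
    (Real.exp_nonneg _)

omit hz in
-- With `A = S(t,0)|a|` and `K` the primitive of `k`, the linear part contributes at most `A` and
-- the integral at most `A (exp(L K(t)) - 1)`; the prefactor `exp(-L K(t))` reduces the sum exactly
-- to `A`. Domination by the linear evolution is thus invariant, with no restriction on the length
-- of time.
lemma abs_relaxedMap_le {t : ℝ} (ht : 0 ≤ t) (x : RN N) :
    |relaxedMap α β p (p * M ^ (p - 1)) k a z t x| ≤ evolution α β t 0 (fun y => |a y|) x := by
  set L := p * M ^ (p - 1) with hL
  set A := evolution α β t 0 (fun y => |a y|) x with hA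
  have h1 : |∫ s in Ioo 0 t, relaxedIntegrand α β p L k z t x s|
      ≤ A * (Real.exp (L * primitive k t) - 1) := by
    rw [← hk.setIntegral_mul_exp ht L, ← integral_const_mul, ← Real.norm_eq_abs]
    refine norm_integral_le_of_norm_le ?_ ?_
    · refine (hk.integrableOn_mul (C := |L| * Real.exp (|L| * primitive k t)) ?_
        fun s hs => ?_).const_mul A
      · have := hk.continuous_primitive
        exact Continuous.aestronglyMeasurable (by fun_prop)
      · rw [abs_mul, Real.abs_exp]
        refine mul_le_mul_of_nonneg_left (Real.exp_le_exp.2 ?_) (abs_nonneg _)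
        exact mul_le_mul (le_abs_self _) (hk.primitive_mono hs.2.le)
          (hk.primitive_nonneg hs.1.le) (abs_nonneg _)
    · filter_upwards [ae_restrict_mem measurableSet_Ioo] with s hs
      rw [relaxedIntegrand, norm_mul, norm_mul, Real.norm_of_nonneg (hk.nonneg s),
        Real.norm_of_nonneg (Real.exp_nonneg _), Real.norm_eq_abs]
      have := abs_propagate_relaxed_le hα0 hα2 hβ hp ha haM hzA hs.1.le hs.2 x
      calc _ ≤ k s * (Real.exp (L * primitive k s) * (L * A)) :=
            mul_le_mul_of_nonneg_left (mul_le_mul_of_nonneg_left this (Real.exp_nonneg _))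
              (hk.nonneg s)
        _ = _ := by ring
  rw [relaxedMap, abs_mul, Real.abs_exp]
  have h2 := abs_evolution_le_evolution_abs hα0 hα2 hβ ha haM ht x
  calc Real.exp (-(L * primitive k t)) * |evolution α β t 0 a x
        + ∫ s in Ioo 0 t, relaxedIntegrand α β p L k z t x s|
      ≤ Real.exp (-(L * primitive k t)) * (A + A * (Real.exp (L * primitive k t) - 1)) :=
        mul_le_mul_of_nonneg_left ((abs_add_le _ _).trans (add_le_add h2 h1)) (Real.exp_nonneg _)
    _ = A * (Real.exp (-(L * primitive k t)) * Real.exp (L * primitive k t)) := by ring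
    _ = A := by rw [← Real.exp_add]; simp

lemma relaxedMap_mono {z' : ℝ → RN N → ℝ} (hz' : Measurable (Function.uncurry z'))
    (hzA' : ∀ t, 0 ≤ t → ∀ x, |z' t x| ≤ evolution α β t 0 (fun y => |a y|) x)
    (hle : ∀ t, 0 ≤ t → ∀ x, z t x ≤ z' t x) (t : ℝ) (x : RN N) :
    relaxedMap α β p (p * M ^ (p - 1)) k a z t x
      ≤ relaxedMap α β p (p * M ^ (p - 1)) k a z' t x := by
  refine mul_le_mul_of_nonneg_left (add_le_add le_rfl ?_) (Real.exp_nonneg _)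
  refine setIntegral_mono_on (integrableOn_relaxedIntegrand hα0 hα2 hβ hp hk ha haM hz hzA t x)
    (integrableOn_relaxedIntegrand hα0 hα2 hβ hp hk ha haM hz' hzA' t x) measurableSet_Ioo
    fun s hs => ?_
  have hM : 0 ≤ M := (abs_nonneg _).trans (haM 0)
  have hL : 0 ≤ p * M ^ (p - 1) := by positivity
  have hb := fun y => abs_le_of_le_evolution hα0 hα2 hβ haM hs.1.le (hzA s hs.1.le) y
  have hb' := fun y => abs_le_of_le_evolution hα0 hα2 hβ haM hs.1.le (hzA' s hs.1.le) y
  have hm : Measurable fun y => relaxed p (p * M ^ (p - 1)) (z s y) :=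
    (measurable_relaxed p _).comp (hz.comp (measurable_const.prodMk measurable_id))
  have hm' : Measurable fun y => relaxed p (p * M ^ (p - 1)) (z' s y) :=
    (measurable_relaxed p _).comp (hz'.comp (measurable_const.prodMk measurable_id))
  refine mul_le_mul_of_nonneg_left (mul_le_mul_of_nonneg_left ?_ (Real.exp_nonneg _))
    (hk.nonneg s)
  refine propagate_mono hα0 hα2 hβ hs.1.le hs.2 hm.aestronglyMeasurable hm'.aestronglyMeasurable
    (C := p * M ^ (p - 1) * M)
    (ae_of_all _ fun y => (abs_relaxed_le hp (hb y)).trans (mul_le_mul_of_nonneg_left (hb y) hL))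
    (ae_of_all _ fun y => (abs_relaxed_le hp (hb' y)).trans (mul_le_mul_of_nonneg_left (hb' y) hL))
    (ae_of_all _ fun y => ?_) x
  exact relaxed_mono hp (abs_le.1 (hb y)).1 (hle s hs.1.le y) (abs_le.1 (hb' y)).2

omit ha hz in
lemma relaxedMap_nonneg (ha0 : ∀ y, 0 ≤ a y) (hz0 : ∀ t, 0 ≤ t → ∀ x, 0 ≤ z t x) {t : ℝ}
    (ht : 0 ≤ t) (x : RN N) : 0 ≤ relaxedMap α β p (p * M ^ (p - 1)) k a z t x := by
  have hM : 0 ≤ M := (abs_nonneg _).trans (haM 0)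
  refine mul_nonneg (Real.exp_nonneg _) (add_nonneg ?_ (setIntegral_nonneg measurableSet_Ioo
    fun s hs => ?_))
  · rcases ht.eq_or_lt with rfl | ht
    · rw [evolution_self]; exact ha0 x
    · rw [evolution_of_lt hβ le_rfl ht]
      exact propagate_nonneg hα0 hα2 hβ le_rfl ht (ae_of_all _ ha0) x
  · refine mul_nonneg (hk.nonneg s) (mul_nonneg (Real.exp_nonneg _)
      (propagate_nonneg hα0 hα2 hβ hs.1.le hs.2 (ae_of_all _ fun y => ?_) x))
    have hb := abs_le_of_le_evolution hα0 hα2 hβ haM hs.1.le (hzA s hs.1.le) y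
    have := relaxed_mono hp (by linarith) (hz0 s hs.1.le y) (abs_le.1 hb).2
    rwa [relaxed_zero] at this

omit hz hzA in
lemma tendsto_relaxedMap {f : ℕ → ℝ → RN N → ℝ} (hf : ∀ n, Measurable (Function.uncurry (f n)))
    (hfA : ∀ n t, 0 ≤ t → ∀ x, |f n t x| ≤ evolution α β t 0 (fun y => |a y|) x)
    (hlim : ∀ t, 0 ≤ t → ∀ x, Tendsto (fun n => f n t x) atTop (𝓝 (z t x)))
    (t : ℝ) (x : RN N) :
    Tendsto (fun n => relaxedMap α β p (p * M ^ (p - 1)) k a (f n) t x) atTop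
      (𝓝 (relaxedMap α β p (p * M ^ (p - 1)) k a z t x)) := by
  have hM : 0 ≤ M := (abs_nonneg _).trans (haM 0)
  have hL : 0 ≤ p * M ^ (p - 1) := by positivity
  refine Tendsto.const_mul _ (Tendsto.const_add _ ?_)
  refine tendsto_integral_of_dominated_convergence (fun s => k s *
    (Real.exp (p * M ^ (p - 1) * primitive k t) *
    (p * M ^ (p - 1) * evolution α β t 0 (fun y => |a y|) x)))
    (fun n => (integrableOn_relaxedIntegrand hα0 hα2 hβ hp hk ha haM (hf n)
      (hfA n) t x).aestronglyMeasurable) ((hk.integrableOn_Ioo t).mul_const _)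
    (fun n => ?_) ?_
  · filter_upwards [ae_restrict_mem measurableSet_Ioo] with s hs
    rw [relaxedIntegrand, norm_mul, norm_mul, Real.norm_of_nonneg (hk.nonneg s),
      Real.norm_of_nonneg (Real.exp_nonneg _), Real.norm_eq_abs]
    exact mul_le_mul_of_nonneg_left (mul_le_mul
      (Real.exp_le_exp.2 (mul_le_mul_of_nonneg_left (hk.primitive_mono hs.2.le) hL))
      (abs_propagate_relaxed_le hα0 hα2 hβ hp ha haM (hfA n) hs.1.le hs.2 x) (abs_nonneg _)
      (Real.exp_nonneg _)) (hk.nonneg s)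
  · filter_upwards [ae_restrict_mem measurableSet_Ioo] with s hs
    refine Tendsto.const_mul _ (Tendsto.const_mul _ ?_)
    have hb := fun n y => abs_le_of_le_evolution hα0 hα2 hβ haM hs.1.le (hfA n s hs.1.le) y
    exact tendsto_propagate hα0 hα2 hβ hs.1.le hs.2
      (fun n => (measurable_relaxed p _).comp ((hf n).comp (measurable_const.prodMk measurable_id)))
      (C := p * M ^ (p - 1) * M)
      (fun n y => (abs_relaxed_le hp (hb n y)).trans (mul_le_mul_of_nonneg_left (hb n y) hL))
      (fun y => ((continuous_relaxed hp _).tendsto _).comp (hlim s hs.1.le y)) x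

omit hz hzA in
/-- Monotone iteration yields a solution of the relaxed equation which is dominated by the linear
evolution of `|a|`. -/
theorem exists_relaxedMap_fixedPoint :
    ∃ u : ℝ → RN N → ℝ, Measurable (Function.uncurry u) ∧
      (∀ t, 0 ≤ t → ∀ x, |u t x| ≤ evolution α β t 0 (fun y => |a y|) x) ∧
      (∀ t, 0 ≤ t → ∀ x, u t x = relaxedMap α β p (p * M ^ (p - 1)) k a u t x) ∧
      ((∀ y, 0 ≤ a y) → ∀ t, 0 ≤ t → ∀ x, 0 ≤ u t x) := by
  -- The linear evolution of `|a|` is the upper starting point. Its image lies below it, so order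
  -- preservation makes the iterates decrease, and they stay above `-A`; the pointwise infimum is
  -- therefore their limit.
  set A : ℝ → RN N → ℝ := fun t => evolution α β t 0 (fun y => |a y|) with hA
  set Φ := relaxedMap α β p (p * M ^ (p - 1)) k a with hΦ
  set f : ℕ → ℝ → RN N → ℝ := fun n => Φ^[n] A with hf
  have hf0 : f 0 = A := rfl
  have hfs : ∀ n, f (n + 1) = Φ (f n) := fun n => Function.iterate_succ_apply' Φ n A
  have hAm : Measurable (Function.uncurry A) := measurable_evolution ha.norm
  have hA0 : ∀ t, 0 ≤ t → ∀ x, 0 ≤ A t x := fun t ht x =>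
    (abs_nonneg _).trans (abs_evolution_le_evolution_abs hα0 hα2 hβ ha haM ht x)
  have hfm : ∀ n, Measurable (Function.uncurry (f n)) := by
    intro n
    induction n with
    | zero => exact hAm
    | succ n ih => rw [hfs]; exact measurable_relaxedMap hk ha ih
  have hfA : ∀ n t, 0 ≤ t → ∀ x, |f n t x| ≤ A t x := by
    intro n
    induction n with
    | zero => intro t ht x; rw [hf0, abs_of_nonneg (hA0 t ht x)]
    | succ n ih =>
      intro t ht x
      rw [hfs]
      exact abs_relaxedMap_le hα0 hα2 hβ hp hk ha haM ih ht x
  have hanti : ∀ n t, 0 ≤ t → ∀ x, f (n + 1) t x ≤ f n t x := by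
    intro n
    induction n with
    | zero => intro t ht x; exact (le_abs_self _).trans (hfA 1 t ht x)
    | succ n ih =>
      intro t ht x
      rw [hfs (n + 1), hfs n]
      exact relaxedMap_mono hα0 hα2 hβ hp hk ha haM (hfs n ▸ hfm (n + 1)) (hfs n ▸ hfA (n + 1))
        (hfm n) (hfA n) (hfs n ▸ ih) t x
  have hlim : ∀ t, 0 ≤ t → ∀ x, Tendsto (fun n => f n t x) atTop (𝓝 (⨅ n, f n t x)) := by
    intro t ht x
    refine tendsto_atTop_ciInf (antitone_nat_of_succ_le fun n => hanti n t ht x)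
      ⟨-A t x, ?_⟩
    rintro _ ⟨n, rfl⟩
    exact (abs_le.1 (hfA n t ht x)).1
  refine ⟨fun t x => ⨅ n, f n t x, ?_, ?_, ?_, ?_⟩
  · exact Measurable.iInf hfm
  · exact fun t ht x => le_of_tendsto (hlim t ht x).abs
      (Eventually.of_forall fun n => hfA n t ht x)
  · intro t ht x
    have h1 := tendsto_relaxedMap hα0 hα2 hβ hp hk ha haM hfm hfA hlim t x
    have h2 := (hlim t ht x).comp (tendsto_add_atTop_nat 1)
    refine tendsto_nhds_unique h2 (h1.congr fun n => ?_)
    simp only [Function.comp, hfs]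
    rfl
  · intro ha0 t ht x
    have hfn : ∀ n t, 0 ≤ t → ∀ x, 0 ≤ f n t x := by
      intro n
      induction n with
      | zero => exact hA0
      | succ n ih =>
        intro t ht x
        rw [hfs]
        exact relaxedMap_nonneg hα0 hα2 hβ hp hk haM (hfA n) ha0 ih ht x
    exact ge_of_tendsto' (hlim t ht x) fun n => hfn n t ht x

end

/-! ### From the relaxed equation to Duhamel's formula -/

section

variable {α β p M : ℝ} {k : ℝ → ℝ} {a : RN N → ℝ} (hα0 : 0 < α) (hα2 : α < 2) (hβ : 0 ≤ β)
  (hp : 1 < p) (hk : IsWeight k) (ha : Measurable a) (haM : ∀ y, |a y| ≤ M)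
  {u : ℝ → RN N → ℝ} (hu : Measurable (Function.uncurry u))
  (huA : ∀ t, 0 ≤ t → ∀ x, |u t x| ≤ evolution α β t 0 (fun y => |a y|) x)
  (hfix : ∀ t, 0 ≤ t → ∀ x, u t x = relaxedMap α β p (p * M ^ (p - 1)) k a u t x)

include hα0 hα2 hβ hp hk ha haM hu huA hfix

/-- Applying `S(t,s)` to the fixed point equation at time `s` turns every `S(s,r)` into `S(t,r)`.
The right-hand side then depends on `s` only through the exponential and the upper limit, which is
the form that `setIntegral_exp_neg_mul` integrates. -/
lemma propagate_relaxed_fixedPoint {s t : ℝ} (hs : 0 < s) (hst : s < t) (x : RN N) :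
    propagate α β t s (u s) x = Real.exp (-(p * M ^ (p - 1) * primitive k s)) *
      (evolution α β t 0 a x +
        ∫ r in Ioo 0 s, relaxedIntegrand α β p (p * M ^ (p - 1)) k u t x r) := by
  have hM : 0 ≤ M := (abs_nonneg _).trans (haM 0)
  set L := p * M ^ (p - 1) with hL
  have hL0 : 0 ≤ L := by positivity
  have hKi := integrable_propKernel (N := N) hα0 hα2 hβ hs.le hst
  have hum : ∀ r, Measurable (u r) := fun r => hu.comp (measurable_const.prodMk measurable_id)
  have hub : ∀ r, 0 ≤ r → ∀ y, |u r y| ≤ M := fun r hr y =>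
    abs_le_of_le_evolution hα0 hα2 hβ haM hr (huA r hr) y
  have hwm : ∀ r, Measurable fun y => relaxed p L (u r y) := fun r =>
    (measurable_relaxed p L).comp (hum r)
  have hwb : ∀ r, 0 ≤ r → ∀ y, |relaxed p L (u r y)| ≤ L * M := fun r hr y =>
    (abs_relaxed_le hp (hub r hr y)).trans (mul_le_mul_of_nonneg_left (hub r hr y) hL0)
  set F : RN N → ℝ → ℝ := fun y r =>
    propKernel N α β t s y * relaxedIntegrand α β p L k u s (x - y) r with hF
  have hint : Integrable (Function.uncurry F) (volume.prod (volume.restrict (Ioo 0 s))) := by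
    refine (hKi.mul_prod ((hk.integrableOn_Ioo s).mul_const
      (Real.exp (L * primitive k s) * (L * M)))).mono' ?_ ?_
    · refine AEStronglyMeasurable.mul ?_ ?_
      · exact ((continuous_propKernel hα0 hβ hs.le hst).comp continuous_fst).aestronglyMeasurable
      · exact ((measurable_relaxedIntegrand (α := α) (β := β) (p := p) (L := L) hk hu).comp
          (f := fun z : RN N × ℝ => ((s, x - z.1), z.2)) (by fun_prop)).aestronglyMeasurable
    · have hq : ∀ᵐ z : RN N × ℝ ∂(volume.prod (volume.restrict (Ioo 0 s))), z.2 ∈ Ioo 0 s :=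
        Measure.quasiMeasurePreserving_snd.ae (ae_restrict_mem measurableSet_Ioo)
      filter_upwards [hq] with z hz
      simp only [Function.uncurry, hF, relaxedIntegrand]
      rw [norm_mul, norm_mul, norm_mul,
        Real.norm_of_nonneg (propKernel_nonneg hα0 hα2 hβ hs.le hst z.1),
        Real.norm_of_nonneg (hk.nonneg z.2), Real.norm_of_nonneg (Real.exp_nonneg _)]
      refine mul_le_mul_of_nonneg_left (mul_le_mul_of_nonneg_left ?_ (hk.nonneg _))
        (propKernel_nonneg hα0 hα2 hβ hs.le hst z.1)
      exact mul_le_mul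
        (Real.exp_le_exp.2 (mul_le_mul_of_nonneg_left (hk.primitive_mono hz.2.le) hL0))
        (abs_propagate_le hα0 hα2 hβ hz.1.le hz.2 (ae_of_all _ (hwb _ hz.1.le)) _)
        (norm_nonneg _) (Real.exp_nonneg _)
  have hlin : Integrable fun y => propKernel N α β t s y * evolution α β s 0 a (x - y) :=
    integrable_propKernel_mul hα0 hα2 hβ hs.le hst
      ((measurable_evolution ha).comp
        (f := fun y : RN N => (s, y)) (by fun_prop)).aestronglyMeasurable
      (ae_of_all _ fun y => abs_evolution_le hα0 hα2 hβ haM hs.le y) x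
  have hint2 : Integrable fun y => ∫ r in Ioo 0 s, F y r := hint.integral_prod_left
  calc propagate α β t s (u s) x
      = ∫ y, Real.exp (-(L * primitive k s)) *
          (propKernel N α β t s y * evolution α β s 0 a (x - y) + ∫ r in Ioo 0 s, F y r) := by
        rw [propagate]
        congr 1 with y
        rw [hfix s hs.le, relaxedMap, integral_const_mul]
        ring
    _ = Real.exp (-(L * primitive k s)) *
          (propagate α β t s (evolution α β s 0 a) x + ∫ r in Ioo 0 s, ∫ y, F y r) := by
        rw [integral_const_mul, integral_add hlin hint2, integral_integral_swap hint]
        rfl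
    _ = _ := by
        rw [propagate_evolution hα0 hα2 hβ ha haM hs.le hst]
        congr 2
        refine setIntegral_congr_fun measurableSet_Ioo fun r hr => ?_
        simp only [hF, relaxedIntegrand]
        rw [← propagate_propagate hα0 hα2 hβ hr.1.le hr.2 hst (hwm r) (hwb r hr.1.le) x]
        rw [propagate, ← integral_const_mul, ← integral_const_mul]
        congr 1 with y
        ring

/-- Integrate `k L S(t,s)u(s)` over `(0,t)` using the formula for `S(t,s)u(s)`. The integration by
parts yields `S(t,0)a`, plus the integral of the propagated relaxed term, minus `u(t)`. Since the
nonlinearity is `L u` minus the relaxed term, solving for `u(t)` gives Duhamel's formula. -/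
theorem duhamel_of_relaxed {t : ℝ} (ht : 0 ≤ t) (x : RN N) :
    u t x = evolution α β t 0 a x
      - ∫ s in Ioo 0 t, k s * propagate α β t s (fun y => oddPow p (u s y)) x := by
  have hM : 0 ≤ M := (abs_nonneg _).trans (haM 0)
  set L := p * M ^ (p - 1) with hL
  have hL0 : 0 ≤ L := by positivity
  have hum : ∀ r, Measurable (u r) := fun r => hu.comp (measurable_const.prodMk measurable_id)
  have hub : ∀ r, 0 ≤ r → ∀ y, |u r y| ≤ M := fun r hr y =>
    abs_le_of_le_evolution hα0 hα2 hβ haM hr (huA r hr) y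
  have hwm : Measurable (Function.uncurry fun r y => relaxed p L (u r y)) :=
    (measurable_relaxed p L).comp hu
  have hwb : ∀ r, 0 ≤ r → ∀ y, |relaxed p L (u r y)| ≤ L * M := fun r hr y =>
    (abs_relaxed_le hp (hub r hr y)).trans (mul_le_mul_of_nonneg_left (hub r hr y) hL0)
  have hLub : ∀ r, 0 ≤ r → ∀ y, |L * u r y| ≤ L * M := fun r hr y => by
    rw [abs_mul, abs_of_nonneg hL0]
    exact mul_le_mul_of_nonneg_left (hub r hr y) hL0
  have hi := integrableOn_relaxedIntegrand hα0 hα2 hβ hp hk ha haM hu huA t x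
  have hibp := hk.setIntegral_exp_neg_mul ht L (evolution α β t 0 a x)
    (P := fun s => propagate α β t s (fun y => relaxed p L (u s y)) x) hi
  have hmP : Measurable fun s => propagate α β t s (fun y => relaxed p L (u s y)) x :=
    (measurable_propagate (α := α) (β := β) hwm).comp (f := fun s : ℝ => ((t, s), x)) (by fun_prop)
  have hi1 : IntegrableOn (fun s => k s * propagate α β t s (fun y => relaxed p L (u s y)) x)
      (Ioo 0 t) := hk.integrableOn_mul hmP.aestronglyMeasurable fun s hs =>
        abs_propagate_le hα0 hα2 hβ hs.1.le hs.2 (ae_of_all _ (hwb s hs.1.le)) x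
  have hmL : Measurable fun s => propagate α β t s (fun y => L * u s y) x :=
    (measurable_propagate (α := α) (β := β) (w := fun s y => L * u s y)
      (hu.const_mul L)).comp (f := fun s : ℝ => ((t, s), x)) (by fun_prop)
  have hi2 : IntegrableOn (fun s => k s * propagate α β t s (fun y => L * u s y) x)
      (Ioo 0 t) := hk.integrableOn_mul hmL.aestronglyMeasurable fun s hs =>
        abs_propagate_le hα0 hα2 hβ hs.1.le hs.2 (ae_of_all _ (hLub s hs.1.le)) x
  have e1 : ∫ s in Ioo 0 t, k s * propagate α β t s (fun y => oddPow p (u s y)) x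
      = (∫ s in Ioo 0 t, k s * propagate α β t s (fun y => L * u s y) x)
        - ∫ s in Ioo 0 t, k s * propagate α β t s (fun y => relaxed p L (u s y)) x := by
    rw [← integral_sub hi2 hi1]
    refine setIntegral_congr_fun measurableSet_Ioo fun s hs => ?_
    rw [← mul_sub, ← propagate_sub (v := fun y => L * u s y) (w := fun y => relaxed p L (u s y))
      hα0 hα2 hβ hs.1.le hs.2 ((hum s).const_mul L).aestronglyMeasurable
      ((measurable_relaxed p L).comp (hum s)).aestronglyMeasurable (C := L * M)
      (ae_of_all _ (hLub s hs.1.le)) (ae_of_all _ (hwb s hs.1.le))]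
    simp only [relaxed, sub_sub_cancel]
  have e2 : ∫ s in Ioo 0 t, k s * propagate α β t s (fun y => L * u s y) x
      = ∫ s in Ioo 0 t, k s * (L * (Real.exp (-(L * primitive k s)) * (evolution α β t 0 a x +
        ∫ r in Ioo 0 s, relaxedIntegrand α β p L k u t x r))) := by
    refine setIntegral_congr_fun measurableSet_Ioo fun s hs => ?_
    rw [← propagate_relaxed_fixedPoint hα0 hα2 hβ hp hk ha haM hu huA hfix hs.1 hs.2, propagate,
      propagate, ← integral_const_mul L]
    congr 2 with y
    ring
  rw [e1, e2]
  have h3 := hfix t ht x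
  rw [relaxedMap] at h3
  simp only [relaxedIntegrand] at h3 ⊢
  rw [hibp, ← h3]
  ring

end

/-! ### Uniqueness -/

lemma setIntegral_duhamel {α β p : ℝ} (hβ : 0 ≤ β) {h k : ℝ → ℝ}
    (hhk : ∀ᵐ s, 0 < s → h s = k s) {t : ℝ} (ht : 0 ≤ t) (u : ℝ → RN N → ℝ) (x : RN N) :
    ∫ s in (0 : ℝ)..t, h s * evolution α β t s (fun y => |u s y| ^ (p - 1) * u s y) x
      = ∫ s in Ioo 0 t, k s * propagate α β t s (fun y => oddPow p (u s y)) x := by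
  rw [intervalIntegral.integral_of_le ht, integral_Ioc_eq_integral_Ioo]
  refine setIntegral_congr_ae measurableSet_Ioo ?_
  filter_upwards [hhk] with s hs hst
  rw [hs hst.1, evolution_of_lt hβ hst.1.le hst.2]
  rfl

/-- On a compact interval both solutions take values in some `[-M, M]`, where the nonlinearity is
Lipschitz with constant `L`. Iterating the difference of the Duhamel formulas with weight `exp(2 L
K)`, `K` the primitive of `k`, replaces Grönwall and needs no continuity in time. -/
theorem IsMildSolution.unique {α β p : ℝ} (hα0 : 0 < α) (hα2 : α < 2) (hβ : 0 ≤ β) (hp : 1 < p)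
    {h k : ℝ → ℝ} (hk : IsWeight k) (hhk : ∀ᵐ s, 0 < s → h s = k s) {u₀ : RN N → ℝ} {T : ℝ}
    {u v : ℝ → RN N → ℝ} (hu : IsMildSolution α β p h u₀ (Icc 0 T) u)
    (hv : IsMildSolution α β p h u₀ (Icc 0 T) v) {t : ℝ} (ht : t ∈ Icc 0 T) :
    u t =ᵐ[volume] v t := by
  have hT : (0 : ℝ) ≤ T := ht.1.trans ht.2
  obtain ⟨M₁, hM₁⟩ := hu.bounded T (right_mem_Icc.2 hT)
  obtain ⟨M₂, hM₂⟩ := hv.bounded T (right_mem_Icc.2 hT)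
  set M := max M₁ M₂
  have huM : ∀ t ∈ Icc 0 T, ∀ᵐ x, |u t x| ≤ M := fun t ht => by
    filter_upwards [hM₁ t ht] with x hx using hx.trans (le_max_left _ _)
  have hvM : ∀ t ∈ Icc 0 T, ∀ᵐ x, |v t x| ≤ M := fun t ht => by
    filter_upwards [hM₂ t ht] with x hx using hx.trans (le_max_right _ _)
  have hM : 0 ≤ M := by
    obtain ⟨x, hx⟩ := (huM t ht).exists
    exact (abs_nonneg _).trans hx
  set L := p * M ^ (p - 1) with hL
  have hL0 : 0 ≤ L := by positivity
  have hbound : ∀ {w : ℝ → RN N → ℝ}, (∀ t ∈ Icc 0 T, ∀ᵐ x, |w t x| ≤ M) →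
      ∀ s ∈ Icc 0 T, ∀ᵐ y, |oddPow p (w s y)| ≤ M ^ (p - 1) * M := fun {w} hw s hs => by
    filter_upwards [hw s hs] with y hy
    exact (abs_oddPow_le hp hy).trans (mul_le_mul_of_nonneg_left hy (by positivity))
  have hmeas : ∀ {w : ℝ → RN N → ℝ}, IsMildSolution α β p h u₀ (Icc 0 T) w → ∀ t ∈ Icc 0 T,
      AEStronglyMeasurable (Function.uncurry fun s y => oddPow p (w s y))
        ((volume.restrict (Ioo 0 t)).prod volume) := fun {w} hw t ht => by
    have hac : (volume.restrict (Ioo 0 t)).prod (volume : Measure (RN N)) ≪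
        (volume.restrict (Icc 0 T)).prod volume :=
      (Measure.restrict_mono (Ioo_subset_Icc_self.trans (Icc_subset_Icc_right ht.2))
        le_rfl).absolutelyContinuous.prod Measure.AbsolutelyContinuous.rfl
    exact (continuous_oddPow hp).comp_aestronglyMeasurable (hw.aestronglyMeasurable.mono_ac hac)
  have hint : ∀ {w : ℝ → RN N → ℝ}, IsMildSolution α β p h u₀ (Icc 0 T) w →
      (∀ t ∈ Icc 0 T, ∀ᵐ x, |w t x| ≤ M) → ∀ t ∈ Icc 0 T, ∀ x,
      IntegrableOn (fun s => k s * propagate α β t s (fun y => oddPow p (w s y)) x) (Ioo 0 t) :=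
    fun {w} hw hwM t ht x => hk.integrableOn_mul (aestronglyMeasurable_propagate (hmeas hw t ht) x)
      fun s hs => abs_propagate_le hα0 hα2 hβ hs.1.le hs.2
        (hbound hwM s ⟨hs.1.le, hs.2.le.trans ht.2⟩) x
  -- The exponent `2 L` is twice the Lipschitz constant, so integrating `k L exp(2 L K)` returns at
  -- most half the weight. The exceptional null set depends on `t` and `n`, and at fixed `t` only
  -- countably many are discarded.
  have key : ∀ n : ℕ, ∀ t ∈ Icc 0 T, ∀ᵐ x,
      |u t x - v t x| ≤ 2 * M * (1 / 2) ^ n * Real.exp (2 * L * primitive k t) := by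
    intro n
    induction n with
    | zero =>
      intro t ht
      filter_upwards [huM t ht, hvM t ht] with x hx hy
      have h1 : (1 : ℝ) ≤ Real.exp (2 * L * primitive k t) :=
        Real.one_le_exp (mul_nonneg (by positivity) (hk.primitive_nonneg ht.1))
      calc |u t x - v t x| ≤ |u t x| + |v t x| := abs_sub _ _
        _ ≤ 2 * M * (1 / 2) ^ 0 * 1 := by linarith
        _ ≤ _ := mul_le_mul_of_nonneg_left h1 (by positivity)
    | succ n ih =>
      intro t ht
      set c := 2 * M * (1 / 2) ^ n with hc
      have hc0 : 0 ≤ c := by positivity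
      filter_upwards [hu.duhamel t ht, hv.duhamel t ht] with x hx hy
      rw [setIntegral_duhamel hβ hhk ht.1] at hx hy
      have e : u t x - v t x = -∫ s in Ioo 0 t,
          (k s * propagate α β t s (fun y => oddPow p (u s y)) x
            - k s * propagate α β t s (fun y => oddPow p (v s y)) x) := by
        rw [integral_sub (hint hu huM t ht x) (hint hv hvM t ht x), hx, hy]
        ring
      have hgi : IntegrableOn
          (fun s => k s * (2 * L * Real.exp (2 * L * primitive k s))) (Ioo 0 t) := by
        refine hk.integrableOn_mul (C := 2 * L * Real.exp (2 * L * primitive k t)) ?_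
          fun s hs => ?_
        · have := hk.continuous_primitive
          exact Continuous.aestronglyMeasurable (by fun_prop)
        · rw [abs_of_nonneg (by positivity)]
          exact mul_le_mul_of_nonneg_left (Real.exp_le_exp.2
            (mul_le_mul_of_nonneg_left (hk.primitive_mono hs.2.le) (by positivity))) (by positivity)
      rw [e, abs_neg, ← Real.norm_eq_abs]
      have hle := norm_integral_le_of_norm_le (hgi.const_mul (c / 2)) (f := fun s =>
          k s * propagate α β t s (fun y => oddPow p (u s y)) x
            - k s * propagate α β t s (fun y => oddPow p (v s y)) x) ?_
      · refine hle.trans ?_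
        rw [integral_const_mul, hk.setIntegral_mul_exp ht.1, pow_succ]
        have : 0 ≤ c / 2 := by positivity
        have e2 : 2 * M * ((1 / 2) ^ n * (1 / 2)) = c / 2 := by rw [hc]; ring
        rw [e2]
        exact mul_le_mul_of_nonneg_left (by linarith) this
      · filter_upwards [ae_restrict_mem measurableSet_Ioo] with s hs
        have hsT : s ∈ Icc 0 T := ⟨hs.1.le, hs.2.le.trans ht.2⟩
        have hsm : ∀ {w : ℝ → RN N → ℝ}, IsMildSolution α β p h u₀ (Icc 0 T) w →
            AEStronglyMeasurable (fun y => oddPow p (w s y)) volume := fun {w} hw =>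
          (continuous_oddPow hp).comp_aestronglyMeasurable (hw.memLp s hsT).aestronglyMeasurable
        rw [← mul_sub, ← propagate_sub hα0 hα2 hβ hs.1.le hs.2 (hsm hu) (hsm hv)
          (hbound huM s hsT) (hbound hvM s hsT), norm_mul, Real.norm_of_nonneg (hk.nonneg s),
          Real.norm_eq_abs]
        have hp1 := abs_propagate_le (N := N) (v := fun y => oddPow p (u s y) - oddPow p (v s y))
          (C := L * (c * Real.exp (2 * L * primitive k s))) hα0 hα2 hβ hs.1.le hs.2 (by
            filter_upwards [ih s hsT, huM s hsT, hvM s hsT] with y h1 h2 h3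
            exact (abs_oddPow_sub_le hp h2 h3).trans (mul_le_mul_of_nonneg_left h1 hL0)) x
        refine (mul_le_mul_of_nonneg_left hp1 (hk.nonneg s)).trans (le_of_eq ?_)
        ring
  have hall := ae_all_iff.2 fun n => key n t ht
  filter_upwards [hall] with x hx
  have hlim : Tendsto (fun n : ℕ => 2 * M * (1 / 2) ^ n * Real.exp (2 * L * primitive k t)) atTop
      (𝓝 (2 * M * 0 * Real.exp (2 * L * primitive k t))) :=
    ((tendsto_pow_atTop_nhds_zero_of_lt_one (by norm_num) (by norm_num)).const_mul _).mul_const _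
  rw [mul_zero, zero_mul] at hlim
  have h0 : |u t x - v t x| ≤ 0 := ge_of_tendsto' hlim hx
  exact sub_eq_zero.1 (abs_nonpos_iff.1 h0)

/-! ### Continuity in time -/

lemma eLpNorm_comp_sub_right {v : RN N → ℝ} (hv : AEStronglyMeasurable v volume) (r : ℝ≥0∞)
    (y : RN N) : eLpNorm (fun x => v (x - y)) r volume = eLpNorm v r volume :=
  eLpNorm_comp_measurePreserving hv (measurePreserving_sub_right volume y)

section

variable {α β : ℝ} (hα0 : 0 < α) (hα2 : α < 2) (hβ : 0 ≤ β)

include hα0 hα2 hβ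

lemma eLpNorm_propagate_le {s t : ℝ} (hs : 0 ≤ s) (hst : s < t) {r : ℝ≥0∞} (hr : 1 ≤ r)
    {v : RN N → ℝ} (hv : Measurable v) :
    eLpNorm (propagate α β t s v) r volume ≤ eLpNorm v r volume := by
  have hφ : Measurable (Function.uncurry fun (y x : RN N) => v (x - y)) :=
    hv.comp (f := fun q : RN N × RN N => q.2 - q.1) (by fun_prop)
  have h := eLpNorm_integral_mul_le (μ := volume) hr
    (continuous_propKernel (N := N) hα0 hβ hs hst).measurable
    (integrable_propKernel hα0 hα2 hβ hs hst) hφ (C := eLpNorm v r volume)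
    (ae_of_all _ fun y => (eLpNorm_comp_sub_right hv.aestronglyMeasurable r y).le)
  have e : ∫ y : RN N, |propKernel N α β t s y| = 1 := by
    rw [← integral_propKernel (N := N) hα0 hα2 hβ hs hst]
    congr 1 with y
    exact abs_of_nonneg (propKernel_nonneg hα0 hα2 hβ hs hst y)
  rwa [e, ENNReal.ofReal_one, one_mul] at h

lemma eLpNorm_evolution_le {t : ℝ} (ht : 0 ≤ t) {r : ℝ≥0∞} (hr : 1 ≤ r)
    {v : RN N → ℝ} (hv : Measurable v) :
    eLpNorm (evolution α β t 0 v) r volume ≤ eLpNorm v r volume := by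
  rcases ht.eq_or_lt with rfl | ht
  · rw [evolution_self]
  · rw [evolution_of_lt hβ le_rfl ht]
    exact eLpNorm_propagate_le hα0 hα2 hβ le_rfl ht hr hv

lemma tendsto_integral_abs_propKernel_sub {s t : ℝ} (hs : 0 ≤ s) (hst : s < t) :
    Tendsto (fun t' => ∫ y : RN N, |propKernel N α β t' s y - propKernel N α β t s y|)
      (𝓝 t) (𝓝 0) := by
  have hc : Tendsto (fun t' : ℝ => t' ^ (β + 1) / (β + 1) - s ^ (β + 1) / (β + 1)) (𝓝 t)
      (𝓝 (t ^ (β + 1) / (β + 1) - s ^ (β + 1) / (β + 1))) := by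
    have : Continuous fun t' : ℝ => t' ^ (β + 1) / (β + 1) - s ^ (β + 1) / (β + 1) :=
      ((Real.continuous_rpow_const (by linarith)).div_const _).sub continuous_const
    exact this.tendsto t
  exact (tendsto_integral_abs_mixedKernel_sub hα0 hα2 (clock_sub_pos hβ hs hst)).comp hc

/-- Continuity of the linear evolution at positive times. -/
lemma tendsto_eLpNorm_evolution_sub {t : ℝ} (ht : 0 < t) {r : ℝ≥0∞} (hr : 1 ≤ r)
    {v : RN N → ℝ} (hv : Measurable v) {M : ℝ} (hM : ∀ y, |v y| ≤ M)
    (hvr : eLpNorm v r volume ≠ ∞) :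
    Tendsto (fun t' => eLpNorm (evolution α β t' 0 v - evolution α β t 0 v) r volume)
      (𝓝 t) (𝓝 0) := by
  have hφ : Measurable (Function.uncurry fun (y x : RN N) => v (x - y)) :=
    hv.comp (f := fun q : RN N × RN N => q.2 - q.1) (by fun_prop)
  have h1 := ENNReal.Tendsto.mul_const (b := eLpNorm v r volume)
    (ENNReal.tendsto_ofReal (tendsto_integral_abs_propKernel_sub (N := N) hα0 hα2 hβ le_rfl ht))
    (Or.inr hvr)
  rw [ENNReal.ofReal_zero, zero_mul] at h1
  refine tendsto_of_tendsto_of_tendsto_of_le_of_le' tendsto_const_nhds h1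
    (Eventually.of_forall fun _ => zero_le) ?_
  filter_upwards [lt_mem_nhds ht] with t' ht'
  have h := eLpNorm_integral_mul_le (μ := volume) (ν := volume) hr
    (k := fun y : RN N => propKernel N α β t' 0 y - propKernel N α β t 0 y)
    ((continuous_propKernel hα0 hβ le_rfl ht').sub
      (continuous_propKernel hα0 hβ le_rfl ht)).measurable
    ((integrable_propKernel hα0 hα2 hβ le_rfl ht').sub
      (integrable_propKernel hα0 hα2 hβ le_rfl ht)) hφ (C := eLpNorm v r volume)
    (ae_of_all _ fun y => (eLpNorm_comp_sub_right hv.aestronglyMeasurable r y).le)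
  refine le_of_eq_of_le ?_ h
  congr 1
  funext x
  rw [Pi.sub_apply, evolution_of_lt hβ le_rfl ht', evolution_of_lt hβ le_rfl ht, propagate,
    propagate, ← integral_sub
    (integrable_propKernel_mul hα0 hα2 hβ le_rfl ht' hv.aestronglyMeasurable (ae_of_all _ hM) x)
    (integrable_propKernel_mul hα0 hα2 hβ le_rfl ht hv.aestronglyMeasurable (ae_of_all _ hM) x)]
  simp only [sub_mul]

lemma tendsto_integral_propKernel_mul :
    Tendsto (fun t => ∫ y : RN N, propKernel N α β t 0 y * (1 - Real.exp (-1 * ‖y‖ ^ 2)))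
      (𝓝[>] 0) (𝓝 0) := by
  refine (tendsto_integral_mixedKernel_mul (N := N) hα0 hα2).comp
    (f := fun t : ℝ => t ^ (β + 1) / (β + 1) - (0 : ℝ) ^ (β + 1) / (β + 1))
    (tendsto_nhdsWithin_of_tendsto_nhds_of_eventually_within _ ?_ ?_)
  · have hc : Continuous fun t : ℝ => t ^ (β + 1) / (β + 1) - (0 : ℝ) ^ (β + 1) / (β + 1) :=
      ((Real.continuous_rpow_const (by linarith)).div_const _).sub continuous_const
    have := hc.tendsto 0
    rw [sub_self] at this
    exact this.mono_left nhdsWithin_le_nhds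
  · filter_upwards [self_mem_nhdsWithin] with t ht
    exact clock_sub_pos hβ le_rfl ht

/-- Continuity of the linear evolution at time `0`, for data on which translations act
continuously. -/
lemma tendsto_eLpNorm_evolution_sub_zero {r : ℝ≥0∞} (hr : 1 ≤ r)
    {v : RN N → ℝ} (hv : Measurable v) {M : ℝ} (hM : ∀ y, |v y| ≤ M)
    (hvr : eLpNorm v r volume ≠ ∞)
    (htr : Tendsto (fun y : RN N => eLpNorm (fun x => v (x - y) - v x) r volume) (𝓝 0) (𝓝 0)) :
    Tendsto (fun t => eLpNorm (evolution α β t 0 v - v) r volume) (𝓝[>] 0) (𝓝 0) := by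
  rw [ENNReal.tendsto_nhds_zero]
  intro ε' hε'
  obtain ⟨ε, hε, hεε⟩ : ∃ ε : ℝ, 0 < ε ∧ ENNReal.ofReal (2 * ε) ≤ ε' := by
    rcases eq_or_ne ε' ∞ with rfl | hne
    · exact ⟨1, one_pos, le_top⟩
    · refine ⟨ε'.toReal / 2, by have := ENNReal.toReal_pos hε'.ne' hne; positivity, ?_⟩
      rw [mul_div_cancel₀ _ (two_ne_zero), ENNReal.ofReal_toReal hne]
  obtain ⟨δ, hδ, hball⟩ := Metric.eventually_nhds_iff.1
    (ENNReal.tendsto_nhds_zero.1 htr (ENNReal.ofReal ε) (ENNReal.ofReal_pos.2 hε))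
  have hq : 0 < 1 - Real.exp (-1 * δ ^ 2) := by
    have : Real.exp (-1 * δ ^ 2) < 1 := Real.exp_lt_one_iff.2 (by nlinarith)
    linarith
  -- Chosen so that for `‖y‖ ≥ δ` the second term of `W` already exceeds the trivial bound `2 ‖v‖_r`
  -- on the modulus of translation.
  set D := 2 * (eLpNorm v r volume).toReal / (1 - Real.exp (-1 * δ ^ 2)) with hD
  have hD0 : 0 ≤ D := by positivity
  have hg0 : ∀ y : RN N, 0 ≤ 1 - Real.exp (-1 * ‖y‖ ^ 2) := fun y => by
    have : Real.exp (-1 * ‖y‖ ^ 2) ≤ 1 := Real.exp_le_one_iff.2 (by nlinarith [sq_nonneg ‖y‖])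
    linarith
  set W : RN N → ℝ := fun y => ε + D * (1 - Real.exp (-1 * ‖y‖ ^ 2)) with hW
  have hW0 : ∀ y, 0 < W y := fun y => add_pos_of_pos_of_nonneg hε (mul_nonneg hD0 (hg0 y))
  have hWc : Continuous W := by fun_prop
  have hmod : ∀ y : RN N, eLpNorm (fun x => v (x - y) - v x) r volume ≤ ENNReal.ofReal (W y) := by
    intro y
    rcases lt_or_ge ‖y‖ δ with hy | hy
    · refine (hball (by simpa using hy)).trans (ENNReal.ofReal_le_ofReal ?_)
      exact le_add_of_nonneg_right (mul_nonneg hD0 (hg0 y))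
    · have h1 := eLpNorm_sub_le (μ := volume) (p := r) (f := fun x => v (x - y)) (g := v)
        (hv.comp (f := fun x : RN N => x - y) (by fun_prop)).aestronglyMeasurable
        hv.aestronglyMeasurable hr
      rw [eLpNorm_comp_sub_right hv.aestronglyMeasurable, ← two_mul] at h1
      refine h1.trans ?_
      have e2 : ∀ c : ℝ, 2 * ENNReal.ofReal c = ENNReal.ofReal (2 * c) := fun c => by
        rw [ENNReal.ofReal_mul zero_le_two, ENNReal.ofReal_ofNat]
      rw [← ENNReal.ofReal_toReal hvr, e2]
      refine ENNReal.ofReal_le_ofReal ?_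
      have h2 : Real.exp (-1 * ‖y‖ ^ 2) ≤ Real.exp (-1 * δ ^ 2) :=
        Real.exp_le_exp.2 (by nlinarith)
      calc 2 * (eLpNorm v r volume).toReal = D * (1 - Real.exp (-1 * δ ^ 2)) := by
            rw [hD, div_mul_cancel₀ _ hq.ne']
        _ ≤ D * (1 - Real.exp (-1 * ‖y‖ ^ 2)) :=
            mul_le_mul_of_nonneg_left (by linarith) hD0
        _ ≤ W y := le_add_of_nonneg_left hε.le
  have hsmall := (tendsto_integral_propKernel_mul (N := N) hα0 hα2 hβ).const_mul D
  rw [mul_zero] at hsmall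
  filter_upwards [hsmall.eventually_lt_const hε, self_mem_nhdsWithin] with t hlt ht
  have ht0 : (0 : ℝ) < t := ht
  have hK := integrable_propKernel (N := N) hα0 hα2 hβ le_rfl ht0
  have hKg : Integrable fun y : RN N => propKernel N α β t 0 y * (1 - Real.exp (-1 * ‖y‖ ^ 2)) :=
    hK.mul_bdd (c := 1) (Continuous.aestronglyMeasurable (by fun_prop)) (ae_of_all _ fun y => by
      rw [Real.norm_of_nonneg (hg0 y)]
      have := Real.exp_pos (-1 * ‖y‖ ^ 2)
      linarith)
  have hKW : ∀ y, propKernel N α β t 0 y * W y = ε * propKernel N α β t 0 y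
      + D * (propKernel N α β t 0 y * (1 - Real.exp (-1 * ‖y‖ ^ 2))) := fun y => by
    simp only [hW]; ring
  -- Dividing by `W`, which is positive thanks to `ε`, normalizes the translation differences to
  -- norm at most one. Minkowski with weight `propKernel * W` then bounds the norm by `ε` plus `D`
  -- times the escaping mass, hence by `2 ε`.
  have hφ : Measurable (Function.uncurry fun (y x : RN N) => (W y)⁻¹ * (v (x - y) - v x)) := by
    have hm : Measurable W := hWc.measurable
    exact (hm.comp measurable_fst).inv.mul ((hv.comp (f := fun q : RN N × RN N => q.2 - q.1)
      (by fun_prop)).sub (hv.comp measurable_snd))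
  have h := eLpNorm_integral_mul_le (μ := volume) (ν := volume) hr
    (k := fun y : RN N => propKernel N α β t 0 y * W y)
    ((continuous_propKernel hα0 hβ le_rfl ht0).mul hWc).measurable
    (by simp only [hKW]; exact (hK.const_mul ε).add (hKg.const_mul D)) hφ (C := 1)
    (ae_of_all _ fun y => by
      have e : (fun x => (W y)⁻¹ * (v (x - y) - v x)) = (W y)⁻¹ • fun x => v (x - y) - v x := rfl
      rw [e, eLpNorm_const_smul, Real.enorm_of_nonneg (inv_nonneg.2 (hW0 y).le)]
      refine (mul_le_mul' le_rfl (hmod y)).trans (le_of_eq ?_)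
      rw [← ENNReal.ofReal_mul (inv_nonneg.2 (hW0 y).le), inv_mul_cancel₀ (hW0 y).ne',
        ENNReal.ofReal_one])
  rw [mul_one] at h
  have e1 : (fun x => ∫ y, propKernel N α β t 0 y * W y * ((W y)⁻¹ * (v (x - y) - v x)))
      = evolution α β t 0 v - v := by
    funext x
    rw [Pi.sub_apply, evolution_of_lt hβ le_rfl ht0, propagate]
    have e2 : ∀ y, propKernel N α β t 0 y * W y * ((W y)⁻¹ * (v (x - y) - v x))
        = propKernel N α β t 0 y * v (x - y) - propKernel N α β t 0 y * v x := fun y => by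
      have := (hW0 y).ne'
      field_simp
    simp_rw [e2]
    rw [integral_sub (integrable_propKernel_mul hα0 hα2 hβ le_rfl ht0 hv.aestronglyMeasurable
      (ae_of_all _ hM) x) (hK.mul_const _), integral_mul_const,
      integral_propKernel hα0 hα2 hβ le_rfl ht0, one_mul]
  rw [e1] at h
  refine h.trans (le_trans (ENNReal.ofReal_le_ofReal ?_) hεε)
  have e3 : ∀ y, |propKernel N α β t 0 y * W y| = ε * propKernel N α β t 0 y
      + D * (propKernel N α β t 0 y * (1 - Real.exp (-1 * ‖y‖ ^ 2))) := fun y => by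
    rw [abs_of_nonneg (mul_nonneg (propKernel_nonneg hα0 hα2 hβ le_rfl ht0 y) (hW0 y).le), hKW]
  simp_rw [e3]
  rw [integral_add (hK.const_mul ε) (hKg.const_mul D), integral_const_mul, integral_const_mul,
    integral_propKernel hα0 hα2 hβ le_rfl ht0]
  linarith

end

/-- Translations form a continuous family of measure-preserving maps, and composition with such a
family is continuous in `L^r` for finite `r`. -/
lemma tendsto_eLpNorm_translation {r : ℝ≥0∞} (hr : 1 ≤ r) (hr' : r ≠ ∞) {v : RN N → ℝ}
    (hv : MemLp v r volume) :
    Tendsto (fun y : RN N => eLpNorm (fun x => v (x - y) - v x) r volume) (𝓝 0) (𝓝 0) := by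
  have : Fact (1 ≤ r) := ⟨hr⟩
  let g : C(RN N, C(RN N, RN N)) :=
    (ContinuousMap.mk (fun q : RN N × RN N => q.2 - q.1) (by fun_prop)).curry
  have hgm : ∀ y, MeasurePreserving (g y) (volume : Measure (RN N)) volume := fun y =>
    measurePreserving_sub_right volume y
  have hcont : Continuous fun y => Lp.compMeasurePreserving (g y) (hgm y) (hv.toLp v) :=
    continuous_const.compMeasurePreservingLp g.continuous hgm hr'
  have hlim := (tendsto_iff_edist_tendsto_0.1 (hcont.tendsto 0))
  refine hlim.congr fun y => ?_
  rw [Lp.toLp_compMeasurePreserving, Lp.toLp_compMeasurePreserving, Lp.edist_toLp_toLp]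
  congr 1
  funext x
  simp [g]

lemma tendsto_eLpNorm_translation_of_uniformContinuous {v g : RN N → ℝ}
    (hg : UniformContinuous g) (hvg : v =ᵐ[volume] g) :
    Tendsto (fun y : RN N => eLpNorm (fun x => v (x - y) - v x) ∞ volume) (𝓝 0) (𝓝 0) := by
  have hle : ∀ ε : ℝ, 0 < ε → ∀ᶠ y : RN N in 𝓝 0,
      eLpNorm (fun x => v (x - y) - v x) ∞ volume ≤ ENNReal.ofReal ε := by
    intro ε hε
    obtain ⟨δ, hδ, h⟩ := Metric.uniformContinuous_iff.1 hg ε hε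
    filter_upwards [Metric.ball_mem_nhds (0 : RN N) hδ] with y hy
    rw [eLpNorm_exponent_top]
    refine eLpNormEssSup_le_of_ae_bound ?_
    filter_upwards [hvg, (measurePreserving_sub_right volume y).quasiMeasurePreserving.ae hvg]
      with x h1 h2
    rw [h1, h2, ← dist_eq_norm]
    refine (h ?_).le
    rw [dist_eq_norm]
    simpa using hy
  rw [ENNReal.tendsto_nhds_zero]
  intro ε hε
  rcases eq_or_ne ε ∞ with rfl | hne
  · exact Eventually.of_forall fun _ => le_top
  · filter_upwards [hle ε.toReal (ENNReal.toReal_pos hε.ne' hne)] with y hy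
    rwa [ENNReal.ofReal_toReal hne] at hy

/-! ### Continuity of the Duhamel term -/

/-- The Duhamel term `∫₀ᵗ k(s) S(t,s) φ(s) ds`. -/
def duhamelTerm (α β : ℝ) (k : ℝ → ℝ) (φ : ℝ → RN N → ℝ) (t : ℝ) (x : RN N) : ℝ :=
  ∫ s in Ioo 0 t, k s * propagate α β t s (φ s) x

lemma measurable_duhamelTerm {α β : ℝ} {k : ℝ → ℝ} (hk : IsWeight k) {φ : ℝ → RN N → ℝ}
    (hφ : Measurable (Function.uncurry φ)) (t : ℝ) : Measurable (duhamelTerm α β k φ t) := by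
  have h1 := (measurable_propagate (α := α) (β := β) hφ).comp
    (f := fun q : RN N × ℝ => ((t, q.2), q.1)) (by fun_prop)
  have h2 : StronglyMeasurable (Function.uncurry fun (x : RN N) (s : ℝ) =>
      k s * propagate α β t s (φ s) x) :=
    ((hk.measurable.comp measurable_snd).mul h1).stronglyMeasurable
  exact (StronglyMeasurable.integral_prod_right (ν := volume.restrict (Ioo 0 t)) h2).measurable

/-- The space-time kernel of the Duhamel term. -/
def duhamelKernel (N : ℕ) (α β : ℝ) (k : ℝ → ℝ) (t : ℝ) (q : ℝ × RN N) : ℝ :=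
  if q.1 < t then k q.1 * propKernel N α β t q.1 q.2 else 0

section

variable {α β : ℝ} {k : ℝ → ℝ} (hα0 : 0 < α) (hα2 : α < 2) (hβ : 0 ≤ β) (hk : IsWeight k)

include hk in
lemma measurable_duhamelKernel (t : ℝ) : Measurable (duhamelKernel N α β k t) :=
  Measurable.ite (measurableSet_lt measurable_fst measurable_const)
    ((hk.measurable.comp measurable_fst).mul ((measurable_propKernel N α β).comp
      (f := fun q : ℝ × RN N => ((t, q.1), q.2)) (by fun_prop))) measurable_const

include hα0 hα2 hβ hk

lemma integral_abs_duhamelKernel_le {s : ℝ} (hs : 0 ≤ s) (t : ℝ) :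
    Integrable (fun y : RN N => duhamelKernel N α β k t (s, y)) ∧
      ∫ y : RN N, |duhamelKernel N α β k t (s, y)| ≤ k s := by
  by_cases hst : s < t
  · simp only [duhamelKernel, hst, if_true]
    refine ⟨(integrable_propKernel hα0 hα2 hβ hs hst).const_mul _, ?_⟩
    have e : ∀ y : RN N, |k s * propKernel N α β t s y| = k s * propKernel N α β t s y :=
      fun y => abs_of_nonneg (mul_nonneg (hk.nonneg s) (propKernel_nonneg hα0 hα2 hβ hs hst y))
    simp_rw [e]
    rw [integral_const_mul, integral_propKernel hα0 hα2 hβ hs hst, mul_one]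
  · simp only [duhamelKernel, hst, if_false]
    simpa using hk.nonneg s

lemma integrable_duhamelKernel (R t : ℝ) :
    Integrable (duhamelKernel N α β k t) ((volume.restrict (Ioo 0 R)).prod volume) := by
  have hm := (measurable_duhamelKernel (N := N) (α := α) (β := β) hk t)
  rw [integrable_prod_iff hm.aestronglyMeasurable]
  constructor
  · filter_upwards [ae_restrict_mem measurableSet_Ioo] with s hs
    exact (integral_abs_duhamelKernel_le hα0 hα2 hβ hk hs.1.le t).1
  · refine (hk.integrableOn_Ioo R).mono'
      hm.aestronglyMeasurable.norm.integral_prod_right' ?_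
    filter_upwards [ae_restrict_mem measurableSet_Ioo] with s hs
    rw [Real.norm_of_nonneg (integral_nonneg fun y => norm_nonneg _)]
    exact (integral_abs_duhamelKernel_le hα0 hα2 hβ hk hs.1.le t).2

/-- Dominated convergence in `s` with majorant `2 k(s)`. For `s < t` the inner integral tends to
zero by `L¹` continuity of the kernel; for `s > t` both kernels vanish once `t'` is close to `t`;
the singular time `s = t` is a null set. -/
lemma tendsto_integral_abs_duhamelKernel_sub {R t : ℝ} :
    Tendsto (fun t' => ∫ q, |duhamelKernel N α β k t' q - duhamelKernel N α β k t q|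
      ∂((volume.restrict (Ioo 0 R)).prod volume)) (𝓝 t) (𝓝 0) := by
  have hi : ∀ t', Integrable (fun q => |duhamelKernel N α β k t' q - duhamelKernel N α β k t q|)
      ((volume.restrict (Ioo 0 R)).prod volume) := fun t' =>
    ((integrable_duhamelKernel hα0 hα2 hβ hk R t').sub
      (integrable_duhamelKernel hα0 hα2 hβ hk R t)).abs
  simp_rw [fun t' => integral_prod _ (hi t')]
  suffices h : Tendsto (fun t' => ∫ s in Ioo 0 R,
      ∫ y : RN N, |duhamelKernel N α β k t' (s, y) - duhamelKernel N α β k t (s, y)|)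
      (𝓝 t) (𝓝 (∫ _ in Ioo 0 R, (0 : ℝ))) by simpa using h
  refine tendsto_integral_filter_of_dominated_convergence (fun s => 2 * k s)
    (Eventually.of_forall fun t' => (hi t').integral_prod_left.aestronglyMeasurable)
    (Eventually.of_forall fun t' => ?_) ((hk.integrableOn_Ioo R).const_mul 2) ?_
  · filter_upwards [ae_restrict_mem measurableSet_Ioo] with s hs
    obtain ⟨h1, h2⟩ := integral_abs_duhamelKernel_le (N := N) hα0 hα2 hβ hk hs.1.le t'
    obtain ⟨h3, h4⟩ := integral_abs_duhamelKernel_le (N := N) hα0 hα2 hβ hk hs.1.le t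
    rw [Real.norm_of_nonneg (integral_nonneg fun y => abs_nonneg _)]
    calc _ ≤ ∫ y, (|duhamelKernel N α β k t' (s, y)| + |duhamelKernel N α β k t (s, y)|) :=
          integral_mono (h1.sub h3).abs (h1.abs.add h3.abs) fun y => abs_sub _ _
      _ ≤ 2 * k s := by rw [integral_add h1.abs h3.abs]; linarith
  · have hne : ∀ᵐ s ∂(volume.restrict (Ioo 0 R)), s ≠ t :=
      ae_restrict_of_ae (Measure.ae_ne volume t)
    filter_upwards [ae_restrict_mem measurableSet_Ioo, hne] with s hs hst
    rcases lt_or_gt_of_ne hst with hst | hst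
    · have h := (tendsto_integral_abs_propKernel_sub (N := N) hα0 hα2 hβ hs.1.le hst).const_mul
        (k s)
      rw [mul_zero] at h
      refine h.congr' ?_
      filter_upwards [lt_mem_nhds hst] with t' ht'
      simp only [duhamelKernel, hst, ht', if_true]
      rw [← integral_const_mul]
      congr 1 with y
      rw [← mul_sub, abs_mul, abs_of_nonneg (hk.nonneg s)]
    · refine tendsto_const_nhds.congr' ?_
      filter_upwards [gt_mem_nhds hst] with t' ht'
      simp [duhamelKernel, not_lt.2 hst.le, not_lt.2 (le_of_lt ht')]

variable {φ : ℝ → RN N → ℝ} (hφ : Measurable (Function.uncurry φ)) {B : ℝ}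
  (hB : ∀ s, 0 ≤ s → ∀ y, |φ s y| ≤ B)

include hφ hB

lemma integrable_duhamelKernel_mul (R t : ℝ) (x : RN N) :
    Integrable (fun q : ℝ × RN N => duhamelKernel N α β k t q * φ q.1 (x - q.2))
      ((volume.restrict (Ioo 0 R)).prod volume) := by
  refine (integrable_duhamelKernel hα0 hα2 hβ hk R t).mul_bdd (c := B)
    (hφ.comp (f := fun q : ℝ × RN N => (q.1, x - q.2)) (by fun_prop)).aestronglyMeasurable ?_
  have hq : ∀ᵐ q : ℝ × RN N ∂((volume.restrict (Ioo 0 R)).prod volume), q.1 ∈ Ioo 0 R :=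
    Measure.quasiMeasurePreserving_fst.ae (ae_restrict_mem measurableSet_Ioo)
  filter_upwards [hq] with q hq using hB _ hq.1.le _

/-- Moving the limit `s < t` into the kernel puts the Duhamel terms of all times up to `R` on one
measure space, so that their difference is a single weighted average of translates. -/
lemma duhamelTerm_eq {R t : ℝ} (htR : t ≤ R) (x : RN N) :
    duhamelTerm α β k φ t x = ∫ q, duhamelKernel N α β k t q * φ q.1 (x - q.2)
      ∂((volume.restrict (Ioo 0 R)).prod volume) := by
  rw [integral_prod _ (integrable_duhamelKernel_mul hα0 hα2 hβ hk hφ hB R t x)]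
  have e : ∀ s, ∫ y, duhamelKernel N α β k t (s, y) * φ s (x - y)
      = (Iio t).indicator (fun s => k s * propagate α β t s (φ s) x) s := by
    intro s
    by_cases hst : s < t
    · simp only [duhamelKernel, hst, if_true, indicator_of_mem (mem_Iio.2 hst), propagate]
      rw [← integral_const_mul]
      simp only [mul_assoc]
    · simp [duhamelKernel, hst]
  simp_rw [e]
  rw [setIntegral_indicator measurableSet_Iio, Ioo_inter_Iio, min_eq_right htR]
  rfl

/-- The Duhamel term is continuous in time with values in `L^r`. -/
lemma tendsto_eLpNorm_duhamelTerm_sub {r : ℝ≥0∞} (hr : 1 ≤ r) {C : ℝ≥0∞} (hC : C ≠ ∞)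
    (hφC : ∀ s, 0 ≤ s → eLpNorm (φ s) r volume ≤ C) (t : ℝ) :
    Tendsto (fun t' => eLpNorm (duhamelTerm α β k φ t' - duhamelTerm α β k φ t) r volume)
      (𝓝 t) (𝓝 0) := by
  have h1 := ENNReal.Tendsto.mul_const (b := C) (ENNReal.tendsto_ofReal
    (tendsto_integral_abs_duhamelKernel_sub (N := N) hα0 hα2 hβ hk (R := t + 1) (t := t)))
    (Or.inr hC)
  rw [ENNReal.ofReal_zero, zero_mul] at h1
  refine tendsto_of_tendsto_of_tendsto_of_le_of_le' tendsto_const_nhds h1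
    (Eventually.of_forall fun _ => zero_le) ?_
  filter_upwards [gt_mem_nhds (show t < t + 1 by linarith)] with t' ht'
  have hm : Measurable (Function.uncurry fun (q : ℝ × RN N) (x : RN N) => φ q.1 (x - q.2)) :=
    hφ.comp (f := fun z : (ℝ × RN N) × RN N => (z.1.1, z.2 - z.1.2)) (by fun_prop)
  have hq : ∀ᵐ q : ℝ × RN N ∂((volume.restrict (Ioo 0 (t + 1))).prod volume), q.1 ∈ Ioo 0 (t + 1) :=
    Measure.quasiMeasurePreserving_fst.ae (ae_restrict_mem measurableSet_Ioo)
  have h := eLpNorm_integral_mul_le (μ := volume) hr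
    (k := fun q => duhamelKernel N α β k t' q - duhamelKernel N α β k t q)
    ((measurable_duhamelKernel hk t').sub (measurable_duhamelKernel hk t))
    ((integrable_duhamelKernel hα0 hα2 hβ hk (t + 1) t').sub
      (integrable_duhamelKernel hα0 hα2 hβ hk (t + 1) t)) hm (C := C) (by
        filter_upwards [hq] with q hq
        have hφq : Measurable (φ q.1) := hφ.comp (measurable_const.prodMk measurable_id)
        rw [eLpNorm_comp_sub_right hφq.aestronglyMeasurable]
        exact hφC _ hq.1.le)
  refine le_of_eq_of_le ?_ h
  congr 1
  funext x
  rw [Pi.sub_apply, duhamelTerm_eq hα0 hα2 hβ hk hφ hB (le_of_lt ht') x,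
    duhamelTerm_eq hα0 hα2 hβ hk hφ hB (show t ≤ t + 1 by linarith) x, ← integral_sub
    (integrable_duhamelKernel_mul hα0 hα2 hβ hk hφ hB _ t' x)
    (integrable_duhamelKernel_mul hα0 hα2 hβ hk hφ hB _ t x)]
  simp only [sub_mul]

end

/-! ### Assembly -/

lemma IsMildSolution.mono {α β p : ℝ} {h : ℝ → ℝ} {u₀ : RN N → ℝ} {I J : Set ℝ}
    {u : ℝ → RN N → ℝ} (hu : IsMildSolution α β p h u₀ I u) (hJ : J ⊆ I) :
    IsMildSolution α β p h u₀ J u where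
  aestronglyMeasurable := hu.aestronglyMeasurable.mono_ac
    ((Measure.restrict_mono hJ le_rfl).absolutelyContinuous.prod Measure.AbsolutelyContinuous.rfl)
  memLp t ht := hu.memLp t (hJ ht)
  bounded T hT := hu.bounded T (hJ hT)
  duhamel t ht := hu.duhamel t (hJ ht)

/-- The weight `h` is only a.e. measurable on `(0,∞)` and arbitrary elsewhere. The absolute value of
a Borel version, extended by zero, is a globally usable substitute, and the Duhamel integral sees
only `s > 0` up to null sets. -/
lemma exists_isWeight {h : ℝ → ℝ} (h_pos : ∀ t, 0 < t → 0 < h t)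
    (h_int : ∀ T, 0 < T → IntegrableOn h (Ioo 0 T) volume) :
    ∃ k, IsWeight k ∧ ∀ᵐ s, 0 < s → h s = k s := by
  have hU : Ioi (0 : ℝ) = ⋃ n : ℕ, Ioo (0 : ℝ) (n + 1) := by
    ext s
    simp only [mem_Ioi, mem_iUnion, mem_Ioo]
    refine ⟨fun hs => ?_, fun ⟨n, hn⟩ => hn.1⟩
    obtain ⟨n, hn⟩ := exists_nat_gt s
    exact ⟨n, hs, by linarith⟩
  have hm : AEStronglyMeasurable h (volume.restrict (Ioi 0)) := by
    rw [hU, aestronglyMeasurable_iUnion_iff]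
    exact fun n => (h_int _ (by positivity)).aestronglyMeasurable
  have heq : ∀ᵐ s, s ∈ Ioi (0 : ℝ) → h s = hm.mk h s :=
    (ae_restrict_iff' measurableSet_Ioi).1 hm.ae_eq_mk
  set k : ℝ → ℝ := (Ioi 0).indicator fun s => |hm.mk h s| with hk
  have hkm : Measurable k := by
    have : Measurable fun s => |hm.mk h s| := hm.stronglyMeasurable_mk.measurable.norm
    exact this.indicator measurableSet_Ioi
  have hhk : ∀ᵐ s, 0 < s → h s = k s := by
    filter_upwards [heq] with s hs hs0
    rw [hk, indicator_of_mem (mem_Ioi.2 hs0), ← hs hs0, abs_of_pos (h_pos s hs0)]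
  refine ⟨k, ⟨hkm, fun s => indicator_nonneg (fun _ _ => abs_nonneg _) s, fun a b => ?_⟩, hhk⟩
  have hR : ∀ R : ℝ, 0 < R → IntegrableOn k (Ioc (-R) R) := by
    intro R hR
    have h0 : IntegrableOn k (Ioc (-R) 0) := by
      refine (integrableOn_zero (ε' := ℝ)).congr_fun (fun s hs => ?_) measurableSet_Ioc
      rw [hk, indicator_of_notMem (by simpa using hs.2)]
    have h1 : IntegrableOn k (Ioc 0 R) := by
      rw [integrableOn_Ioc_iff_integrableOn_Ioo]
      refine (h_int R hR).congr_fun_ae ?_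
      filter_upwards [ae_restrict_of_ae hhk, ae_restrict_mem measurableSet_Ioo] with s hs hs'
      exact hs hs'.1
    rw [← Ioc_union_Ioc_eq_Ioc (neg_nonpos.2 hR.le) hR.le]
    exact h0.union h1
  have hpos : 0 < max |a| |b| + 1 := by positivity
  refine IntervalIntegrable.mono_set (a := -(max |a| |b| + 1)) (b := max |a| |b| + 1) ?_ ?_
  · rw [intervalIntegrable_iff_integrableOn_Ioc_of_le (by linarith)]
    exact hR _ hpos
  · rw [uIcc_of_le (show -(max |a| |b| + 1) ≤ max |a| |b| + 1 by linarith)]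
    refine uIcc_subset_Icc ⟨?_, ?_⟩ ⟨?_, ?_⟩
    · linarith [neg_abs_le a, le_max_left |a| |b|]
    · linarith [le_abs_self a, le_max_left |a| |b|]
    · linarith [neg_abs_le b, le_max_right |a| |b|]
    · linarith [le_abs_self b, le_max_right |a| |b|]

/-- Truncating a Borel version at the essential bound, and at `0` when the datum is nonnegative,
makes all bounds hold everywhere, so the monotone iteration can be run pointwise. -/
lemma exists_bounded_representative {u₀ : RN N → ℝ} (hu₀ : MemLp u₀ ∞ volume) :
    ∃ (a : RN N → ℝ) (M : ℝ), Measurable a ∧ (∀ y, |a y| ≤ M) ∧ u₀ =ᵐ[volume] a ∧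
      ((∀ᵐ x, 0 ≤ u₀ x) → ∀ y, 0 ≤ a y) := by
  set M := (eLpNorm u₀ ∞ volume).toReal with hM
  have hM0 : 0 ≤ M := ENNReal.toReal_nonneg
  have hbd : ∀ᵐ x, |u₀ x| ≤ M := by
    have hne := hu₀.eLpNorm_ne_top
    rw [hM]
    simp only [eLpNorm_exponent_top] at hne ⊢
    filter_upwards [ae_le_eLpNormEssSup (f := u₀) (μ := volume)] with x hx
    have := ENNReal.toReal_mono hne hx
    simpa using this
  set b := hu₀.aestronglyMeasurable.mk u₀ with hb
  have hbm : Measurable b := hu₀.aestronglyMeasurable.stronglyMeasurable_mk.measurable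
  have hub : u₀ =ᵐ[volume] b := hu₀.aestronglyMeasurable.ae_eq_mk
  by_cases hpos : ∀ᵐ x, 0 ≤ u₀ x
  · refine ⟨fun y => max 0 (min (b y) M), M, measurable_const.max (hbm.min measurable_const),
      fun y => ?_, ?_, fun _ y => le_max_left _ _⟩
    · rw [abs_of_nonneg (le_max_left _ _)]
      exact max_le hM0 (min_le_right _ _)
    · filter_upwards [hub, hbd, hpos] with x h1 h2 h3
      rw [← h1, min_eq_left ((le_abs_self _).trans h2), max_eq_right h3]
  · refine ⟨fun y => max (-M) (min (b y) M), M, measurable_const.max (hbm.min measurable_const),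
      fun y => ?_, ?_, fun h => absurd h hpos⟩
    · exact abs_le.2 ⟨le_max_left _ _, max_le (by linarith) (min_le_right _ _)⟩
    · filter_upwards [hub, hbd] with x h1 h2
      rw [abs_le] at h2
      rw [← h1, min_eq_left h2.2, max_eq_right h2.1]

lemma evolution_congr_ae {α β t : ℝ} {v w : RN N → ℝ} (hβ : 0 ≤ β) (ht : 0 ≤ t)
    (h : v =ᵐ[volume] w) : evolution α β t 0 v =ᵐ[volume] evolution α β t 0 w := by
  rcases ht.eq_or_lt with rfl | ht
  · rwa [evolution_self, evolution_self]
  · rw [evolution_of_lt hβ le_rfl ht, evolution_of_lt hβ le_rfl ht, propagate_congr_ae h]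

/-- The nonlinearity is absorbing, so that a bounded initial value has a global solution, which is
dominated by the linear evolution of its absolute value. -/
theorem exists_global_solution {α β p : ℝ} (hα0 : 0 < α) (hα2 : α < 2) (hβ : 0 ≤ β) (hp : 1 < p)
    {h k : ℝ → ℝ} (hk : IsWeight k) (hhk : ∀ᵐ s, 0 < s → h s = k s) {u₀ a : RN N → ℝ} {M : ℝ}
    (ha : Measurable a) (haM : ∀ y, |a y| ≤ M) (hua : u₀ =ᵐ[volume] a) :
    ∃ u : ℝ → RN N → ℝ, Measurable (Function.uncurry u) ∧
      (∀ t, 0 ≤ t → ∀ x, |u t x| ≤ evolution α β t 0 (fun y => |a y|) x) ∧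
      (∀ t, 0 ≤ t → ∀ x, u t x
        = evolution α β t 0 a x - duhamelTerm α β k (fun s y => oddPow p (u s y)) t x) ∧
      ((∀ y, 0 ≤ a y) → ∀ t, 0 ≤ t → ∀ x, 0 ≤ u t x) ∧
      IsMildSolution α β p h u₀ (Ici 0) u := by
  obtain ⟨u, hu, huA, hfix, hnn⟩ :=
    exists_relaxedMap_fixedPoint (N := N) hα0 hα2 hβ hp hk ha haM
  have hD : ∀ t, 0 ≤ t → ∀ x, u t x
      = evolution α β t 0 a x - duhamelTerm α β k (fun s y => oddPow p (u s y)) t x :=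
    fun t ht x => duhamel_of_relaxed hα0 hα2 hβ hp hk ha haM hu huA hfix ht x
  have huM : ∀ t, 0 ≤ t → ∀ x, |u t x| ≤ M := fun t ht x =>
    abs_le_of_le_evolution hα0 hα2 hβ haM ht (huA t ht) x
  refine ⟨u, hu, huA, hD, hnn, hu.aestronglyMeasurable, fun t ht => ?_, fun T _ => ⟨M, fun t ht =>
    ae_of_all _ (huM t ht.1)⟩, fun t ht => ?_⟩
  · exact memLp_top_of_bound
      (hu.comp (measurable_const.prodMk measurable_id)).aestronglyMeasurable M
      (ae_of_all _ (huM t ht))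
  · filter_upwards [evolution_congr_ae (α := α) hβ ht hua] with x hx
    rw [setIntegral_duhamel hβ hhk ht, hx]
    exact hD t ht x

section

variable {α β p M : ℝ} (hα0 : 0 < α) (hα2 : α < 2) (hβ : 0 ≤ β) (hp : 1 < p) {k : ℝ → ℝ}
  (hk : IsWeight k) {a : RN N → ℝ} (ha : Measurable a) (haM : ∀ y, |a y| ≤ M)
  {u : ℝ → RN N → ℝ} (hu : Measurable (Function.uncurry u))
  (huA : ∀ t, 0 ≤ t → ∀ x, |u t x| ≤ evolution α β t 0 (fun y => |a y|) x)
  (hD : ∀ t, 0 ≤ t → ∀ x, u t x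
    = evolution α β t 0 a x - duhamelTerm α β k (fun s y => oddPow p (u s y)) t x)

include hα0 hα2 hβ ha haM hu huA

omit haM hu in
-- Pointwise domination by the linear evolution and its contractivity in `L^r` propagate the
-- integrability of the datum for all time.
lemma eLpNorm_le_of_le_evolution {r : ℝ≥0∞} (hr : 1 ≤ r) {t : ℝ} (ht : 0 ≤ t) :
    eLpNorm (u t) r volume ≤ eLpNorm a r volume := by
  have ham : Measurable fun y => |a y| := ha.norm
  refine (eLpNorm_mono_real (huA t ht)).trans
    ((eLpNorm_evolution_le hα0 hα2 hβ ht hr ham).trans (le_of_eq ?_))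
  exact eLpNorm_norm a

omit haM in
lemma memLp_of_le_evolution {r : ℝ≥0∞} (hr : 1 ≤ r) (har : eLpNorm a r volume ≠ ∞) {t : ℝ}
    (ht : 0 ≤ t) : MemLp (u t) r volume :=
  ⟨(hu.comp (measurable_const.prodMk measurable_id)).aestronglyMeasurable,
    (eLpNorm_le_of_le_evolution hα0 hα2 hβ ha huA hr ht).trans_lt har.lt_top⟩

include hp hk

lemma tendsto_eLpNorm_duhamelTerm_oddPow {r : ℝ≥0∞} (hr : 1 ≤ r) (har : eLpNorm a r volume ≠ ∞)
    (t : ℝ) : Tendsto (fun t' => eLpNorm (duhamelTerm α β k (fun s y => oddPow p (u s y)) t'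
      - duhamelTerm α β k (fun s y => oddPow p (u s y)) t) r volume) (𝓝 t) (𝓝 0) := by
  have hM : 0 ≤ M := (abs_nonneg _).trans (haM 0)
  have huM : ∀ t, 0 ≤ t → ∀ x, |u t x| ≤ M := fun t ht x =>
    abs_le_of_le_evolution hα0 hα2 hβ haM ht (huA t ht) x
  refine tendsto_eLpNorm_duhamelTerm_sub (φ := fun s y => oddPow p (u s y)) hα0 hα2 hβ hk
    ((measurable_oddPow p).comp hu)
    (B := M ^ (p - 1) * M) (fun s hs y => (abs_oddPow_le hp (huM s hs y)).trans
      (mul_le_mul_of_nonneg_left (huM s hs y) (by positivity))) hr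
    (C := ENNReal.ofReal (M ^ (p - 1)) * eLpNorm a r volume)
    (ENNReal.mul_ne_top ENNReal.ofReal_ne_top har) (fun s hs => ?_) t
  have hle : ∀ y, ‖oddPow p (u s y)‖ ≤ M ^ (p - 1) * ‖u s y‖ := fun y =>
    abs_oddPow_le hp (huM s hs y)
  refine (eLpNorm_le_mul_eLpNorm_of_ae_le_mul (ae_of_all _ hle) r).trans ?_
  exact mul_le_mul' le_rfl (eLpNorm_le_of_le_evolution hα0 hα2 hβ ha huA hr hs)

include hD

lemma tendsto_eLpNorm_sub_of_evolution {r : ℝ≥0∞} (hr : 1 ≤ r) (har : eLpNorm a r volume ≠ ∞)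
    {J : Set ℝ} (hJ : J ⊆ Ici 0) {t : ℝ} (ht : t ∈ J)
    (hlin : Tendsto (fun s => eLpNorm (evolution α β s 0 a - evolution α β t 0 a) r volume)
      (𝓝[J] t) (𝓝 0)) :
    Tendsto (fun s => eLpNorm (u s - u t) r volume) (𝓝[J] t) (𝓝 0) := by
  have hm : Measurable (Function.uncurry fun s y => oddPow p (u s y)) :=
    (measurable_oddPow p).comp hu
  have h1 := hlin.add ((tendsto_eLpNorm_duhamelTerm_oddPow hα0 hα2 hβ hp hk ha haM hu huA hr har
    t).mono_left (nhdsWithin_le_nhds (s := J)))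
  rw [add_zero] at h1
  refine tendsto_of_tendsto_of_tendsto_of_le_of_le' tendsto_const_nhds h1
    (Eventually.of_forall fun _ => zero_le) ?_
  filter_upwards [self_mem_nhdsWithin] with s hs
  have hev : ∀ s, Measurable (evolution α β s 0 a) := fun s =>
    (measurable_evolution ha).comp (f := fun y : RN N => (s, y)) (by fun_prop)
  have e : u s - u t = (evolution α β s 0 a - evolution α β t 0 a)
      - (duhamelTerm α β k (fun s y => oddPow p (u s y)) s
        - duhamelTerm α β k (fun s y => oddPow p (u s y)) t) := by
    funext x
    simp only [Pi.sub_apply]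
    rw [hD s (hJ hs) x, hD t (hJ ht) x]
    ring
  rw [e]
  exact eLpNorm_sub_le ((hev s).sub (hev t)).aestronglyMeasurable
    ((measurable_duhamelTerm hk hm s).sub (measurable_duhamelTerm hk hm t)).aestronglyMeasurable hr

lemma continuousInLp_of_pos {r : ℝ≥0∞} (hr : 1 ≤ r) (har : eLpNorm a r volume ≠ ∞) :
    ContinuousInLp r (Ici 0 \ {0}) u := by
  refine ⟨fun t ht => memLp_of_le_evolution hα0 hα2 hβ ha hu huA hr har ht.1, fun t ht => ?_⟩
  have ht0 : 0 < t := lt_of_le_of_ne ht.1 fun h => ht.2 h.symm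
  exact tendsto_eLpNorm_sub_of_evolution hα0 hα2 hβ hp hk ha haM hu huA hD hr har sdiff_subset ht
    ((tendsto_eLpNorm_evolution_sub hα0 hα2 hβ ht0 hr ha haM har).mono_left nhdsWithin_le_nhds)

lemma continuousInLp_of_translation {r : ℝ≥0∞} (hr : 1 ≤ r) (har : eLpNorm a r volume ≠ ∞)
    (htr : Tendsto (fun y : RN N => eLpNorm (fun x => a (x - y) - a x) r volume) (𝓝 0) (𝓝 0)) :
    ContinuousInLp r (Ici 0) u := by
  refine ⟨fun t ht => memLp_of_le_evolution hα0 hα2 hβ ha hu huA hr har ht, fun t ht => ?_⟩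
  refine tendsto_eLpNorm_sub_of_evolution hα0 hα2 hβ hp hk ha haM hu huA hD hr har subset_rfl ht ?_
  rcases (show (0 : ℝ) ≤ t from ht).eq_or_lt with rfl | ht0
  -- At time `0` the neighbourhood filter in `[0,∞)` splits into the point itself, where the
  -- difference vanishes, and the right-hand limit.
  · rw [← Ioi_insert, nhdsWithin_insert, tendsto_sup, tendsto_pure_left]
    refine ⟨fun s hs => by simpa using mem_of_mem_nhds hs, ?_⟩
    rw [evolution_self]
    exact tendsto_eLpNorm_evolution_sub_zero hα0 hα2 hβ hr ha haM har htr
  · exact (tendsto_eLpNorm_evolution_sub hα0 hα2 hβ ht0 hr ha haM har).mono_left nhdsWithin_le_nhds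

lemma continuousInLp_sub_evolution {u₀ : RN N → ℝ} (hua : u₀ =ᵐ[volume] a) :
    ContinuousInLp ∞ (Ici 0) fun t => u t - evolution α β t 0 u₀ := by
  have har : eLpNorm a ∞ volume ≠ ∞ :=
    (memLp_top_of_bound ha.aestronglyMeasurable M (ae_of_all _ haM)).eLpNorm_ne_top
  have hm : Measurable (Function.uncurry fun s y => oddPow p (u s y)) :=
    (measurable_oddPow p).comp hu
  have hev : ∀ s, Measurable (evolution α β s 0 a) := fun s =>
    (measurable_evolution ha).comp (f := fun y : RN N => (s, y)) (by fun_prop)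
  have he : ∀ t, 0 ≤ t → (u t - evolution α β t 0 u₀ : RN N → ℝ) =ᵐ[volume]
      -duhamelTerm α β k (fun s y => oddPow p (u s y)) t := fun t ht => by
    filter_upwards [evolution_congr_ae (α := α) hβ ht hua] with x hx
    rw [Pi.sub_apply, Pi.neg_apply, hx, hD t ht x]
    ring
  constructor
  · intro t ht
    refine (MemLp.sub (memLp_of_le_evolution hα0 hα2 hβ ha hu huA le_top har ht)
      (g := evolution α β t 0 a) ⟨(hev t).aestronglyMeasurable,
        (eLpNorm_evolution_le hα0 hα2 hβ ht le_top ha).trans_lt har.lt_top⟩).ae_eq ?_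
    filter_upwards [evolution_congr_ae (α := α) hβ ht hua] with x hx
    rw [Pi.sub_apply, Pi.sub_apply, hx]
  · intro t ht
    refine ((tendsto_eLpNorm_duhamelTerm_oddPow hα0 hα2 hβ hp hk ha haM hu huA le_top har
      t).mono_left (nhdsWithin_le_nhds (s := Ici 0))).congr' ?_
    filter_upwards [self_mem_nhdsWithin] with s hs
    rw [← eLpNorm_neg]
    refine eLpNorm_congr_ae ?_
    filter_upwards [he s hs, he t ht] with x h1 h2
    simp only [Pi.sub_apply, Pi.neg_apply] at h1 h2 ⊢
    rw [h1, h2]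
    ring

end

end MixedDiffusion

end

theorem theorem2p1 (N : ℕ) (hN : 1 ≤ N) (α β p : ℝ) (hα0 : 0 < α) (hα2 : α < 2)
    (hβ : 0 ≤ β) (hp : 1 < p) (h : ℝ → ℝ) (h_pos : ∀ t, 0 < t → 0 < h t)
    (h_int : ∀ T, 0 < T → IntegrableOn h (Ioo 0 T) volume)
    (u₀ : MixedDiffusion.RN N → ℝ) (hu₀ : MemLp u₀ ∞ volume) :
    ∃ (T : ℝ) (w : ℝ → MixedDiffusion.RN N → ℝ),
      -- local existence and uniqueness on `[0,T]`
      0 < T ∧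
      MixedDiffusion.IsMildSolution α β p h u₀ (Icc 0 T) w ∧
      (∀ v, MixedDiffusion.IsMildSolution α β p h u₀ (Icc 0 T) v →
        ∀ t ∈ Icc 0 T, v t =ᵐ[volume] w t) ∧
      ENNReal.ofReal T < MixedDiffusion.maximalTime α β p h u₀ ∧
      -- unique continuation to `[0,T_m)`
      ∃ u : ℝ → MixedDiffusion.RN N → ℝ,
        (∀ t ∈ Icc 0 T, u t =ᵐ[volume] w t) ∧
        MixedDiffusion.IsMildSolution α β p h u₀
          (MixedDiffusion.timesBefore (MixedDiffusion.maximalTime α β p h u₀)) u ∧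
        (∀ v, MixedDiffusion.IsMildSolution α β p h u₀
            (MixedDiffusion.timesBefore (MixedDiffusion.maximalTime α β p h u₀)) v →
          ∀ t ∈ MixedDiffusion.timesBefore (MixedDiffusion.maximalTime α β p h u₀),
            v t =ᵐ[volume] u t) ∧
        -- maximality: every solution on a compact interval is a restriction of `u`
        (∀ (T' : ℝ) (v : ℝ → MixedDiffusion.RN N → ℝ), 0 < T' →
          MixedDiffusion.IsMildSolution α β p h u₀ (Icc 0 T') v →
            ENNReal.ofReal T' < MixedDiffusion.maximalTime α β p h u₀ ∧
            ∀ t ∈ Icc 0 T', v t =ᵐ[volume] u t) ∧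
        -- global solution if `T_m = ∞`
        (MixedDiffusion.maximalTime α β p h u₀ = ∞ →
          MixedDiffusion.IsMildSolution α β p h u₀ (Ici 0) u) ∧
        -- blow-up if `T_m < ∞`
        (MixedDiffusion.maximalTime α β p h u₀ < ∞ →
          Tendsto (fun t => (eLpNorm (u t) ∞ volume).toReal)
            (𝓝[<] (MixedDiffusion.maximalTime α β p h u₀).toReal) atTop) ∧
        -- nonnegativity
        ((∀ᵐ x, 0 ≤ u₀ x) →
          ∀ t ∈ MixedDiffusion.timesBefore (MixedDiffusion.maximalTime α β p h u₀),
            ∀ᵐ x, 0 ≤ u t x) ∧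
        -- continuity in `L^∞`: for positive times, and up to `t = 0` after subtracting the
        -- linear evolution or for uniformly continuous data
        MixedDiffusion.ContinuousInLp ∞
          (MixedDiffusion.timesBefore (MixedDiffusion.maximalTime α β p h u₀) \ {0}) u ∧
        MixedDiffusion.ContinuousInLp ∞
          (MixedDiffusion.timesBefore (MixedDiffusion.maximalTime α β p h u₀))
          (fun t => u t - MixedDiffusion.evolution α β t 0 u₀) ∧
        ((∃ g : MixedDiffusion.RN N → ℝ, UniformContinuous g ∧ u₀ =ᵐ[volume] g) →
          MixedDiffusion.ContinuousInLp ∞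
            (MixedDiffusion.timesBefore (MixedDiffusion.maximalTime α β p h u₀)) u) ∧
        -- continuity in `L^r`
        (∀ r : ℝ≥0∞, 1 ≤ r → r ≠ ∞ → MemLp u₀ r volume →
          MixedDiffusion.ContinuousInLp r
            (MixedDiffusion.timesBefore (MixedDiffusion.maximalTime α β p h u₀)) u) := by

  obtain ⟨k, hk, hhk⟩ := MixedDiffusion.exists_isWeight h_pos h_int
  obtain ⟨a, M, ha, haM, hua, hnn⟩ := MixedDiffusion.exists_bounded_representative hu₀
  obtain ⟨u, hu, huA, hD, hunn, hsol⟩ :=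
    MixedDiffusion.exists_global_solution hα0 hα2 hβ hp hk hhk ha haM hua
  have huniq : ∀ {T : ℝ} {v : ℝ → MixedDiffusion.RN N → ℝ},
      MixedDiffusion.IsMildSolution α β p h u₀ (Icc 0 T) v → ∀ t ∈ Icc 0 T,
        v t =ᵐ[volume] u t := fun {T v} hv t ht =>
    hv.unique hα0 hα2 hβ hp hk hhk (hsol.mono Icc_subset_Ici_self) ht
  -- The global solution restricts to every `[0,T]`, so the supremum is infinite.
  have hTm : MixedDiffusion.maximalTime α β p h u₀ = ∞ := by
    refine ENNReal.eq_top_of_forall_nnreal_le fun r => ?_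
    refine le_trans ?_ (le_sSup (⟨(r : ℝ) + 1, by positivity, rfl, u,
      hsol.mono Icc_subset_Ici_self⟩))
    rw [← ENNReal.ofReal_coe_nnreal]
    exact ENNReal.ofReal_le_ofReal (by linarith)
  have hI : MixedDiffusion.timesBefore ∞ = Ici 0 := by
    ext t
    simp [MixedDiffusion.timesBefore]
  have har : ∀ {r : ℝ≥0∞}, MemLp u₀ r volume → eLpNorm a r volume ≠ ∞ := fun {r} hr => by
    rw [← eLpNorm_congr_ae hua]
    exact hr.eLpNorm_ne_top
  rw [hTm, hI]
  -- Any positive time would serve in place of `1`; with `T_m = ∞` the bounds on existence times are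
  -- immediate and the blow-up hypothesis is contradictory.
  refine ⟨1, u, one_pos, hsol.mono Icc_subset_Ici_self, fun v hv => huniq hv,
    ENNReal.ofReal_lt_top, u, fun t _ => Eventually.of_forall fun x => rfl, hsol,
    fun v hv t ht => huniq (hv.mono Icc_subset_Ici_self) t ⟨ht, le_rfl⟩,
    fun T' v _ hv => ⟨ENNReal.ofReal_lt_top, huniq hv⟩, fun _ => hsol,
    fun hlt => absurd hlt (lt_irrefl _),
    fun h0 t ht => Eventually.of_forall (hunn (hnn h0) t ht),
    MixedDiffusion.continuousInLp_of_pos hα0 hα2 hβ hp hk ha haM hu huA hD le_top (har hu₀),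
    MixedDiffusion.continuousInLp_sub_evolution hα0 hα2 hβ hp hk ha haM hu huA hD hua, ?_, ?_⟩
  · rintro ⟨g, hg, hug⟩
    exact MixedDiffusion.continuousInLp_of_translation hα0 hα2 hβ hp hk ha haM hu huA hD le_top
      (har hu₀) (MixedDiffusion.tendsto_eLpNorm_translation_of_uniformContinuous hg
        (hua.symm.trans hug))
  · intro r hr hr' hur
    exact MixedDiffusion.continuousInLp_of_translation hα0 hα2 hβ hp hk ha haM hu huA hD hr
      (har hur) (MixedDiffusion.tendsto_eLpNorm_translation hr hr' (hur.ae_eq hua))
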